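/- Let $d\ge 2$ and let $\Omega\subset\mathbb R^d$ be a bounded Lipschitz domain. All function spaces are complex, except $L^\infty(\Omega)=L^\infty(\Omega;\mathbb R)$; put $L^\infty_+(\Omega)=\{\sigma\in L^\infty(\Omega): \operatorname{ess\,inf}\sigma>0\}$. Let $H^{1/2}(\partial\Omega)$ be the Sobolev–Slobodeckij space on $\partial\Omega$, let $H^{-1/2}(\partial\Omega)$ be its (conjugate-linear) dual with sesquilinear pairing $\langle\cdot,\cdot\rangle$, linear in the first argument, let $H^{1/2}_\diamond(\partial\Omega)$ be the subspace of functions of vanishing mean in $H^{1/2}(\partial\Omega)$, and let $H^{-1/2}_\diamond(\partial\Omega)=\{f\in H^{-1/2}(\partial\Omega):\langle f,1\rangle=0\}$. Equip $H^1(\Omega)/\mathbb C$ with the quotient norm $\inf_{c\in\mathbb C}\|u-c\|_{H^1(\Omega)}$. For $\sigma\in L^\infty_+(\Omega)$, $\eta\in L^\infty(\Omega)$ define the following maps. - $N(\sigma)\colon H^{-1/2}_\diamond(\partial\Omega)\to H^1(\Omega)/\mathbb C$ is the bounded operator that maps $f$ to the class of the solutions $u\in H^1(\Omega)$ of $\int_\Omega\sigma\nabla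 u\cdot\nabla\overline v\,dx=\langle f,v|_{\partial\Omega}\rangle$ for all $v\in H^1(\Omega)$. - $P(\sigma,\eta)\colon H^1(\Omega)/\mathbb C\to H^1(\Omega)/\mathbb C$ is the bounded operator that maps $\tilde u$ to the solution $w$ of $\int_\Omega\sigma\nabla w\cdot\nabla\overline v\,dx=-\int_\Omega\eta\nabla\tilde u\cdot\nabla\overline v\,dx$ for all $v\in H^1(\Omega)$. - $\mathrm{tr}\colon H^1(\Omega)/\mathbb C\to H^{1/2}_\diamond(\partial\Omega)$ is the bounded operator that maps the class of $v$ to the mean-free representative of $v|_{\partial\Omega}$ modulo constants. - $\Lambda(\sigma)\colon H^{-1/2}_\diamond(\partial\Omega)\to H^{1/2}_\diamond(\partial\Omega)$, the Neumann-to-Dirichlet map, is the bounded operator that maps $f$ to the mean-free trace $u|_{\partial\Omega}$ of a solution $u$ of the first problem. Then the trace $H^1(\Omega)\to H^{1/2}(\partial\Omega)$ and all these operators exist and are uniquely determined, $L^\infty_+(\Omega)$ is open in $L^\infty(\Omega)$, and the standard forward map $\sigma\mapsto\Lambda(\sigma)$, $L^\infty_+(\Omega)\to\mathscr L(H^{-1/2}_\diamond(\partial\Omega),H^{1/2}_\diamond(\partial\Omega))$,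 is infinitely many times continuously Fréchet differentiable. Its derivatives are $$D^k\Lambda(\sigma;\eta_1,\dots,\eta_k)=\sum_{\alpha}\mathrm{tr}\,P(\sigma,\eta_{\alpha_1})\cdots P(\sigma,\eta_{\alpha_k})N(\sigma),\qquad k\in\mathbb N_0,\ \sigma\in L^\infty_+(\Omega),\ \eta_1,\dots,\eta_k\in L^\infty(\Omega),$$ where $\alpha$ runs over all permutations of $\{1,\dots,k\}$. Moreover, the map is analytic on $L^\infty_+(\Omega)$, and $$\Lambda(\sigma+\eta)=\sum_{k=0}^\infty\frac1{k!}D^k\Lambda(\sigma;\eta,\dots,\eta)=\sum_{k=0}^\infty \mathrm{tr}\,P(\sigma,\eta)^kN(\sigma)$$ with convergence in $\mathscr L(H^{-1/2}_\diamond(\partial\Omega),H^{1/2}_\diamond(\partial\Omega))$, whenever $\sigma\in L^\infty_+(\Omega)$, $\eta\in L^\infty(\Omega)$, $\sigma+\eta\in L^\infty_+(\Omega)$ and $\|P(\sigma,\eta)\|_{\mathscr L(H^1(\Omega)/\mathbb C)}<1$. -/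

import Mathlib

open MeasureTheory
open scoped ENNReal

noncomputable section

namespace EIT

/-- `d`-dimensional Euclidean space. -/
abbrev Euc (d : ℕ) : Type := EuclideanSpace ℝ (Fin d)

variable {d : ℕ}

/-! ### Domains and conductivities -/

/-- A bounded Lipschitz domain: bounded, open, connected (in particular nonempty), and such that
near every boundary point, in suitable orthonormal coordinates `T y = (y', y_d)`, the set is the
part above the graph of a Lipschitz function `γ` of `y'`. -/
structure IsBoundedLipschitzDomain (Ω : Set (Euc d)) : Prop where
  isOpen : IsOpen Ω
  isConnected : IsConnected Ω
  isBounded : Bornology.IsBounded Ω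
  lipschitz_boundary : ∀ x ∈ frontier Ω,
    ∃ (T : Euc d ≃ₗᵢ[ℝ] WithLp 2 (Euc (d - 1) × ℝ)) (γ : Euc (d - 1) → ℝ) (K : NNReal) (r : ℝ),
      LipschitzWith K γ ∧ 0 < r ∧
        ∀ y ∈ Metric.ball x r, (y ∈ Ω ↔ γ (T y).fst < (T y).snd)

/-- `L^∞(Ω; ℝ)`. -/
abbrev LInf (Ω : Set (Euc d)) : Type := Lp ℝ ⊤ (volume.restrict Ω)

/-- `L^∞_+(Ω)`: the real essentially bounded functions with positive essential infimum. -/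
def LInfPos (Ω : Set (Euc d)) : Set (LInf Ω) :=
  {σ | ∃ c : ℝ, 0 < c ∧ ∀ᵐ x ∂(volume.restrict Ω), c ≤ σ x}

/-! ### Almost everywhere constant functions -/

/-- The almost everywhere constant functions in the complex space `L²(μ)`. -/
def constL2 {X : Type*} [MeasurableSpace X] (μ : Measure X) : Submodule ℂ (Lp ℂ 2 μ) where
  carrier := {g | ∃ c : ℂ, ∀ᵐ x ∂μ, g x = c}
  zero_mem' := ⟨0, by filter_upwards [Lp.coeFn_zero ℂ 2 μ] with x hx using hx⟩
  add_mem' := by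
    rintro g h ⟨a, ha⟩ ⟨b, hb⟩
    refine ⟨a + b, ?_⟩
    filter_upwards [Lp.coeFn_add g h, ha, hb] with x hx h1 h2
    rw [hx, Pi.add_apply, h1, h2]
  smul_mem' := by
    rintro c g ⟨a, ha⟩
    refine ⟨c * a, ?_⟩
    filter_upwards [Lp.coeFn_smul c g, ha] with x hx h1
    rw [hx, Pi.smul_apply, h1, smul_eq_mul]

theorem constL2_le_span {X : Type*} [MeasurableSpace X] (μ : Measure X) :
    ∃ g : Lp ℂ 2 μ, constL2 μ ≤ Submodule.span ℂ {g} := by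
  by_cases hex : ∃ g ∈ constL2 μ, g ≠ 0
  · obtain ⟨g, ⟨a, ha⟩, hg⟩ := hex
    have ha0 : a ≠ 0 := by
      rintro rfl
      exact hg ((Lp.eq_zero_iff_ae_eq_zero).2 ha)
    refine ⟨g, ?_⟩
    rintro h ⟨b, hb⟩
    refine Submodule.mem_span_singleton.2 ⟨b / a, ?_⟩
    refine Lp.ext ?_
    filter_upwards [Lp.coeFn_smul (b / a) g, ha, hb] with x hx h1 h2
    rw [hx, Pi.smul_apply, h1, h2, smul_eq_mul, div_mul_cancel₀ _ ha0]
  · refine ⟨0, fun h hh => ?_⟩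
    have : h = 0 := by
      by_contra h0
      exact hex ⟨h, hh, h0⟩
    rw [this]
    exact Submodule.zero_mem _

theorem isClosed_constL2 {X : Type*} [MeasurableSpace X] (μ : Measure X) :
    IsClosed (constL2 μ : Set (Lp ℂ 2 μ)) := by
  obtain ⟨g, hg⟩ := constL2_le_span μ
  have : FiniteDimensional ℂ (constL2 μ) := Submodule.finiteDimensional_of_le hg
  exact Submodule.closed_of_finiteDimensional _

/-! ### The Sobolev space `H¹(Ω)` and its quotient by the constants -/

/-- `G` is the weak gradient of `u` on `Ω`. -/
def IsWeakGradient (Ω : Set (Euc d)) (u : Euc d → ℂ) (G : Euc d → EuclideanSpace ℂ (Fin d)) :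
    Prop :=
  ∀ φ : Euc d → ℝ, ContDiff ℝ (⊤ : ℕ∞) φ → HasCompactSupport φ → tsupport φ ⊆ Ω →
    ∀ i : Fin d,
      ∫ x in Ω, (fderiv ℝ φ x (EuclideanSpace.single i 1)) • u x = - ∫ x in Ω, φ x • (G x i)

theorem integrable_test_smul {μ : Measure (Euc d)} [IsFiniteMeasureOnCompacts μ]
    {ψ : Euc d → ℝ} (hψ : Continuous ψ) (hc : HasCompactSupport ψ) {u : Euc d → ℂ}
    (hu : MemLp u 2 μ) : Integrable (fun x => ψ x • u x) μ := by
  have h1 : MemLp ψ 2 μ := hψ.memLp_of_hasCompactSupport hc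
  exact memLp_one_iff_integrable.1 (hu.smul h1)

theorem memLp_coord {μ : Measure (Euc d)} {G : Euc d → EuclideanSpace ℂ (Fin d)}
    (hG : MemLp G 2 μ) (i : Fin d) : MemLp (fun x => G x i) 2 μ :=
  (EuclideanSpace.proj (𝕜 := ℂ) i).comp_memLp' hG

/-- The pairs of a square integrable function on `Ω` and its square integrable weak gradient. -/
def h1Submodule (Ω : Set (Euc d)) : Submodule ℂ
    (WithLp 2 (Lp ℂ 2 (volume.restrict Ω) × Lp (EuclideanSpace ℂ (Fin d)) 2 (volume.restrict Ω)))
    where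
  carrier := {p | IsWeakGradient Ω p.fst p.snd}
  zero_mem' := by
    intro φ hφ hc hs i
    have h1 : ∫ x in Ω, (fderiv ℝ φ x (EuclideanSpace.single i 1)) •
        ((0 : Lp ℂ 2 (volume.restrict Ω)) x) = 0 := by
      refine integral_eq_zero_of_ae ?_
      filter_upwards [Lp.coeFn_zero ℂ 2 (volume.restrict Ω)] with x hx
      rw [hx]; simp
    have h2 : ∫ x in Ω, φ x •
        ((0 : Lp (EuclideanSpace ℂ (Fin d)) 2 (volume.restrict Ω)) x i) = 0 := by
      refine integral_eq_zero_of_ae ?_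
      filter_upwards [Lp.coeFn_zero (EuclideanSpace ℂ (Fin d)) 2 (volume.restrict Ω)] with x hx
      rw [hx]; simp
    exact h1.trans ((neg_eq_zero.2 h2).symm)
  add_mem' := by
    intro p q hp hq φ hφ hc hs i
    have hφ1 : ContDiff ℝ 1 φ := hφ.of_le (by exact_mod_cast le_top)
    have hD : Continuous fun x => fderiv ℝ φ x (EuclideanSpace.single i 1) :=
      (hφ1.continuous_fderiv (by norm_num)).clm_apply continuous_const
    have hDc : HasCompactSupport fun x => fderiv ℝ φ x (EuclideanSpace.single i 1) :=
      hc.fderiv_apply ℝ _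
    have e1 : ∫ x in Ω, (fderiv ℝ φ x (EuclideanSpace.single i 1)) • (p + q).fst x
        = ∫ x in Ω, ((fderiv ℝ φ x (EuclideanSpace.single i 1)) • p.fst x
          + (fderiv ℝ φ x (EuclideanSpace.single i 1)) • q.fst x) := by
      refine integral_congr_ae ?_
      filter_upwards [Lp.coeFn_add p.fst q.fst] with x hx
      rw [WithLp.add_fst, hx, Pi.add_apply, smul_add]
    have e2 : ∫ x in Ω, φ x • ((p + q).snd x i)
        = ∫ x in Ω, (φ x • (p.snd x i) + φ x • (q.snd x i)) := by
      refine integral_congr_ae ?_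
      filter_upwards [Lp.coeFn_add p.snd q.snd] with x hx
      rw [WithLp.add_snd, hx, Pi.add_apply, PiLp.add_apply, smul_add]
    rw [e1, e2, integral_add, integral_add, hp φ hφ hc hs i, hq φ hφ hc hs i, neg_add]
    · exact integrable_test_smul hφ.continuous hc (memLp_coord (Lp.memLp p.snd) i)
    · exact integrable_test_smul hφ.continuous hc (memLp_coord (Lp.memLp q.snd) i)
    · exact integrable_test_smul hD hDc (Lp.memLp p.fst)
    · exact integrable_test_smul hD hDc (Lp.memLp q.fst)
  smul_mem' := by
    intro c p hp φ hφ hc hs i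
    have e1 : ∫ x in Ω, (fderiv ℝ φ x (EuclideanSpace.single i 1)) • (c • p).fst x
        = ∫ x in Ω, c • ((fderiv ℝ φ x (EuclideanSpace.single i 1)) • p.fst x) := by
      refine integral_congr_ae ?_
      filter_upwards [Lp.coeFn_smul c p.fst] with x hx
      rw [WithLp.smul_fst, hx, Pi.smul_apply, smul_comm]
    have e2 : ∫ x in Ω, φ x • ((c • p).snd x i) = ∫ x in Ω, c • (φ x • (p.snd x i)) := by
      refine integral_congr_ae ?_
      filter_upwards [Lp.coeFn_smul c p.snd] with x hx
      rw [WithLp.smul_snd, hx, Pi.smul_apply, PiLp.smul_apply, smul_comm]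
    rw [e1, e2, integral_smul, integral_smul, hp φ hφ hc hs i, smul_neg]

/-- The complex Sobolev space `H¹(Ω)` of square integrable functions with a square integrable weak
gradient, with the norm `‖u‖² = ‖u‖²_{L²(Ω)} + ‖∇u‖²_{L²(Ω)}`. -/
def H1 (Ω : Set (Euc d)) : Type := h1Submodule Ω

instance (Ω : Set (Euc d)) : NormedAddCommGroup (H1 Ω) :=
  inferInstanceAs (NormedAddCommGroup (h1Submodule Ω))

instance (Ω : Set (Euc d)) : InnerProductSpace ℂ (H1 Ω) :=
  inferInstanceAs (InnerProductSpace ℂ (h1Submodule Ω))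

/-- The underlying function of an element of `H¹(Ω)`. -/
def h1Fun {Ω : Set (Euc d)} (u : H1 Ω) : Lp ℂ 2 (volume.restrict Ω) :=
  (Subtype.val (p := fun p => p ∈ h1Submodule Ω) u).fst

/-- The weak gradient of an element of `H¹(Ω)`. -/
def h1Grad {Ω : Set (Euc d)} (u : H1 Ω) :
    Lp (EuclideanSpace ℂ (Fin d)) 2 (volume.restrict Ω) :=
  (Subtype.val (p := fun p => p ∈ h1Submodule Ω) u).snd

theorem continuous_h1Fun {Ω : Set (Euc d)} : Continuous (h1Fun (Ω := Ω)) :=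
  (WithLp.prod_continuous_ofLp 2 _ _).fst.comp continuous_subtype_val

/-- The constant functions in `H¹(Ω)`. -/
def constH1 (Ω : Set (Euc d)) : Submodule ℂ (H1 Ω) where
  carrier := {u | h1Fun u ∈ constL2 (volume.restrict Ω)}
  zero_mem' := (constL2 (volume.restrict Ω)).zero_mem
  add_mem' := fun hu hv => (constL2 (volume.restrict Ω)).add_mem hu hv
  smul_mem' := fun c _ hu => (constL2 (volume.restrict Ω)).smul_mem c hu

instance isClosed_constH1 (Ω : Set (Euc d)) : IsClosed (constH1 Ω : Set (H1 Ω)) :=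
  (isClosed_constL2 (volume.restrict Ω)).preimage continuous_h1Fun

/-- `H¹(Ω)/ℂ` with the quotient norm `inf_c ‖u - c‖_{H¹(Ω)}`. -/
def H1C (Ω : Set (Euc d)) : Type := H1 Ω ⧸ constH1 Ω

instance (Ω : Set (Euc d)) : NormedAddCommGroup (H1C Ω) :=
  inferInstanceAs (NormedAddCommGroup (H1 Ω ⧸ constH1 Ω))

instance (Ω : Set (Euc d)) : NormedSpace ℂ (H1C Ω) :=
  inferInstanceAs (NormedSpace ℂ (H1 Ω ⧸ constH1 Ω))

/-- The class in `H¹(Ω)/ℂ` of an element of `H¹(Ω)`. -/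
def h1Class {Ω : Set (Euc d)} (u : H1 Ω) : H1C Ω :=
  Submodule.Quotient.mk (p := constH1 Ω) u

/-- The sesquilinear form `∫_Ω s ∇u · conj(∇v) dx`. -/
def form {Ω : Set (Euc d)} (s : LInf Ω) (u v : H1 Ω) : ℂ :=
  ∫ x in Ω, (s x : ℂ) * inner ℂ (h1Grad v x) (h1Grad u x)

/-! ### Boundary spaces -/

/-- The surface measure on `∂Ω`. -/
def surf (Ω : Set (Euc d)) : Measure (Euc d) :=
  (Measure.euclideanHausdorffMeasure (d - 1)).restrict (frontier Ω)

/-- The pairs of a square integrable function `g` on `∂Ω` and a square integrable function on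
`∂Ω × ∂Ω` that equals `(g x - g y) / |x - y|^{d/2}` almost everywhere. -/
def h12Submodule (Ω : Set (Euc d)) : Submodule ℂ
    (WithLp 2 (Lp ℂ 2 (surf Ω) × Lp ℂ 2 ((surf Ω).prod (surf Ω)))) where
  carrier := {p | ∀ᵐ z ∂((surf Ω).prod (surf Ω)),
    p.snd z = ((‖z.1 - z.2‖ ^ (-(d : ℝ) / 2) : ℝ) : ℂ) * (p.fst z.1 - p.fst z.2)}
  zero_mem' := by
    have h := Lp.coeFn_zero ℂ 2 (surf Ω)
    filter_upwards [Lp.coeFn_zero ℂ 2 ((surf Ω).prod (surf Ω)),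
      Measure.quasiMeasurePreserving_fst.ae h, Measure.quasiMeasurePreserving_snd.ae h]
      with z h0 h1 h2
    have e1 : (0 : Lp ℂ 2 (surf Ω)) z.1 = 0 := h1
    have e2 : (0 : Lp ℂ 2 (surf Ω)) z.2 = 0 := h2
    rw [WithLp.zero_fst, WithLp.zero_snd, h0, e1, e2, sub_zero, mul_zero, Pi.zero_apply]
  add_mem' := by
    intro p q hp hq
    have h := Lp.coeFn_add p.fst q.fst
    filter_upwards [Lp.coeFn_add p.snd q.snd, hp, hq,
      Measure.quasiMeasurePreserving_fst.ae h, Measure.quasiMeasurePreserving_snd.ae h]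
      with z h0 hp hq h1 h2
    rw [WithLp.add_fst, WithLp.add_snd, h0, h1, h2]
    simp only [Pi.add_apply, hp, hq]
    ring
  smul_mem' := by
    intro c p hp
    have h := Lp.coeFn_smul c p.fst
    filter_upwards [Lp.coeFn_smul c p.snd, hp,
      Measure.quasiMeasurePreserving_fst.ae h, Measure.quasiMeasurePreserving_snd.ae h]
      with z h0 hp h1 h2
    rw [WithLp.smul_fst, WithLp.smul_snd, h0, h1, h2]
    simp only [Pi.smul_apply, hp, smul_eq_mul]
    ring

/-- The Sobolev–Slobodeckij space `H^{1/2}(∂Ω)` of functions on the `(d-1)`-dimensional set `∂Ω`,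
with `‖g‖² = ‖g‖²_{L²(∂Ω)} + ∬_{∂Ω × ∂Ω} |g x - g y|² / |x - y|^d dS(x) dS(y)`. -/
def H12 (Ω : Set (Euc d)) : Type := h12Submodule Ω

instance (Ω : Set (Euc d)) : NormedAddCommGroup (H12 Ω) :=
  inferInstanceAs (NormedAddCommGroup (h12Submodule Ω))

instance (Ω : Set (Euc d)) : InnerProductSpace ℂ (H12 Ω) :=
  inferInstanceAs (InnerProductSpace ℂ (h12Submodule Ω))

/-- The underlying `L²(∂Ω)` function of an element of `H^{1/2}(∂Ω)`. -/
def h12Fun {Ω : Set (Euc d)} (g : H12 Ω) : Lp ℂ 2 (surf Ω) :=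
  (Subtype.val (p := fun p => p ∈ h12Submodule Ω) g).fst

/-- The constant functions in `H^{1/2}(∂Ω)`. -/
def constH12 (Ω : Set (Euc d)) : Submodule ℂ (H12 Ω) where
  carrier := {g | h12Fun g ∈ constL2 (surf Ω)}
  zero_mem' := (constL2 (surf Ω)).zero_mem
  add_mem' := fun hu hv => (constL2 (surf Ω)).add_mem hu hv
  smul_mem' := fun c _ hu => (constL2 (surf Ω)).smul_mem c hu

/-- The elements of `H^{1/2}(∂Ω)` that are `L²(∂Ω)`-orthogonal to the constants. -/
def h12mSubmodule (Ω : Set (Euc d)) : Submodule ℂ (H12 Ω) where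
  carrier := {g | h12Fun g ∈ (constL2 (surf Ω))ᗮ}
  zero_mem' := (constL2 (surf Ω))ᗮ.zero_mem
  add_mem' := fun hu hv => (constL2 (surf Ω))ᗮ.add_mem hu hv
  smul_mem' := fun c _ hu => (constL2 (surf Ω))ᗮ.smul_mem c hu

/-- `H^{1/2}_⋄(∂Ω)`: the elements of `H^{1/2}(∂Ω)` of vanishing mean. -/
def H12m (Ω : Set (Euc d)) : Type := h12mSubmodule Ω

instance (Ω : Set (Euc d)) : NormedAddCommGroup (H12m Ω) :=
  inferInstanceAs (NormedAddCommGroup (h12mSubmodule Ω))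

instance (Ω : Set (Euc d)) : InnerProductSpace ℂ (H12m Ω) :=
  inferInstanceAs (InnerProductSpace ℂ (h12mSubmodule Ω))

/-- The inclusion `H^{1/2}_⋄(∂Ω) → H^{1/2}(∂Ω)`. -/
def h12mIncl {Ω : Set (Euc d)} (g : H12m Ω) : H12 Ω :=
  Subtype.val (p := fun p => p ∈ h12mSubmodule Ω) g

/-- `H^{-1/2}(∂Ω)`: the bounded conjugate-linear functionals on `H^{1/2}(∂Ω)`. The sesquilinear
dual pairing is `⟨f, g⟩ = f(g)`, linear in `f` and conjugate-linear in `g`. -/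
def Hneg12 (Ω : Set (Euc d)) : Type := H12 Ω →L⋆[ℂ] ℂ

instance (Ω : Set (Euc d)) : NormedAddCommGroup (Hneg12 Ω) :=
  inferInstanceAs (NormedAddCommGroup (H12 Ω →L⋆[ℂ] ℂ))

instance (Ω : Set (Euc d)) : NormedSpace ℂ (Hneg12 Ω) :=
  inferInstanceAs (NormedSpace ℂ (H12 Ω →L⋆[ℂ] ℂ))

/-- An element of `H^{-1/2}(∂Ω)` as a conjugate-linear functional. -/
def hneg12Functional {Ω : Set (Euc d)} (f : Hneg12 Ω) : H12 Ω →L⋆[ℂ] ℂ := f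

/-- The dual pairing `⟨f, g⟩` of `H^{-1/2}(∂Ω)` and `H^{1/2}(∂Ω)`. -/
def pairing {Ω : Set (Euc d)} (f : Hneg12 Ω) (g : H12 Ω) : ℂ := hneg12Functional f g

/-- The elements of `H^{-1/2}(∂Ω)` that vanish on the constants. -/
def hneg12mSubmodule (Ω : Set (Euc d)) : Submodule ℂ (Hneg12 Ω) where
  carrier := {f | ∀ g ∈ constH12 Ω, pairing f g = 0}
  zero_mem' := fun _ _ => rfl
  add_mem' := fun {f₁ f₂} h₁ h₂ g hg =>
    show pairing f₁ g + pairing f₂ g = 0 by rw [h₁ g hg, h₂ g hg, add_zero]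
  smul_mem' := fun c f h g hg =>
    show c • pairing f g = 0 by rw [h g hg, smul_zero]

/-- `H^{-1/2}_⋄(∂Ω)`: the elements `f` of `H^{-1/2}(∂Ω)` with `⟨f, 1⟩ = 0`. -/
def Hneg12m (Ω : Set (Euc d)) : Type := hneg12mSubmodule Ω

instance (Ω : Set (Euc d)) : NormedAddCommGroup (Hneg12m Ω) :=
  inferInstanceAs (NormedAddCommGroup (hneg12mSubmodule Ω))

instance (Ω : Set (Euc d)) : NormedSpace ℂ (Hneg12m Ω) :=
  inferInstanceAs (NormedSpace ℂ (hneg12mSubmodule Ω))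

/-- The inclusion `H^{-1/2}_⋄(∂Ω) → H^{-1/2}(∂Ω)`. -/
def hneg12mIncl {Ω : Set (Euc d)} (f : Hneg12m Ω) : Hneg12 Ω :=
  Subtype.val (p := fun f => f ∈ hneg12mSubmodule Ω) f

/-! ### Traces -/

/-- `T` is the trace operator `u ↦ u|_{∂Ω}`: a bounded operator `H¹(Ω) → H^{1/2}(∂Ω)` that
restricts functions smooth up to the boundary to their boundary values. -/
def IsTrace (Ω : Set (Euc d)) (T : H1 Ω →L[ℂ] H12 Ω) : Prop :=
  ∀ φ : Euc d → ℂ, ContDiff ℝ (⊤ : ℕ∞) φ → ∀ u : H1 Ω,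
    (∀ᵐ x ∂(volume.restrict Ω), h1Fun u x = φ x) → ∀ᵐ x ∂(surf Ω), h12Fun (T u) x = φ x

open Classical in
/-- The trace operator `H¹(Ω) → H^{1/2}(∂Ω)`. -/
def trace (Ω : Set (Euc d)) : H1 Ω →L[ℂ] H12 Ω :=
  if h : ∃ T, IsTrace Ω T then h.choose else 0

/-- `T` maps the class of `v` to the mean-free representative of the class of `v|_{∂Ω}` modulo
constants. -/
def IsMeanFreeTrace (Ω : Set (Euc d)) (T : H1C Ω →L[ℂ] H12m Ω) : Prop :=
  ∀ v : H1 Ω, trace Ω v - h12mIncl (T (h1Class v)) ∈ constH12 Ω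

open Classical in
/-- The trace map `tr : H¹(Ω)/ℂ → H^{1/2}_⋄(∂Ω)`. -/
def tr (Ω : Set (Euc d)) : H1C Ω →L[ℂ] H12m Ω :=
  if h : ∃ T, IsMeanFreeTrace Ω T then h.choose else 0

/-! ### The solution operators and the Neumann-to-Dirichlet map -/

/-- `u` is a weak solution of `∇ · (σ ∇u) = 0` in `Ω`, `σ ∂u/∂ν = f` on `∂Ω`. -/
def IsNeumannSolution {Ω : Set (Euc d)} (σ : LInf Ω) (f : Hneg12m Ω) (u : H1 Ω) : Prop :=
  ∀ v : H1 Ω, form σ u v = pairing (hneg12mIncl f) (trace Ω v)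

/-- `N` maps `f` to the class modulo constants of a solution of the Neumann problem. -/
def IsNeumannOperator {Ω : Set (Euc d)} (σ : LInf Ω) (N : Hneg12m Ω →L[ℂ] H1C Ω) : Prop :=
  ∀ f, ∃ u : H1 Ω, h1Class u = N f ∧ IsNeumannSolution σ f u

open Classical in
/-- `N(σ) : H^{-1/2}_⋄(∂Ω) → H¹(Ω)/ℂ`. -/
def neumannOp {Ω : Set (Euc d)} (σ : LInf Ω) : Hneg12m Ω →L[ℂ] H1C Ω :=
  if h : ∃ N, IsNeumannOperator σ N then h.choose else 0

/-- `P` maps the class of `u` to the class of a `w` with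
`∫_Ω σ ∇w · conj(∇v) dx = - ∫_Ω η ∇u · conj(∇v) dx` for all `v`. -/
def IsPerturbOperator {Ω : Set (Euc d)} (σ η : LInf Ω) (P : H1C Ω →L[ℂ] H1C Ω) : Prop :=
  ∀ u : H1 Ω, ∃ w : H1 Ω, h1Class w = P (h1Class u) ∧ ∀ v : H1 Ω, form σ w v = - form η u v

open Classical in
/-- `P(σ, η) : H¹(Ω)/ℂ → H¹(Ω)/ℂ`. -/
def perturbOp {Ω : Set (Euc d)} (σ η : LInf Ω) : H1C Ω →L[ℂ] H1C Ω :=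
  if h : ∃ P, IsPerturbOperator σ η P then h.choose else 0

/-- `L` is the Neumann-to-Dirichlet map of `σ`: it maps `f` to the mean-free boundary value of a
solution of the Neumann problem. -/
def IsNDMap {Ω : Set (Euc d)} (σ : LInf Ω) (L : Hneg12m Ω →L[ℂ] H12m Ω) : Prop :=
  ∀ f, ∃ u : H1 Ω, IsNeumannSolution σ f u ∧ trace Ω u = h12mIncl (L f)

open Classical in
/-- The standard forward map `σ ↦ Λ(σ)`. Only its values on `L^∞_+(Ω)` matter. -/
def forwardMap (Ω : Set (Euc d)) (σ : LInf Ω) : Hneg12m Ω →L[ℂ] H12m Ω :=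
  if h : ∃ L, IsNDMap σ L then h.choose else 0

end EIT

end

open EIT

open EIT

section

open Filter Set Topology

noncomputable section

namespace EIT

variable {d : ℕ}

/-! ### Calculus lemmas -/

/-! The analysis on `Ω` is condensed into three facts. Restrictions of smooth functions are dense in
`H1 Ω` (`topologicalClosure_smoothH1`). Boundary values of smooth functions are bounded in `H12 Ω`
by the norm in `H1 Ω` (`exists_h12`). The quotient norm of a class is bounded by the norm of its
gradient, which is the Poincaré inequality (`exists_norm_h1Class_le`).

All three rest on the uniform interior cone (`exists_chart_cone`, `exists_cone`): near each point of
the closure there is a ball of vectors `v` such that the segments from `x` to `x + v`, without `x`,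
lie in `Ω`. Density follows by mollifying the zero extension with a kernel supported in that ball,
so that only values inside of `Ω` are sampled. The Poincaré inequality follows by translating pieces
near the boundary into interior balls and merging overlapping pieces. For the traces the cone also
yields that the boundary is transversal to these directions (`exists_transversal`), which permits
Fubini's theorem along `v` over the boundary. In the Gagliardo seminorm, `φ x - φ y` is split at a
common point `x + s • v` with `s` proportional to `‖x - y‖`, averaged over `v`, and estimated by a
weighted Cauchy–Schwarz inequality of Hardy type; the weights cancel after integration in `y`, and
the Dirichlet integral remains.

By the Poincaré inequality the gradient embeds `H1C Ω` as a closed subspace of `VecL2 Ω`, on which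
multiplication by `σ` in `LInfPos Ω` is coercive. The Lax–Milgram argument
(`exists_solution_operator`) and the Riesz representation (`exists_riesz`) give the operators `N`
and `P` with their uniqueness, and the forward map is `tr Ω ∘L neumannOp σ` (`forwardMap_eq`).

The rest is algebra. Comparing the weak equations for `σ` and `σ + η` gives `(1 - P(σ, η)) N(σ + η)
= N(σ)` (`neumannOp_add`). If `‖P(σ, η)‖ < 1`, the geometric series inverts the first factor, and
composing with the trace gives the Neumann series (`hasSum_forwardMap_add`). Since `P(σ, η)` is
linear and bounded in `η` (`exists_perturbOp_eq`), this is a power series in `η` with positive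
radius of convergence (`exists_hasFPowerSeriesOnBall_forwardMap`). Analyticity and smoothness
follow, and the derivatives are the symmetrisations of its coefficients, which is where the sum over
permutations comes from. -/

/-- The Cauchy–Schwarz inequality for lower Lebesgue integrals. -/
theorem sq_lintegral_mul_le {α : Type*} [MeasurableSpace α] (μ : Measure α) {f g : α → ℝ≥0∞}
    (hf : AEMeasurable f μ) (hg : AEMeasurable g μ) :
    (∫⁻ a, f a * g a ∂μ) ^ 2 ≤ (∫⁻ a, f a ^ 2 ∂μ) * ∫⁻ a, g a ^ 2 ∂μ := by
  have h := ENNReal.lintegral_mul_le_Lp_mul_Lq μ (p := 2) (q := 2)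
    (Real.HolderConjugate.two_two) hf hg
  have h2 : ∀ a : ℝ≥0∞, (a ^ (1 / 2 : ℝ)) ^ 2 = a := fun a => by
    rw [← ENNReal.rpow_natCast, ← ENNReal.rpow_mul]; norm_num
  calc (∫⁻ a, f a * g a ∂μ) ^ 2 ≤ _ := pow_le_pow_left' h 2
    _ = _ := by
      rw [mul_pow, h2, h2]
      norm_num

theorem sq_lintegral_le {α : Type*} [MeasurableSpace α] (μ : Measure α) {f : α → ℝ≥0∞}
    (hf : AEMeasurable f μ) :
    (∫⁻ a, f a ∂μ) ^ 2 ≤ μ univ * ∫⁻ a, f a ^ 2 ∂μ := by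
  simpa using sq_lintegral_mul_le μ (f := 1) (g := f) aemeasurable_const hf

theorem ennreal_add_sq_le (a b : ℝ≥0∞) : (a + b) ^ 2 ≤ 2 * a ^ 2 + 2 * b ^ 2 := by
  have h := ENNReal.rpow_add_le_mul_rpow_add_rpow a b (p := 2) (by norm_num)
  norm_num [mul_add] at h
  exact h

/-- The vector of the partial derivatives of a complex function on `ℝ^d`. -/
def gradE (φ : Euc d → ℂ) (x : Euc d) : EuclideanSpace ℂ (Fin d) :=
  WithLp.toLp 2 fun i => fderiv ℝ φ x (EuclideanSpace.single i 1)

@[simp]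
theorem gradE_apply (φ : Euc d → ℂ) (x : Euc d) (i : Fin d) :
    gradE φ x i = fderiv ℝ φ x (EuclideanSpace.single i 1) := rfl

/-- Read as a complex vector, `v` keeps its norm, and the derivative along `v` becomes an inner
product with `gradE φ x`; Cauchy–Schwarz then gives the constant one. -/
theorem norm_fderiv_apply_le (φ : Euc d → ℂ) (x v : Euc d) :
    ‖fderiv ℝ φ x v‖ ≤ ‖gradE φ x‖ * ‖v‖ := by
  have h1 : fderiv ℝ φ x v
      = inner ℂ (WithLp.toLp 2 fun i => ((v i : ℝ) : ℂ) : EuclideanSpace ℂ (Fin d)) (gradE φ x) := by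
    conv_lhs => rw [← (EuclideanSpace.basisFun (Fin d) ℝ).sum_repr v]
    rw [map_sum, PiLp.inner_apply]
    refine Finset.sum_congr rfl fun i _ => ?_
    simp [mul_comm]
  have h2 : ‖(WithLp.toLp 2 fun i => ((v i : ℝ) : ℂ) : EuclideanSpace ℂ (Fin d))‖ = ‖v‖ := by
    rw [EuclideanSpace.norm_eq, EuclideanSpace.norm_eq]
    simp
  rw [h1, mul_comm, ← h2]
  exact norm_inner_le_norm _ _

theorem continuous_gradE {φ : Euc d → ℂ} (hφ : ContDiff ℝ 1 φ) : Continuous (gradE φ) := by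
  refine (PiLp.continuous_toLp 2 _).comp (continuous_pi fun i => ?_)
  exact (hφ.continuous_fderiv (by norm_num)).clm_apply continuous_const

/-- The increment of a function along a segment is at most the integral of its gradient. -/
theorem enorm_sub_le_lintegral {φ : Euc d → ℂ} (hφ : ContDiff ℝ 1 φ) (x v : Euc d) {s : ℝ}
    (hs : 0 ≤ s) :
    ‖φ (x + s • v) - φ x‖ₑ ≤ ‖v‖ₑ * ∫⁻ t in Ioc 0 s, ‖gradE φ (x + t • v)‖ₑ := by
  have hd : ∀ t : ℝ, HasDerivAt (fun t : ℝ => φ (x + t • v)) (fderiv ℝ φ (x + t • v) v) t := by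
    intro t
    have h1 : HasDerivAt (fun t : ℝ => x + t • v) v t := by
      simpa using ((hasDerivAt_id t).smul_const v).const_add x
    exact ((hφ.differentiable (by norm_num)) _).hasFDerivAt.comp_hasDerivAt t h1
  have hc : Continuous fun t : ℝ => fderiv ℝ φ (x + t • v) v :=
    ((hφ.continuous_fderiv (by norm_num)).comp (by fun_prop)).clm_apply continuous_const
  have h := intervalIntegral.integral_eq_sub_of_hasDerivAt (a := 0) (b := s)
    (fun t _ => hd t) (hc.intervalIntegrable _ _)
  simp only [zero_smul, add_zero] at h
  rw [← h, intervalIntegral.integral_of_le hs, ← lintegral_const_mul']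
  · refine (enorm_integral_le_lintegral_enorm _).trans (lintegral_mono fun t => ?_)
    have := norm_fderiv_apply_le φ (x + t • v) v
    rw [← ofReal_norm, ← ofReal_norm, ← ofReal_norm, ← ENNReal.ofReal_mul (norm_nonneg _)]
    exact ENNReal.ofReal_le_ofReal (by linarith [mul_comm ‖v‖ ‖gradE φ (x + t • v)‖])
  · simp

/-- If all the segments from `A` to `A + h` lie in `Ω`, then the translation by `h` changes a
function on `A` by at most `|h|` times the norm of its gradient, in `L²`. -/
theorem lintegral_translate_sub_le {φ : Euc d → ℂ} (hφ : ContDiff ℝ 1 φ) {Ω A : Set (Euc d)}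
    (hA : MeasurableSet A) (hΩ : MeasurableSet Ω) (h : Euc d)
    (hseg : ∀ x ∈ A, ∀ t ∈ Ioc (0 : ℝ) 1, x + t • h ∈ Ω) :
    ∫⁻ x in A, ‖φ (x + h) - φ x‖ₑ ^ 2 ≤ ‖h‖ₑ ^ 2 * ∫⁻ x in Ω, ‖gradE φ x‖ₑ ^ 2 := by
  have hg : Continuous (gradE φ) := continuous_gradE hφ
  have hgm : Measurable fun x => ‖gradE φ x‖ₑ := hg.measurable.enorm
  have h1 : ∀ x ∈ A, ‖φ (x + h) - φ x‖ₑ ^ 2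
      ≤ ‖h‖ₑ ^ 2 * ∫⁻ t in Ioc (0 : ℝ) 1, ‖gradE φ (x + t • h)‖ₑ ^ 2 := by
    intro x _
    have := enorm_sub_le_lintegral hφ x h zero_le_one
    rw [one_smul] at this
    refine (pow_le_pow_left' this 2).trans ?_
    rw [mul_pow]
    gcongr
    refine (sq_lintegral_le _ ?_).trans (by simp)
    exact (hgm.comp (by fun_prop)).aemeasurable
  refine (setLIntegral_mono' hA h1).trans ?_
  rw [lintegral_const_mul' _ _ (by simp)]
  refine mul_le_mul' le_rfl ?_
  -- For fixed `t`, translation by `t • h` carries `A` into `Ω` and preserves the Lebesgue measure.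
  rw [lintegral_lintegral_swap]
  · calc ∫⁻ t in Ioc (0 : ℝ) 1, ∫⁻ x in A, ‖gradE φ (x + t • h)‖ₑ ^ 2
        ≤ ∫⁻ t in Ioc (0 : ℝ) 1, ∫⁻ x in Ω, ‖gradE φ x‖ₑ ^ 2 := by
          refine setLIntegral_mono' measurableSet_Ioc fun t ht => ?_
          rw [← lintegral_indicator hA, ← lintegral_indicator hΩ,
            ← lintegral_add_right_eq_self (Ω.indicator _) (t • h)]
          refine lintegral_mono fun x => ?_
          by_cases hx : x ∈ A
          · rw [indicator_of_mem hx, indicator_of_mem (hseg x hx t ht)]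
          · rw [indicator_of_notMem hx]; exact zero_le
      _ = _ := by simp
  · exact ((hgm.comp (by fun_prop)).pow_const 2).aemeasurable

/-! ### Geometry of Lipschitz domains -/

/-- In the chart, a direction whose vertical part exceeds `K` times its horizontal part climbs
strictly above a `K`-Lipschitz graph. A small ball around a vertical vector `e` consists of such
directions. -/
theorem IsBoundedLipschitzDomain.exists_chart_cone {Ω : Set (Euc d)}
    (hΩ : IsBoundedLipschitzDomain Ω) {x₀ : Euc d} (hx₀ : x₀ ∈ frontier Ω) :
    ∃ (T : Euc d ≃ₗᵢ[ℝ] WithLp 2 (Euc (d - 1) × ℝ)) (e : Euc d) (ρ r : ℝ), 0 < ρ ∧ 0 < r ∧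
      (∀ v, ‖v - e‖ < ρ → ρ < (T v).snd) ∧
      ∀ x ∈ closure Ω, dist x x₀ < r → ∀ v, ‖v - e‖ < ρ → ∀ t ∈ Ioc (0 : ℝ) 1, x + t • v ∈ Ω := by
  obtain ⟨T, γ, K, R, hγ, hR, hy⟩ := hΩ.lipschitz_boundary x₀ hx₀
  -- Since `a = 2 * (1 + K) * ρ`, vertical parts exceed `a - ρ = (1 + 2 * K) * ρ`, while horizontal
  -- parts are below `ρ`. Since `ρ ≤ R / 8`, segments that start within `R / 4` of `x₀` stay in the
  -- chart of radius `R`.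
  set a : ℝ := R / 4 with ha
  set ρ : ℝ := a / (2 * (1 + K)) with hρ
  set e : Euc d := T.symm (WithLp.toLp 2 (0, a)) with he
  have hK : (0 : ℝ) ≤ K := K.2
  have ha0 : 0 < a := by positivity
  have hρ0 : 0 < ρ := by positivity
  have hρa : ρ * (2 * (1 + K)) = a := by rw [hρ]; field_simp
  have hρK : 0 ≤ ρ * K := by positivity
  have hTe : T e = WithLp.toLp 2 (0, a) := by simp [he]
  have hfst : ∀ v, ‖v - e‖ < ρ → ‖(T v).fst‖ < ρ := by
    intro v hv
    have h1 : (T v).fst = (T (v - e)).fst := by simp [hTe]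
    rw [h1]
    exact (WithLp.norm_fst_le _ _).trans_lt (by rwa [T.norm_map])
  have hsnd : ∀ v, ‖v - e‖ < ρ → a - ρ < (T v).snd := by
    intro v hv
    have h1 : (T v).snd = a + (T (v - e)).snd := by simp [hTe]
    have h2 : ‖(T (v - e)).snd‖ < ρ := (WithLp.norm_snd_le _ _).trans_lt (by rwa [T.norm_map])
    rw [Real.norm_eq_abs, abs_lt] at h2
    linarith
  -- On the closure only the weak inequality survives; the strict slope of `v` restores strictness
  -- for positive `t`.
  have hcl : ∀ x ∈ closure Ω, dist x x₀ < R → γ (T x).fst ≤ (T x).snd := by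
    intro x hx hxR
    have h1 : x ∈ closure (Ω ∩ Metric.ball x₀ R) :=
      Metric.isOpen_ball.closure_inter ⟨hx, hxR⟩
    have h2 : IsClosed {y : Euc d | γ (T y).fst ≤ (T y).snd} := by
      refine isClosed_le (hγ.continuous.comp ?_) ?_
      · exact ((WithLp.prod_continuous_ofLp 2 _ _).comp T.continuous).fst
      · exact ((WithLp.prod_continuous_ofLp 2 _ _).comp T.continuous).snd
    exact closure_minimal (fun y hy' => ((hy y hy'.2).1 hy'.1).le) h2 h1
  refine ⟨T, e, ρ, R / 4, hρ0, by positivity, fun v hv => ?_, ?_⟩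
  · have := hsnd v hv
    linarith
  · intro x hx hxr v hv t ht
    have hve : ‖v‖ < a + ρ := by
      have h1 : ‖e‖ = a := by
        rw [← T.norm_map, hTe, WithLp.prod_norm_eq_of_L2]
        simp [abs_of_pos ha0, Real.sqrt_sq ha0.le]
      calc ‖v‖ = ‖(v - e) + e‖ := by simp
        _ ≤ ‖v - e‖ + ‖e‖ := norm_add_le _ _
        _ < a + ρ := by linarith
    have htv : ‖t • v‖ ≤ ‖v‖ := by
      rw [norm_smul, Real.norm_of_nonneg ht.1.le]
      exact mul_le_of_le_one_left (norm_nonneg _) ht.2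
    refine (hy _ ?_).2 ?_
    · rw [Metric.mem_ball]
      calc dist (x + t • v) x₀ ≤ dist (x + t • v) x + dist x x₀ := dist_triangle _ _ _
        _ < R := by rw [dist_eq_norm, add_sub_cancel_left]; nlinarith
    · have h1 := hcl x hx (by linarith)
      have h2 := hγ.dist_le_mul (T (x + t • v)).fst (T x).fst
      have h3 : (T (x + t • v)).fst - (T x).fst = t • (T v).fst := by simp
      have h4 : (T (x + t • v)).snd = (T x).snd + t * (T v).snd := by simp
      rw [dist_eq_norm, dist_eq_norm, h3, norm_smul, Real.norm_of_nonneg ht.1.le,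
        Real.norm_eq_abs] at h2
      have h5 := (abs_le.1 h2).2
      have h6 := hsnd v hv
      have h7 := hfst v hv
      rw [h4]
      have h8 : K * (t * ‖(T v).fst‖) < t * (T v).snd := by
        have : K * ‖(T v).fst‖ < (T v).snd := by
          have : K * ‖(T v).fst‖ ≤ K * ρ := mul_le_mul_of_nonneg_left h7.le hK
          linarith
        nlinarith [ht.1]
      linarith

/-- The uniform interior cone property of a Lipschitz domain. -/
theorem IsBoundedLipschitzDomain.exists_cone {Ω : Set (Euc d)}
    (hΩ : IsBoundedLipschitzDomain Ω) {x₀ : Euc d} (hx₀ : x₀ ∈ closure Ω) :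
    ∃ (e : Euc d) (ρ r : ℝ), 0 < ρ ∧ 0 < r ∧
      ∀ x ∈ closure Ω, dist x x₀ < r → ∀ v, ‖v - e‖ < ρ → ∀ t ∈ Ioc (0 : ℝ) 1, x + t • v ∈ Ω := by
  by_cases h : x₀ ∈ Ω
  · obtain ⟨R, hR, hball⟩ := Metric.isOpen_iff.1 hΩ.isOpen x₀ h
    refine ⟨0, R / 2, R / 2, by positivity, by positivity, ?_⟩
    intro x _ hxr v hv t ht
    refine hball ?_
    rw [sub_zero] at hv
    have htv : ‖t • v‖ ≤ ‖v‖ := by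
      rw [norm_smul, Real.norm_of_nonneg ht.1.le]
      exact mul_le_of_le_one_left (norm_nonneg _) ht.2
    rw [Metric.mem_ball]
    calc dist (x + t • v) x₀ ≤ dist (x + t • v) x + dist x x₀ := dist_triangle _ _ _
      _ < R := by rw [dist_eq_norm, add_sub_cancel_left]; linarith
  · have hf : x₀ ∈ frontier Ω := by
      rw [frontier, hΩ.isOpen.interior_eq]; exact ⟨hx₀, h⟩
    obtain ⟨_, e, ρ, r, hρ, hr, _, h⟩ := hΩ.exists_chart_cone hf
    exact ⟨e, ρ, r, hρ, hr, h⟩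

/-- Near a boundary point, the boundary of a Lipschitz domain is uniformly transversal to a ball of
directions that point into the domain. -/
theorem IsBoundedLipschitzDomain.exists_transversal {Ω : Set (Euc d)}
    (hΩ : IsBoundedLipschitzDomain Ω) {x₀ : Euc d} (hx₀ : x₀ ∈ frontier Ω) :
    ∃ (T : Euc d ≃ₗᵢ[ℝ] WithLp 2 (Euc (d - 1) × ℝ)) (e : Euc d) (ρ r : ℝ) (L : NNReal),
      0 < ρ ∧ 0 < r ∧
      (∀ v, ‖v - e‖ < ρ → ρ < (T v).snd) ∧
      (∀ x ∈ closure Ω, dist x x₀ < r → ∀ v, ‖v - e‖ < ρ → ∀ t ∈ Ioc (0 : ℝ) 1, x + t • v ∈ Ω) ∧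
      ∀ x ∈ frontier Ω, ∀ y ∈ frontier Ω, dist x x₀ < r → dist y x₀ < r → ∀ v, ‖v - e‖ < ρ →
        ∀ t : ℝ, ‖x - y‖ ≤ L * ‖x - y - t • v‖ := by
  obtain ⟨T, e, ρ, r, hρ, hr, hT, hcone⟩ := hΩ.exists_chart_cone hx₀
  have he : ρ < ‖e‖ := by
    have h1 := hT e (by simpa using hρ)
    have h2 : ‖(T e).snd‖ ≤ ‖e‖ := (WithLp.norm_snd_le _ _).trans_eq (T.norm_map _)
    exact (h1.trans_le (le_abs_self _)).trans_le h2
  have hL : 0 ≤ 1 + 2 * (‖e‖ + ρ) / ρ := by positivity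
  -- Half of the ball is given up in order to pass from `e` to nearby `v`. The second bound on the
  -- radius makes `‖x - y‖ < ‖e‖ - ρ`, as needed for `1 < |t|`.
  refine ⟨T, e, ρ / 2, min r ((‖e‖ - ρ) / 2), ⟨_, hL⟩, by positivity,
    lt_min hr (by linarith), fun v hv => by linarith [hT v (by linarith)],
    fun x hx hxr v hv t ht => hcone x hx (hxr.trans_le (min_le_left _ _)) v (by linarith) t ht, ?_⟩
  have hnot : ∀ x ∈ frontier Ω, x ∉ Ω := fun x hx => by
    rw [frontier, hΩ.isOpen.interior_eq] at hx; exact hx.2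
  -- If the bound failed, `x` would be `y + t • v` with `v` in the cone, hence a point of the open
  -- set `Ω`, which a boundary point is not.
  have hpos : ∀ x ∈ frontier Ω, ∀ y ∈ frontier Ω, dist y x₀ < r →
      ∀ t ∈ Ioc (0 : ℝ) 1, t * ρ ≤ ‖x - y - t • e‖ := by
    intro x hx y hy hyr t ht
    by_contra! hlt
    refine hnot x hx ?_
    have h := hcone y hy.1 hyr (t⁻¹ • (x - y)) ?_ t ht
    · rwa [smul_inv_smul₀ ht.1.ne', add_sub_cancel] at h
    · have h1 : t⁻¹ • (x - y) - e = t⁻¹ • (x - y - t • e) := by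
        rw [smul_sub t⁻¹ (x - y), inv_smul_smul₀ ht.1.ne']
      rw [h1, norm_smul, norm_inv, Real.norm_of_nonneg ht.1.le, inv_mul_lt_iff₀ ht.1]
      exact hlt
  intro x hx y hy hxr hyr v hv t
  have hxr1 := hxr.trans_le (min_le_left _ _)
  have hyr1 := hyr.trans_le (min_le_left _ _)
  have hxr2 := hxr.trans_le (min_le_right _ _)
  have hyr2 := hyr.trans_le (min_le_right _ _)
  have hkey : |t| * ρ ≤ ‖x - y - t • e‖ := by
    rcases le_or_gt |t| 1 with h1 | h1
    · rcases lt_trichotomy t 0 with h0 | h0 | h0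
      · rw [abs_of_neg h0] at h1 ⊢
        have := hpos y hy x hx hxr1 (-t) ⟨by linarith, h1⟩
        rwa [← norm_neg, show -(y - x - -t • e) = x - y - t • e by module] at this
      · simp [h0]
      · rw [abs_of_pos h0] at h1 ⊢
        exact hpos x hx y hy hyr1 t ⟨h0, h1⟩
    · have h2 : ‖x - y‖ < ‖e‖ - ρ := by
        rw [← dist_eq_norm]
        linarith [dist_triangle_right x y x₀]
      have h3 : |t| * ‖e‖ - ‖x - y‖ ≤ ‖x - y - t • e‖ := by
        have := norm_sub_norm_le (t • e) (x - y)
        rwa [norm_smul, Real.norm_eq_abs, norm_sub_rev (t • e)] at this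
      nlinarith
  have h4 : |t| * (ρ / 2) ≤ ‖x - y - t • v‖ := by
    have h5 : ‖x - y - t • e‖ ≤ ‖x - y - t • v‖ + |t| * ‖v - e‖ := by
      rw [← Real.norm_eq_abs, ← norm_smul]
      refine le_trans (le_of_eq ?_) (norm_add_le _ _)
      congr 1; module
    nlinarith [abs_nonneg t]
  have h6 : ‖v‖ ≤ ‖e‖ + ρ := by
    have := norm_sub_norm_le v e
    linarith
  have h7 : ‖x - y‖ ≤ ‖x - y - t • v‖ + |t| * ‖v‖ := by
    rw [← Real.norm_eq_abs, ← norm_smul]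
    refine le_trans (le_of_eq ?_) (norm_add_le _ _)
    congr 1; module
  have h8 : |t| * ‖v‖ ≤ 2 * (‖e‖ + ρ) / ρ * ‖x - y - t • v‖ := by
    calc |t| * ‖v‖ ≤ |t| * (‖e‖ + ρ) := by gcongr
      _ = 2 * (‖e‖ + ρ) / ρ * (|t| * (ρ / 2)) := by field_simp
      _ ≤ _ := by gcongr
  calc ‖x - y‖ ≤ _ := h7
    _ ≤ (1 + 2 * (‖e‖ + ρ) / ρ) * ‖x - y - t • v‖ := by linarith

/-! ### Integration over transversal pieces of the boundary -/

/-- The projection of `ℝ^d` onto `ℝ^{d-1}` along the direction `v`. -/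
def projAlong (T : Euc d ≃ₗᵢ[ℝ] WithLp 2 (Euc (d - 1) × ℝ)) (v x : Euc d) : Euc (d - 1) :=
  (T x).fst - ((T x).snd / (T v).snd) • (T v).fst

theorem continuous_projAlong (T : Euc d ≃ₗᵢ[ℝ] WithLp 2 (Euc (d - 1) × ℝ)) (v : Euc d) :
    Continuous (projAlong T v) := by
  have h := (WithLp.prod_continuous_ofLp 2 (Euc (d - 1)) ℝ).comp T.continuous
  exact h.fst.sub ((h.snd.div_const _).smul continuous_const)

/-- Moving `x - y` along `v` until its height vanishes leaves exactly the horizontal difference of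
the projections. Transversality thereby becomes a lower Lipschitz bound for `projAlong T v`. -/
theorem exists_norm_sub_projAlong (T : Euc d ≃ₗᵢ[ℝ] WithLp 2 (Euc (d - 1) × ℝ)) {v : Euc d}
    (hv : (T v).snd ≠ 0) (x y : Euc d) :
    ∃ t : ℝ, ‖x - y - t • v‖ = ‖projAlong T v x - projAlong T v y‖ := by
  refine ⟨((T x).snd - (T y).snd) / (T v).snd, ?_⟩
  rw [← T.norm_map, WithLp.prod_norm_eq_of_L2]
  have h1 : (T (x - y - (((T x).snd - (T y).snd) / (T v).snd) • v)).snd = 0 := by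
    simp [div_mul_cancel₀ _ hv]
  have h2 : (T (x - y - (((T x).snd - (T y).snd) / (T v).snd) • v)).fst
      = projAlong T v x - projAlong T v y := by
    simp only [map_sub, map_smul, WithLp.sub_fst, WithLp.smul_fst, projAlong]
    module
  rw [h1, h2]
  simp

theorem euclideanHausdorffMeasure_image_le {X Y : Type*} [MetricSpace X] [MetricSpace Y]
    [MeasurableSpace X] [BorelSpace X] [MeasurableSpace Y] [BorelSpace Y] {K : NNReal} {f : X → Y}
    {s : Set X} (h : LipschitzOnWith K f s) (n : ℕ) :
    Measure.euclideanHausdorffMeasure n (f '' s)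
      ≤ (K : ℝ≥0∞) ^ n * Measure.euclideanHausdorffMeasure n s := by
  rw [Measure.euclideanHausdorffMeasure_def, Measure.euclideanHausdorffMeasure_def,
    Measure.smul_apply, Measure.smul_apply, ENNReal.smul_def, ENNReal.smul_def, smul_eq_mul,
    smul_eq_mul, mul_left_comm]
  refine mul_le_mul' le_rfl ?_
  simpa using h.hausdorffMeasure_image_le (d := n) (Nat.cast_nonneg n)

/-- The image measure on `ℝ^{d-1}` of the surface measure on a piece transversal to `v` is bounded
by the Lebesgue measure. -/
theorem lintegral_projAlong_le (T : Euc d ≃ₗᵢ[ℝ] WithLp 2 (Euc (d - 1) × ℝ)) {v : Euc d}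
    (hv : (T v).snd ≠ 0) {P : Set (Euc d)} {L : NNReal}
    (hL : ∀ x ∈ P, ∀ y ∈ P, ∀ t : ℝ, ‖x - y‖ ≤ L * ‖x - y - t • v‖)
    {J : Euc (d - 1) → ℝ≥0∞} (hJ : Measurable J) :
    ∫⁻ x in P, J (projAlong T v x) ∂(Measure.euclideanHausdorffMeasure (d - 1))
      ≤ (L : ℝ≥0∞) ^ (d - 1) * ∫⁻ w, J w := by
  have hm := (continuous_projAlong T v).measurable
  have hle : ((Measure.euclideanHausdorffMeasure (d - 1)).restrict P).map (projAlong T v)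
      ≤ ((L : ℝ≥0∞) ^ (d - 1)) • (volume : Measure (Euc (d - 1))) := by
    refine Measure.le_iff.2 fun E hE => ?_
    rw [Measure.map_apply hm hE, Measure.restrict_apply (hm hE), Measure.smul_apply, smul_eq_mul]
    set s := projAlong T v ⁻¹' E ∩ P with hs
    have hanti : ∀ x ∈ s, ∀ y ∈ s, ‖x - y‖ ≤ L * ‖projAlong T v x - projAlong T v y‖ := by
      intro x hx y hy
      obtain ⟨t, ht⟩ := exists_norm_sub_projAlong T hv x y
      rw [← ht]
      exact hL x hx.2 y hy.2 t
    have hinj : InjOn (projAlong T v) s := by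
      intro x hx y hy hxy
      have := hanti x hx y hy
      rw [hxy, sub_self, norm_zero, mul_zero] at this
      exact sub_eq_zero.1 (norm_le_zero_iff.1 this)
    have hleft := hinj.leftInvOn_invFunOn
    -- The inverse of the projection is `L`-Lipschitz, so the piece over `E` has at most `L ^ (d -
    -- 1)` times the measure of `E`.
    have hlip : LipschitzOnWith L (Function.invFunOn (projAlong T v) s) (projAlong T v '' s) := by
      refine LipschitzOnWith.of_dist_le_mul ?_
      rintro _ ⟨x, hx, rfl⟩ _ ⟨y, hy, rfl⟩
      rw [hleft hx, hleft hy, dist_eq_norm, dist_eq_norm]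
      exact hanti x hx y hy
    have h1 := euclideanHausdorffMeasure_image_le hlip (d - 1)
    rw [hleft.image_image, EuclideanSpace.euclideanHausdorffMeasure_eq_volume] at h1
    refine h1.trans (mul_le_mul' le_rfl (measure_mono ?_))
    rintro _ ⟨x, hx, rfl⟩
    exact hx.1
  calc ∫⁻ x in P, J (projAlong T v x) ∂(Measure.euclideanHausdorffMeasure (d - 1))
      = ∫⁻ w, J w ∂(((Measure.euclideanHausdorffMeasure (d - 1)).restrict P).map
          (projAlong T v)) := (lintegral_map hJ hm).symm
    _ ≤ ∫⁻ w, J w ∂(((L : ℝ≥0∞) ^ (d - 1)) • (volume : Measure (Euc (d - 1)))) :=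
        lintegral_mono' hle le_rfl
    _ = _ := by rw [lintegral_smul_measure, smul_eq_mul]

theorem lintegral_eq_lintegral_chart (T : Euc d ≃ₗᵢ[ℝ] WithLp 2 (Euc (d - 1) × ℝ))
    {F : Euc d → ℝ≥0∞} (hF : Measurable F) :
    ∫⁻ x, F x = ∫⁻ s : ℝ, ∫⁻ w : Euc (d - 1), F (T.symm (WithLp.toLp 2 (w, s))) := by
  have hm : Measurable fun p : Euc (d - 1) × ℝ => F (T.symm (WithLp.toLp 2 p)) :=
    hF.comp (T.symm.continuous.comp (WithLp.prod_continuous_toLp 2 _ _)).measurable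
  have h1 : ∫⁻ x, F x = ∫⁻ p : Euc (d - 1) × ℝ, F (T.symm (WithLp.toLp 2 p)) := by
    rw [← T.symm.measurePreserving.lintegral_comp hF]
    have hm' : Measurable fun p : WithLp 2 (Euc (d - 1) × ℝ) => F (T.symm p) :=
      hF.comp T.symm.continuous.measurable
    exact ((WithLp.volume_preserving_toLp (Euc (d - 1)) ℝ).lintegral_comp hm').symm
  rw [h1, Measure.volume_eq_prod, lintegral_prod_symm _ hm.aemeasurable]

/-- Fubini's theorem in the direction `v` over a transversal piece of the boundary. -/
theorem lintegral_lintegral_line_le (T : Euc d ≃ₗᵢ[ℝ] WithLp 2 (Euc (d - 1) × ℝ)) {v : Euc d}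
    (hv : 0 < (T v).snd) {P : Set (Euc d)} {L : NNReal}
    (hL : ∀ x ∈ P, ∀ y ∈ P, ∀ t : ℝ, ‖x - y‖ ≤ L * ‖x - y - t • v‖)
    {F : Euc d → ℝ≥0∞} (hF : Measurable F) :
    ∫⁻ x in P, (∫⁻ t : ℝ, F (x + t • v)) ∂(Measure.euclideanHausdorffMeasure (d - 1))
      ≤ (L : ℝ≥0∞) ^ (d - 1) * (ENNReal.ofReal (T v).snd)⁻¹ * ∫⁻ x, F x := by
  set a := (T v).snd with ha
  -- The horizontal displacement per unit of height: the line through `x` along `v` has the point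
  -- `projAlong T v x + s • ζ` at height `s`.
  set ζ : Euc (d - 1) := a⁻¹ • (T v).fst with hζ
  have hcT : Continuous fun p : Euc (d - 1) × ℝ => T.symm (WithLp.toLp 2 (p.1 + p.2 • ζ, p.2)) := by
    refine T.symm.continuous.comp ((WithLp.prod_continuous_toLp 2 _ _).comp ?_)
    fun_prop
  set J : Euc (d - 1) → ℝ≥0∞ := fun w => ∫⁻ s : ℝ, F (T.symm (WithLp.toLp 2 (w + s • ζ, s)))
  have hJ : Measurable J := (hF.comp hcT.measurable).lintegral_prod_right'
  have hline : ∀ x, ∫⁻ t : ℝ, F (x + t • v) = (ENNReal.ofReal a)⁻¹ * J (projAlong T v x) := by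
    intro x
    have hpt : ∀ t : ℝ, x + t • v = T.symm (WithLp.toLp 2
        (projAlong T v x + ((T x).snd + t * a) • ζ, (T x).snd + t * a)) := by
      intro t
      rw [LinearIsometryEquiv.eq_symm_apply]
      refine (WithLp.ofLp_injective 2) (Prod.ext ?_ ?_)
      · have : ((T x).snd + t * a) • ζ = ((T x).snd / a) • (T v).fst + t • (T v).fst := by
          rw [hζ, smul_smul, ← add_smul]
          congr 1; field_simp
        change (T (x + t • v)).fst = _
        simp only [map_add, map_smul, WithLp.add_fst, WithLp.smul_fst, this, projAlong]
        rw [← ha]; module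
      · change (T (x + t • v)).snd = _
        simp only [map_add, map_smul, WithLp.add_snd, WithLp.smul_snd, ← ha, smul_eq_mul]
    have hG : Measurable fun s : ℝ =>
        F (T.symm (WithLp.toLp 2 (projAlong T v x + s • ζ, s))) :=
      hF.comp (hcT.comp (Continuous.prodMk_right (projAlong T v x))).measurable
    calc ∫⁻ t : ℝ, F (x + t • v) = ∫⁻ t : ℝ, (fun s : ℝ =>
        F (T.symm (WithLp.toLp 2 (projAlong T v x + s • ζ, s)))) (t * a + (T x).snd) := by
          refine lintegral_congr fun t => ?_
          rw [hpt t, add_comm (T x).snd]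
      _ = ∫⁻ t : ℝ, (fun s : ℝ => F (T.symm (WithLp.toLp 2 (projAlong T v x + (s + (T x).snd) • ζ,
            (s + (T x).snd))))) (t * a) := rfl
      _ = (ENNReal.ofReal a)⁻¹ * J (projAlong T v x) := by
          have hG' : Measurable fun s : ℝ => F (T.symm (WithLp.toLp 2
              (projAlong T v x + (s + (T x).snd) • ζ, (s + (T x).snd)))) :=
            hG.comp (measurable_id.add_const _)
          have hmap := Real.map_volume_mul_right hv.ne'
          rw [← lintegral_map (g := fun t : ℝ => t * a) hG' (measurable_id.mul_const a), hmap, lintegral_smul_measure,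
            smul_eq_mul, lintegral_add_right_eq_self
              (fun s : ℝ => F (T.symm (WithLp.toLp 2 (projAlong T v x + s • ζ, s))))]
          rw [abs_of_pos (inv_pos.2 hv), ENNReal.ofReal_inv_of_pos hv]
  simp_rw [hline]
  have hJp : Measurable fun x => J (projAlong T v x) :=
    hJ.comp (continuous_projAlong T v).measurable
  rw [lintegral_const_mul _ hJp]
  -- At each height the shear by `s • ζ` is a translation, so it preserves the integral.
  have hJint : ∫⁻ w, J w = ∫⁻ x, F x := by
    rw [lintegral_eq_lintegral_chart T hF, lintegral_lintegral_swap]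
    · refine lintegral_congr fun s => ?_
      exact lintegral_add_right_eq_self (fun w => F (T.symm (WithLp.toLp 2 (w, s)))) (s • ζ)
    · exact (hF.comp hcT.measurable).aemeasurable
  rw [← hJint, mul_comm ((L : ℝ≥0∞) ^ (d - 1)), mul_assoc]
  exact mul_le_mul' le_rfl (lintegral_projAlong_le T hv.ne' hL hJ)

/-! ### The trace estimate for smooth functions -/

/-- The exponent exceeds the dimension by one half, so the tail integral converges. The substitution
`w = a • u` reduces to `a = 1` and produces the power `a ^ (-1/2)`. -/
theorem exists_lintegral_rpow_norm_le (n : ℕ) :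
    ∃ C : ℝ≥0∞, C ≠ ∞ ∧ ∀ a : ℝ, 0 < a →
      ∫⁻ w in {w : Euc n | a ≤ ‖w‖}, ENNReal.ofReal (‖w‖ ^ (-((n : ℝ) + 1 / 2)))
        ≤ C * ENNReal.ofReal (a ^ (-(1 / 2) : ℝ)) := by
  set s : ℝ := (n : ℝ) + 1 / 2 with hs
  have hs0 : 0 ≤ s := by positivity
  refine ⟨∫⁻ w in {w : Euc n | 1 ≤ ‖w‖}, ENNReal.ofReal (‖w‖ ^ (-s)), ?_, ?_⟩
  · have h1 : ∀ w ∈ {w : Euc n | 1 ≤ ‖w‖}, ENNReal.ofReal (‖w‖ ^ (-s))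
        ≤ ENNReal.ofReal (2 ^ s) * ENNReal.ofReal ((1 + ‖w‖) ^ (-s)) := by
      intro w hw
      have hw1 : 1 ≤ ‖w‖ := hw
      rw [← ENNReal.ofReal_mul (by positivity)]
      refine ENNReal.ofReal_le_ofReal ?_
      have h2 : (1 + ‖w‖) ≤ 2 * ‖w‖ := by linarith
      calc ‖w‖ ^ (-s) = 2 ^ s * (2 * ‖w‖) ^ (-s) := by
            rw [Real.mul_rpow (by norm_num) (by linarith), ← mul_assoc,
              ← Real.rpow_add (by norm_num), add_neg_cancel, Real.rpow_zero, one_mul]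
        _ ≤ 2 ^ s * (1 + ‖w‖) ^ (-s) := by
            refine mul_le_mul_of_nonneg_left ?_ (by positivity)
            exact Real.rpow_le_rpow_of_nonpos (by linarith) h2 (by linarith)
    have hS : MeasurableSet {w : Euc n | 1 ≤ ‖w‖} := measurableSet_le measurable_const measurable_norm
    refine ne_top_of_le_ne_top ?_ ((setLIntegral_mono' hS h1).trans (setLIntegral_le_lintegral _ _))
    rw [lintegral_const_mul' _ _ ENNReal.ofReal_ne_top]
    refine ENNReal.mul_ne_top ENNReal.ofReal_ne_top ?_
    exact (finite_integral_one_add_norm (by simp [hs])).ne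
  · intro a ha
    have hS : ∀ a : ℝ, MeasurableSet {w : Euc n | a ≤ ‖w‖} := fun a =>
      measurableSet_le measurable_const measurable_norm
    have hm : Measurable fun w : Euc n => ENNReal.ofReal (‖w‖ ^ (-s)) := by fun_prop
    rw [← lintegral_indicator (hS a), ← lintegral_indicator (hS 1)]
    set g := {w : Euc n | a ≤ ‖w‖}.indicator fun w => ENNReal.ofReal (‖w‖ ^ (-s)) with hg
    have hgm : Measurable g := hm.indicator (hS a)
    have h1 : ∫⁻ u, g (a • u) = ENNReal.ofReal (a ^ n)⁻¹ * ∫⁻ w, g w := by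
      rw [← lintegral_map (f := g) (g := fun u : Euc n => a • u) hgm (by fun_prop),
        Measure.map_addHaar_smul _ ha.ne', lintegral_smul_measure, smul_eq_mul]
      simp [abs_of_pos ha]
    have h2 : ∀ u : Euc n, g (a • u) = ENNReal.ofReal (a ^ (-s)) *
        {w : Euc n | 1 ≤ ‖w‖}.indicator (fun w => ENNReal.ofReal (‖w‖ ^ (-s))) u := by
      intro u
      have hn : ‖a • u‖ = a * ‖u‖ := by rw [norm_smul, Real.norm_of_nonneg ha.le]
      by_cases hu : 1 ≤ ‖u‖
      · rw [hg, indicator_of_mem, indicator_of_mem, hn, Real.mul_rpow ha.le (norm_nonneg _),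
          ENNReal.ofReal_mul (by positivity)]
        · exact hu
        · simp only [mem_ofPred_eq, hn]; exact le_mul_of_one_le_right ha.le hu
      · rw [hg, indicator_of_notMem, indicator_of_notMem, mul_zero]
        · exact hu
        · simp only [mem_ofPred_eq, hn, not_le] at hu ⊢
          exact mul_lt_of_lt_one_right ha hu
    simp_rw [h2] at h1
    rw [lintegral_const_mul' _ _ ENNReal.ofReal_ne_top] at h1
    refine le_of_eq ?_
    calc ∫⁻ w, g w = ENNReal.ofReal (a ^ n) * (ENNReal.ofReal (a ^ n)⁻¹ * ∫⁻ w, g w) := by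
          rw [← mul_assoc, ← ENNReal.ofReal_mul (by positivity),
            mul_inv_cancel₀ (by positivity), ENNReal.ofReal_one, one_mul]
      _ = _ := by
          rw [← h1, ← mul_assoc, ← ENNReal.ofReal_mul (by positivity), mul_comm]
          congr 2
          rw [← Real.rpow_natCast, ← Real.rpow_add ha]
          congr 1
          rw [hs]; ring

theorem norm_projAlong_sub_le (T : Euc d ≃ₗᵢ[ℝ] WithLp 2 (Euc (d - 1) × ℝ)) {v : Euc d}
    (hv : 0 < (T v).snd) (x y : Euc d) :
    ‖projAlong T v x - projAlong T v y‖ ≤ (1 + ‖v‖ / (T v).snd) * ‖x - y‖ := by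
  have h1 : projAlong T v x - projAlong T v y
      = (T (x - y)).fst - ((T (x - y)).snd / (T v).snd) • (T v).fst := by
    simp only [map_sub, WithLp.sub_fst, WithLp.sub_snd, projAlong]
    module
  have h2 : ‖(T (x - y)).fst‖ ≤ ‖x - y‖ := (WithLp.norm_fst_le _ _).trans_eq (T.norm_map _)
  have h3 : ‖(T (x - y)).snd‖ ≤ ‖x - y‖ := (WithLp.norm_snd_le _ _).trans_eq (T.norm_map _)
  have h4 : ‖(T v).fst‖ ≤ ‖v‖ := (WithLp.norm_fst_le _ _).trans_eq (T.norm_map _)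
  rw [h1]
  refine (norm_sub_le _ _).trans ?_
  rw [norm_smul, norm_div, Real.norm_of_nonneg hv.le]
  have h5 : ‖(T (x - y)).snd‖ / (T v).snd * ‖(T v).fst‖ ≤ ‖x - y‖ / (T v).snd * ‖v‖ := by gcongr
  calc _ ≤ ‖x - y‖ + ‖x - y‖ / (T v).snd * ‖v‖ := add_le_add h2 h5
    _ = _ := by ring

/-- The surface measure of a Lipschitz domain is finite. -/
theorem IsBoundedLipschitzDomain.isFiniteMeasure_surf {Ω : Set (Euc d)}
    (hΩ : IsBoundedLipschitzDomain Ω) : IsFiniteMeasure (surf Ω) := by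
  have hc : IsCompact (frontier Ω) :=
    Metric.isCompact_of_isClosed_isBounded isClosed_frontier
      (hΩ.isBounded.closure.subset frontier_subset_closure)
  have h : surf Ω (frontier Ω) < ∞ := by
    refine hc.measure_lt_top_of_nhdsWithin fun x₀ hx₀ => ?_
    obtain ⟨T, e, ρ, r, L, hρ, hr, hT, -, hL⟩ := hΩ.exists_transversal hx₀
    have hTe : 0 < (T e).snd := hρ.trans (hT e (by simpa using hρ))
    refine ⟨frontier Ω ∩ Metric.ball x₀ r, inter_mem self_mem_nhdsWithin
      (mem_nhdsWithin_of_mem_nhds (Metric.ball_mem_nhds _ hr)), ?_⟩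
    have hP : MeasurableSet (frontier Ω ∩ Metric.ball x₀ r) :=
      isClosed_frontier.measurableSet.inter measurableSet_ball
    set Q := projAlong T e '' Metric.closedBall x₀ r with hQ
    have hQc : IsCompact Q := (isCompact_closedBall x₀ r).image (continuous_projAlong T e)
    have h1 := lintegral_projAlong_le T hTe.ne' (P := frontier Ω ∩ Metric.ball x₀ r)
      (fun x hx y hy t => hL x hx.1 y hy.1 hx.2 hy.2 e (by simpa using hρ) t)
      (J := Q.indicator 1) (measurable_one.indicator hQc.measurableSet)
    rw [lintegral_indicator_one hQc.measurableSet] at h1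
    calc surf Ω (frontier Ω ∩ Metric.ball x₀ r)
        ≤ Measure.euclideanHausdorffMeasure (d - 1) (frontier Ω ∩ Metric.ball x₀ r) :=
          Measure.restrict_apply_le _ _
      _ = ∫⁻ x in frontier Ω ∩ Metric.ball x₀ r, Q.indicator 1 (projAlong T e x)
            ∂(Measure.euclideanHausdorffMeasure (d - 1)) := by
          rw [← setLIntegral_one]
          refine setLIntegral_congr_fun hP fun x hx => ?_
          rw [indicator_of_mem]
          · rfl
          · exact mem_image_of_mem _ (Metric.ball_subset_closedBall hx.2)
      _ < ∞ := h1.trans_lt (ENNReal.mul_lt_top (by simp) hQc.measure_lt_top)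
  refine ⟨?_⟩
  rwa [surf, Measure.restrict_apply_univ, ← Measure.restrict_apply_self]

/-- The assertions about a neighbourhood of a boundary point on which the trace estimates rest. -/
structure IsTransversalPiece (Ω P : Set (Euc d)) (e : Euc d) (ρ : ℝ) (C : ℝ≥0∞) : Prop where
  pos : 0 < ρ
  ne_top : C ≠ ∞
  measurableSet : MeasurableSet P
  norm_sub_le : ∀ x ∈ P, ∀ y ∈ P, 2 * ‖x - y‖ ≤ ρ
  line_le : ∀ v, ‖v - e‖ < ρ → ∀ F : Euc d → ℝ≥0∞, Measurable F →
    ∫⁻ x in P, (∫⁻ t in Ioc (0 : ℝ) 1, F (x + t • v)) ∂(surf Ω) ≤ C * ∫⁻ x in Ω, F x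
  kernel_le : ∀ x ∈ P, ∀ t : ℝ, 0 < t →
    ∫⁻ y in P ∩ {y | t ≤ 2 / ρ * ‖x - y‖}, ENNReal.ofReal (‖x - y‖ ^ (-((d : ℝ) - 1 / 2))) ∂(surf Ω)
      ≤ C * ENNReal.ofReal (t ^ (-(1 / 2) : ℝ))

/-- The line estimate is Fubini's theorem along `v` for `F` cut off outside of `Ω`, as the segments
stay in `Ω`. The kernel estimate is the Euclidean one in dimension `d - 1`, transported by
`projAlong T e`, which distorts distances on the piece by bounded factors both ways. -/
theorem IsBoundedLipschitzDomain.exists_isTransversalPiece (hd : 2 ≤ d) {Ω : Set (Euc d)}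
    (hΩ : IsBoundedLipschitzDomain Ω) {x₀ : Euc d} (hx₀ : x₀ ∈ frontier Ω) :
    ∃ (r : ℝ) (e : Euc d) (ρ : ℝ) (C : ℝ≥0∞), 0 < r ∧
      IsTransversalPiece Ω (frontier Ω ∩ Metric.ball x₀ r) e ρ C := by
  obtain ⟨T, e, ρ, r, L, hρ, hr, hT, hcone, hL⟩ := hΩ.exists_transversal hx₀
  obtain ⟨C₀, hC₀, hker⟩ := exists_lintegral_rpow_norm_le (d - 1)
  have hTe : ρ < (T e).snd := hT e (by simpa using hρ)
  have hTe0 : 0 < (T e).snd := hρ.trans hTe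
  -- Two points of the piece are then closer than `ρ / 2`, so the scale `2 / ρ * ‖x - y‖` used later
  -- is at most one.
  set r' := min r (ρ / 4) with hr'
  have hr'0 : 0 < r' := lt_min hr (by positivity)
  set P := frontier Ω ∩ Metric.ball x₀ r' with hPdef
  have hP : MeasurableSet P := isClosed_frontier.measurableSet.inter measurableSet_ball
  have hxr : ∀ x ∈ P, dist x x₀ < r := fun x hx => (Metric.mem_ball.1 hx.2).trans_le (min_le_left _ _)
  have hLP : ∀ v, ‖v - e‖ < ρ → ∀ x ∈ P, ∀ y ∈ P, ∀ t : ℝ, ‖x - y‖ ≤ L * ‖x - y - t • v‖ :=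
    fun v hv x hx y hy t => hL x hx.1 y hy.1 (hxr x hx) (hxr y hy) v hv t
  have hsurf : (surf Ω).restrict P = (Measure.euclideanHausdorffMeasure (d - 1)).restrict P := by
    rw [surf, Measure.restrict_restrict hP, inter_eq_left.2 inter_subset_left]
  have hsurf2 : ∀ S : Set (Euc d), MeasurableSet S →
      (surf Ω).restrict (P ∩ S) = ((Measure.euclideanHausdorffMeasure (d - 1)).restrict P).restrict S := by
    intro S hS
    rw [← hsurf, Measure.restrict_restrict hS, inter_comm]
  set c : ℝ := 1 + ‖e‖ / (T e).snd with hc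
  have hc0 : 0 < c := by positivity
  have hd1 : ((d - 1 : ℕ) : ℝ) + 1 / 2 = (d : ℝ) - 1 / 2 := by
    rw [Nat.cast_sub (by omega)]; push_cast; ring
  have hexp : (0 : ℝ) ≤ (d : ℝ) - 1 / 2 := by rw [← hd1]; positivity
  -- The added one only ensures that `b`, by which `t` is divided, is positive.
  set L' : ℝ := L + 1 with hL'
  have hL'0 : 0 < L' := by positivity
  set b : ℝ := 2 / ρ * L' with hb
  have hb0 : 0 < b := by positivity
  set C₁ : ℝ≥0∞ := (L : ℝ≥0∞) ^ (d - 1) * (ENNReal.ofReal ρ)⁻¹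
  set C₂ : ℝ≥0∞ := (ENNReal.ofReal (c ^ ((d : ℝ) - 1 / 2)) *
    ((L : ℝ≥0∞) ^ (d - 1) * (C₀ * ENNReal.ofReal (b ^ (1 / 2 : ℝ)))))
  have hC₁ : C₁ ≠ ∞ := ENNReal.mul_ne_top (by simp) (by simpa using hρ)
  have hC₂ : C₂ ≠ ∞ := ENNReal.mul_ne_top (by simp)
    (ENNReal.mul_ne_top (by simp) (ENNReal.mul_ne_top hC₀ (by simp)))
  refine ⟨r', e, ρ, C₁ + C₂, hr'0, hρ, ENNReal.add_ne_top.2 ⟨hC₁, hC₂⟩, hP,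
    ?_, ?_, ?_⟩
  · intro x hx y hy
    have h1 : dist x y < r' + r' := (dist_triangle_right x y x₀).trans_lt (add_lt_add hx.2 hy.2)
    rw [← dist_eq_norm]
    have h2 : r' ≤ ρ / 4 := min_le_right _ _
    linarith
  · intro v hv F hF
    have h1 : ∀ x ∈ P, ∫⁻ t in Ioc (0 : ℝ) 1, F (x + t • v) ≤ ∫⁻ t : ℝ, Ω.indicator F (x + t • v) := by
      intro x hx
      rw [← lintegral_indicator measurableSet_Ioc]
      refine lintegral_mono fun t => ?_
      by_cases ht : t ∈ Ioc (0 : ℝ) 1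
      · rw [indicator_of_mem ht, indicator_of_mem (hcone x hx.1.1 (hxr x hx) v hv t ht)]
      · rw [indicator_of_notMem ht]; exact zero_le
    rw [hsurf]
    refine (setLIntegral_mono' hP h1).trans ?_
    refine (lintegral_lintegral_line_le T (hρ.trans (hT v hv)) (hLP v hv)
      (hF.indicator hΩ.isOpen.measurableSet)).trans ?_
    rw [lintegral_indicator hΩ.isOpen.measurableSet]
    refine mul_le_mul' ?_ le_rfl
    refine le_trans ?_ le_self_add
    exact mul_le_mul' le_rfl (ENNReal.inv_le_inv.2 (ENNReal.ofReal_le_ofReal (hT v hv).le))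
  · intro x hx t ht
    have hS : MeasurableSet {y : Euc d | t ≤ 2 / ρ * ‖x - y‖} :=
      measurableSet_le measurable_const (by fun_prop)
    set J : Euc (d - 1) → ℝ≥0∞ := fun w => {w : Euc (d - 1) | t / b ≤ ‖w‖}.indicator
      (fun w => ENNReal.ofReal (‖w‖ ^ (-((d : ℝ) - 1 / 2)))) (w - projAlong T e x) with hJdef
    have hSJ : MeasurableSet {w : Euc (d - 1) | t / b ≤ ‖w‖} :=
      measurableSet_le measurable_const measurable_norm
    have hJ0 : Measurable ({w : Euc (d - 1) | t / b ≤ ‖w‖}.indicator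
      (fun w => ENNReal.ofReal (‖w‖ ^ (-((d : ℝ) - 1 / 2))))) :=
      Measurable.indicator (by fun_prop) hSJ
    have hJ : Measurable J := hJ0.comp (measurable_id.sub_const _)
    have hJint : ∫⁻ w, J w ≤ C₀ * ENNReal.ofReal (b ^ (1 / 2 : ℝ)) *
        ENNReal.ofReal (t ^ (-(1 / 2) : ℝ)) := by
      rw [lintegral_sub_right_eq_self (fun w => {w : Euc (d - 1) | t / b ≤ ‖w‖}.indicator
        (fun w => ENNReal.ofReal (‖w‖ ^ (-((d : ℝ) - 1 / 2)))) w), lintegral_indicator hSJ]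
      have := hker (t / b) (by positivity)
      rw [hd1] at this
      refine this.trans (le_of_eq ?_)
      rw [mul_assoc, ← ENNReal.ofReal_mul (by positivity), Real.div_rpow ht.le hb0.le,
        Real.rpow_neg hb0.le]
      congr 2
      field_simp
    have hpt : ∀ y ∈ P, {y : Euc d | t ≤ 2 / ρ * ‖x - y‖}.indicator
        (fun y => ENNReal.ofReal (‖x - y‖ ^ (-((d : ℝ) - 1 / 2)))) y
        ≤ ENNReal.ofReal (c ^ ((d : ℝ) - 1 / 2)) * J (projAlong T e y) := by
      intro y hy
      by_cases hty : t ≤ 2 / ρ * ‖x - y‖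
      · obtain ⟨τ, hτ⟩ := exists_norm_sub_projAlong T hTe0.ne' y x
        have h1 := hLP e (by simpa using hρ) y hy x hx τ
        rw [hτ] at h1
        have h2 := norm_projAlong_sub_le T hTe0 y x
        rw [norm_sub_rev y x] at h1 h2
        set q := ‖projAlong T e y - projAlong T e x‖ with hq
        have hxy0 : 0 < ‖x - y‖ := by
          by_contra! h0
          have : 2 / ρ * ‖x - y‖ ≤ 0 := mul_nonpos_of_nonneg_of_nonpos (by positivity) h0
          linarith
        have h1' : ‖x - y‖ ≤ L' * q := h1.trans (by
          refine mul_le_mul_of_nonneg_right ?_ (norm_nonneg _); rw [hL']; linarith)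
        have hq0 : 0 < q := by
          by_contra! h0
          have : L' * q ≤ 0 := mul_nonpos_of_nonneg_of_nonpos hL'0.le h0
          linarith
        rw [indicator_of_mem (show y ∈ {y : Euc d | t ≤ 2 / ρ * ‖x - y‖} from hty), hJdef]
        simp only
        rw [indicator_of_mem, ← hq, ← ENNReal.ofReal_mul (by positivity)]
        · refine ENNReal.ofReal_le_ofReal ?_
          calc ‖x - y‖ ^ (-((d : ℝ) - 1 / 2)) ≤ (q / c) ^ (-((d : ℝ) - 1 / 2)) := by
                refine Real.rpow_le_rpow_of_nonpos (by positivity) ?_ (by linarith)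
                rw [div_le_iff₀ hc0, mul_comm]
                exact h2
            _ = _ := by
                rw [Real.div_rpow hq0.le hc0.le, Real.rpow_neg hc0.le, div_inv_eq_mul, mul_comm]
        · simp only [mem_ofPred_eq, ← hq]
          rw [div_le_iff₀ hb0, hb]
          calc t ≤ 2 / ρ * ‖x - y‖ := hty
            _ ≤ 2 / ρ * (L' * q) := by gcongr
            _ = _ := by ring
      · rw [indicator_of_notMem (show y ∉ {y : Euc d | t ≤ 2 / ρ * ‖x - y‖} from hty)]
        exact zero_le
    rw [hsurf2 _ hS, ← lintegral_indicator hS]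
    refine (setLIntegral_mono' hP hpt).trans ?_
    rw [lintegral_const_mul' _ _ ENNReal.ofReal_ne_top]
    have h3 := lintegral_projAlong_le T hTe0.ne' (hLP e (by simpa using hρ)) hJ
    calc _ ≤ ENNReal.ofReal (c ^ ((d : ℝ) - 1 / 2)) * ((L : ℝ≥0∞) ^ (d - 1) *
          (C₀ * ENNReal.ofReal (b ^ (1 / 2 : ℝ)) * ENNReal.ofReal (t ^ (-(1 / 2) : ℝ)))) :=
          mul_le_mul' le_rfl (h3.trans (mul_le_mul' le_rfl hJint))
      _ = C₂ * ENNReal.ofReal (t ^ (-(1 / 2) : ℝ)) := by ring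
      _ ≤ _ := mul_le_mul' le_add_self le_rfl

theorem lintegral_rpow_neg_half {s : ℝ} (hs : 0 < s) :
    ∫⁻ t in Ioc 0 s, ENNReal.ofReal (t ^ (-(1 / 2) : ℝ)) = ENNReal.ofReal (2 * s ^ (1 / 2 : ℝ)) := by
  have hint : IntervalIntegrable (fun t : ℝ => t ^ (-(1 / 2) : ℝ)) volume 0 s :=
    intervalIntegral.intervalIntegrable_rpow' (by norm_num)
  rw [← ofReal_integral_eq_lintegral_ofReal
    ((intervalIntegrable_iff_integrableOn_Ioc_of_le hs.le).1 hint)]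
  · rw [← intervalIntegral.integral_of_le hs.le, integral_rpow (Or.inl (by norm_num))]
    congr 1
    norm_num
    ring
  · refine (ae_restrict_iff' measurableSet_Ioc).2 (Eventually.of_forall fun t ht => ?_)
    exact Real.rpow_nonneg ht.1.le _

/-- A weighted Cauchy–Schwarz inequality. -/
theorem sq_lintegral_Ioc_le {s : ℝ} (hs : 0 < s) {g : ℝ → ℝ≥0∞} (hg : Measurable g) :
    (∫⁻ t in Ioc 0 s, g t) ^ 2 ≤ ENNReal.ofReal (2 * s ^ (1 / 2 : ℝ)) *
      ∫⁻ t in Ioc 0 s, ENNReal.ofReal (t ^ (1 / 2 : ℝ)) * g t ^ 2 := by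
  -- The integrand is split as `t ^ (-1/4)` times `t ^ (1/4) * g t`; the square of the first factor
  -- is still integrable at zero.
  have h := sq_lintegral_mul_le (volume.restrict (Ioc 0 s))
    (f := fun t => ENNReal.ofReal (t ^ (-(1 / 4) : ℝ)))
    (g := fun t => ENNReal.ofReal (t ^ (1 / 4 : ℝ)) * g t) (by fun_prop)
    ((Measurable.ennreal_ofReal (by fun_prop)).mul hg).aemeasurable
  have h1 : ∫⁻ t in Ioc 0 s, ENNReal.ofReal (t ^ (-(1 / 4) : ℝ)) *
      (ENNReal.ofReal (t ^ (1 / 4 : ℝ)) * g t) = ∫⁻ t in Ioc 0 s, g t := by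
    refine setLIntegral_congr_fun measurableSet_Ioc fun t ht => ?_
    have h0 : 0 ≤ t ^ (-(1 / 4) : ℝ) := Real.rpow_nonneg ht.1.le _
    rw [← mul_assoc, ← ENNReal.ofReal_mul h0, ← Real.rpow_add ht.1]
    norm_num
  have h2 : ∫⁻ t in Ioc 0 s, ENNReal.ofReal (t ^ (-(1 / 4) : ℝ)) ^ 2
      = ENNReal.ofReal (2 * s ^ (1 / 2 : ℝ)) := by
    rw [← lintegral_rpow_neg_half hs]
    refine setLIntegral_congr_fun measurableSet_Ioc fun t ht => ?_
    have h0 : 0 ≤ t ^ (-(1 / 4) : ℝ) := Real.rpow_nonneg ht.1.le _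
    rw [← ENNReal.ofReal_pow h0, ← Real.rpow_natCast, ← Real.rpow_mul ht.1.le]
    norm_num
  have h3 : ∫⁻ t in Ioc 0 s, (ENNReal.ofReal (t ^ (1 / 4 : ℝ)) * g t) ^ 2
      = ∫⁻ t in Ioc 0 s, ENNReal.ofReal (t ^ (1 / 2 : ℝ)) * g t ^ 2 := by
    refine setLIntegral_congr_fun measurableSet_Ioc fun t ht => ?_
    have h0 : 0 ≤ t ^ (1 / 4 : ℝ) := Real.rpow_nonneg ht.1.le _
    rw [mul_pow, ← ENNReal.ofReal_pow h0, ← Real.rpow_natCast, ← Real.rpow_mul ht.1.le]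
    norm_num
  rwa [h1, h2, h3] at h

namespace IsTransversalPiece

variable {Ω P : Set (Euc d)} {e : Euc d} {ρ : ℝ} {C : ℝ≥0∞}

/-- The `L²` trace estimate near a boundary point. -/
theorem lintegral_sq_le [IsFiniteMeasure (surf Ω)] (hP : IsTransversalPiece Ω P e ρ C)
    {φ : Euc d → ℂ} (hφ : ContDiff ℝ 1 φ) :
    ∫⁻ x in P, ‖φ x‖ₑ ^ 2 ∂(surf Ω) ≤ 2 * C * (1 + ‖e‖ₑ ^ 2) *
      ((∫⁻ x in Ω, ‖φ x‖ₑ ^ 2) + ∫⁻ x in Ω, ‖gradE φ x‖ₑ ^ 2) := by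
  have hgm : Measurable fun x => ‖gradE φ x‖ₑ := (continuous_gradE hφ).measurable.enorm
  have hφm : Measurable fun x => ‖φ x‖ₑ := hφ.continuous.measurable.enorm
  have he : ‖e - e‖ < ρ := by simpa using hP.pos
  have h1 : ∀ x, ‖φ x‖ₑ ^ 2 ≤ 2 * ‖e‖ₑ ^ 2 * (∫⁻ t in Ioc (0 : ℝ) 1, ‖gradE φ (x + t • e)‖ₑ ^ 2)
      + 2 * ∫⁻ t in Ioc (0 : ℝ) 1, ‖φ (x + t • e)‖ₑ ^ 2 := by
    intro x
    -- The bound holds for every `t`; integrating over the unit interval replaces the value at one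
    -- point of the segment by its mean, which `line_le` controls.
    have h2 : ∀ t ∈ Ioc (0 : ℝ) 1, ‖φ x‖ₑ ^ 2
        ≤ 2 * ‖e‖ₑ ^ 2 * (∫⁻ t in Ioc (0 : ℝ) 1, ‖gradE φ (x + t • e)‖ₑ ^ 2)
          + 2 * ‖φ (x + t • e)‖ₑ ^ 2 := by
      intro t ht
      have h3 : ‖φ (x + t • e) - φ x‖ₑ
          ≤ ‖e‖ₑ * ∫⁻ t in Ioc (0 : ℝ) 1, ‖gradE φ (x + t • e)‖ₑ := by
        refine (enorm_sub_le_lintegral hφ x e ht.1.le).trans (mul_le_mul' le_rfl ?_)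
        exact lintegral_mono_set (Ioc_subset_Ioc_right ht.2)
      have h4 : ‖φ x‖ₑ ≤ ‖φ (x + t • e) - φ x‖ₑ + ‖φ (x + t • e)‖ₑ := by
        rw [enorm_sub_rev]
        refine le_trans (le_of_eq ?_) (enorm_add_le _ _)
        simp
      have h5 : (∫⁻ t in Ioc (0 : ℝ) 1, ‖gradE φ (x + t • e)‖ₑ) ^ 2
          ≤ ∫⁻ t in Ioc (0 : ℝ) 1, ‖gradE φ (x + t • e)‖ₑ ^ 2 :=
        (sq_lintegral_le _ (hgm.comp (by fun_prop)).aemeasurable).trans (by simp)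
      calc ‖φ x‖ₑ ^ 2 ≤ (‖φ (x + t • e) - φ x‖ₑ + ‖φ (x + t • e)‖ₑ) ^ 2 := pow_le_pow_left' h4 2
        _ ≤ 2 * ‖φ (x + t • e) - φ x‖ₑ ^ 2 + 2 * ‖φ (x + t • e)‖ₑ ^ 2 := ennreal_add_sq_le _ _
        _ ≤ 2 * (‖e‖ₑ ^ 2 * (∫⁻ t in Ioc (0 : ℝ) 1, ‖gradE φ (x + t • e)‖ₑ ^ 2))
            + 2 * ‖φ (x + t • e)‖ₑ ^ 2 := by
          refine add_le_add (mul_le_mul' le_rfl ((pow_le_pow_left' h3 2).trans ?_)) le_rfl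
          rw [mul_pow]
          exact mul_le_mul' le_rfl h5
        _ = _ := by rw [mul_assoc]
    have h6 := setLIntegral_mono' (μ := volume) measurableSet_Ioc h2
    rw [lintegral_add_left measurable_const, lintegral_const, lintegral_const,
      lintegral_const_mul' _ _ (by simp)] at h6
    simpa using h6
  have hm1 : Measurable fun x => ∫⁻ t in Ioc (0 : ℝ) 1, ‖gradE φ (x + t • e)‖ₑ ^ 2 :=
    Measurable.lintegral_prod_right' (f := fun p : Euc d × ℝ => ‖gradE φ (p.1 + p.2 • e)‖ₑ ^ 2)
      ((hgm.comp (by fun_prop)).pow_const 2)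
  calc ∫⁻ x in P, ‖φ x‖ₑ ^ 2 ∂(surf Ω) ≤ _ := lintegral_mono h1
    _ = 2 * ‖e‖ₑ ^ 2 * (∫⁻ x in P, (∫⁻ t in Ioc (0 : ℝ) 1, ‖gradE φ (x + t • e)‖ₑ ^ 2) ∂(surf Ω))
        + 2 * ∫⁻ x in P, (∫⁻ t in Ioc (0 : ℝ) 1, ‖φ (x + t • e)‖ₑ ^ 2) ∂(surf Ω) := by
      rw [lintegral_add_left (hm1.const_mul _), lintegral_const_mul' _ _ (by finiteness),
        lintegral_const_mul' _ _ (by finiteness)]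
    _ ≤ 2 * ‖e‖ₑ ^ 2 * (C * ∫⁻ x in Ω, ‖gradE φ x‖ₑ ^ 2) + 2 * (C * ∫⁻ x in Ω, ‖φ x‖ₑ ^ 2) :=
      add_le_add (mul_le_mul' le_rfl (hP.line_le e he (fun x => ‖gradE φ x‖ₑ ^ 2) (hgm.pow_const 2)))
        (mul_le_mul' le_rfl (hP.line_le e he (fun x => ‖φ x‖ₑ ^ 2) (hφm.pow_const 2)))
    _ = 2 * C * (‖e‖ₑ ^ 2 * (∫⁻ x in Ω, ‖gradE φ x‖ₑ ^ 2) + 1 * ∫⁻ x in Ω, ‖φ x‖ₑ ^ 2) := by ring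
    _ ≤ 2 * C * ((1 + ‖e‖ₑ ^ 2) * (∫⁻ x in Ω, ‖gradE φ x‖ₑ ^ 2)
          + (1 + ‖e‖ₑ ^ 2) * ∫⁻ x in Ω, ‖φ x‖ₑ ^ 2) := by
      refine mul_le_mul' le_rfl (add_le_add (mul_le_mul' le_add_self le_rfl)
        (mul_le_mul' le_self_add le_rfl))
    _ = _ := by ring

/-- The mean square of the increments of `φ` from `x` in the directions near `e`, at scale `s`. -/
def meanIncr (φ : Euc d → ℂ) (e : Euc d) (ρ : ℝ) (x : Euc d) (s : ℝ) : ℝ≥0∞ :=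
  ∫⁻ v in Metric.ball e ρ, ‖φ (x + s • v) - φ x‖ₑ ^ 2

theorem measurable_meanIncr {φ : Euc d → ℂ} (hφ : Continuous φ) (e : Euc d) (ρ : ℝ) :
    Measurable fun q : Euc d × ℝ => meanIncr φ e ρ q.1 q.2 := by
  refine Measurable.lintegral_prod_right' (ν := volume.restrict (Metric.ball e ρ))
    (f := fun p : (Euc d × ℝ) × Euc d => ‖φ (p.1.1 + p.1.2 • p.2) - φ p.1.1‖ₑ ^ 2) ?_
  exact (Continuous.measurable (by fun_prop)).enorm.pow_const 2

theorem measurable_meanIncr_comp {φ : Euc d → ℂ} (hφ : Continuous φ) (e : Euc d) (ρ : ℝ)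
    {s : Euc d × Euc d → ℝ} (hs : Measurable s) :
    Measurable fun q : Euc d × Euc d => meanIncr φ e ρ q.1 (s q) := by
  have hq : Measurable fun q : Euc d × Euc d => (q.1, s q) := measurable_fst.prodMk hs
  have h := (measurable_meanIncr hφ e ρ).comp hq
  exact h

/-- Both points reach a common one: `x + s • v = y + s • (v + w)` with `w = s⁻¹ • (x - y)`. The
choice of `s` makes `‖w‖ = ρ / 2`, so for `v` in the half ball both `v` and `v + w` are admissible
directions. Averaging over `v` gives the two mean increments. -/
theorem enorm_sub_sq_le (hρ : 0 < ρ) {φ : Euc d → ℂ} (hφ : Continuous φ)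
    {x y : Euc d} (hxy : x ≠ y) :
    volume (Metric.ball e (ρ / 2)) * ‖φ x - φ y‖ₑ ^ 2 ≤
      2 * (meanIncr φ e ρ x (2 / ρ * ‖x - y‖) + meanIncr φ e ρ y (2 / ρ * ‖x - y‖)) := by
  set s := 2 / ρ * ‖x - y‖ with hs
  have hn : 0 < ‖x - y‖ := norm_pos_iff.2 (sub_ne_zero.2 hxy)
  have hs0 : 0 < s := by positivity
  set w := s⁻¹ • (x - y) with hw
  have hwn : ‖w‖ = ρ / 2 := by
    rw [hw, norm_smul, norm_inv, Real.norm_of_nonneg hs0.le, hs]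
    field_simp
  have h1 : ∀ v, ‖φ x - φ y‖ₑ ^ 2 ≤
      2 * ‖φ (x + s • v) - φ x‖ₑ ^ 2 + 2 * ‖φ (y + s • (v + w)) - φ y‖ₑ ^ 2 := by
    intro v
    have h2 : y + s • (v + w) = x + s • v := by
      rw [hw, smul_add, smul_inv_smul₀ hs0.ne']; abel
    rw [h2]
    refine le_trans (pow_le_pow_left' ?_ 2) (ennreal_add_sq_le _ _)
    rw [enorm_sub_rev (φ (x + s • v)) (φ x)]
    refine le_trans (le_of_eq ?_) (enorm_add_le _ _)
    congr 1; ring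
  have hmx : Measurable fun v => ‖φ (x + s • v) - φ x‖ₑ ^ 2 :=
    (Continuous.measurable (by fun_prop)).enorm.pow_const 2
  have h3 : ∫⁻ v in Metric.ball e (ρ / 2), ‖φ (y + s • (v + w)) - φ y‖ₑ ^ 2
      ≤ meanIncr φ e ρ y s := by
    rw [meanIncr, ← lintegral_indicator measurableSet_ball, ← lintegral_indicator measurableSet_ball,
      ← lintegral_add_right_eq_self ((Metric.ball e ρ).indicator _) w]
    refine lintegral_mono fun v => ?_
    by_cases hv : v ∈ Metric.ball e (ρ / 2)
    · rw [indicator_of_mem hv, indicator_of_mem]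
      rw [Metric.mem_ball, dist_eq_norm] at hv ⊢
      calc ‖v + w - e‖ = ‖(v - e) + w‖ := by congr 1; abel
        _ ≤ ‖v - e‖ + ‖w‖ := norm_add_le _ _
        _ < ρ := by linarith
    · rw [indicator_of_notMem hv]; exact zero_le
  calc volume (Metric.ball e (ρ / 2)) * ‖φ x - φ y‖ₑ ^ 2
      = ∫⁻ _ in Metric.ball e (ρ / 2), ‖φ x - φ y‖ₑ ^ 2 := by
        rw [setLIntegral_const, mul_comm]
    _ ≤ ∫⁻ v in Metric.ball e (ρ / 2), (2 * ‖φ (x + s • v) - φ x‖ₑ ^ 2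
          + 2 * ‖φ (y + s • (v + w)) - φ y‖ₑ ^ 2) := lintegral_mono h1
    _ = 2 * (∫⁻ v in Metric.ball e (ρ / 2), ‖φ (x + s • v) - φ x‖ₑ ^ 2)
          + 2 * ∫⁻ v in Metric.ball e (ρ / 2), ‖φ (y + s • (v + w)) - φ y‖ₑ ^ 2 := by
        rw [lintegral_add_left (hmx.const_mul 2), lintegral_const_mul' _ _ (by finiteness),
          lintegral_const_mul' _ _ (by finiteness)]
    _ ≤ 2 * meanIncr φ e ρ x s + 2 * meanIncr φ e ρ y s := by
        refine add_le_add (mul_le_mul' le_rfl ?_) (mul_le_mul' le_rfl h3)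
        exact lintegral_mono_set (Metric.ball_subset_ball (by linarith))
    _ = _ := by ring

/-- The weighted Cauchy–Schwarz inequality along each segment yields the gain `s ^ (1/2)`. The
restriction `t ≤ s` is written as an indicator on the fixed interval so that the order of
integration can be exchanged later. -/
theorem meanIncr_le {φ : Euc d → ℂ} (hφ : ContDiff ℝ 1 φ) (x : Euc d) {s : ℝ} (hs : 0 < s)
    (hs1 : s ≤ 1) :
    meanIncr φ e ρ x s ≤ ENNReal.ofReal ((‖e‖ + ρ) ^ 2 * (2 * s ^ (1 / 2 : ℝ))) *
      ∫⁻ v in Metric.ball e ρ, ∫⁻ t in Ioc (0 : ℝ) 1, (Iic s).indicator 1 t *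
        (ENNReal.ofReal (t ^ (1 / 2 : ℝ)) * ‖gradE φ (x + t • v)‖ₑ ^ 2) := by
  have hgm : Measurable fun x => ‖gradE φ x‖ₑ := (continuous_gradE hφ).measurable.enorm
  rw [meanIncr, ← lintegral_const_mul' _ _ ENNReal.ofReal_ne_top]
  refine setLIntegral_mono' measurableSet_ball fun v hv => ?_
  have hvn : ‖v‖ₑ ^ 2 ≤ ENNReal.ofReal ((‖e‖ + ρ) ^ 2) := by
    rw [← ofReal_norm, ← ENNReal.ofReal_pow (norm_nonneg _)]
    refine ENNReal.ofReal_le_ofReal (pow_le_pow_left₀ (norm_nonneg _) ?_ 2)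
    have h1 := norm_sub_norm_le v e
    rw [Metric.mem_ball, dist_eq_norm] at hv
    linarith
  have h2 : ∫⁻ t in Ioc (0 : ℝ) 1, (Iic s).indicator 1 t *
        (ENNReal.ofReal (t ^ (1 / 2 : ℝ)) * ‖gradE φ (x + t • v)‖ₑ ^ 2)
      = ∫⁻ t in Ioc (0 : ℝ) s, ENNReal.ofReal (t ^ (1 / 2 : ℝ)) * ‖gradE φ (x + t • v)‖ₑ ^ 2 := by
    rw [← lintegral_indicator measurableSet_Ioc, ← lintegral_indicator measurableSet_Ioc]
    refine lintegral_congr fun t => ?_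
    by_cases ht : t ∈ Ioc 0 s
    · rw [indicator_of_mem ht, indicator_of_mem (show t ∈ Ioc (0 : ℝ) 1 from ⟨ht.1, ht.2.trans hs1⟩),
        indicator_of_mem (show t ∈ Iic s from ht.2), Pi.one_apply, one_mul]
    · rw [indicator_of_notMem ht]
      by_cases ht1 : t ∈ Ioc (0 : ℝ) 1
      · rw [indicator_of_mem ht1, indicator_of_notMem (show t ∉ Iic s from fun h => ht ⟨ht1.1, h⟩), zero_mul]
      · rw [indicator_of_notMem ht1]
  rw [h2, ENNReal.ofReal_mul (by positivity), mul_assoc]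
  calc ‖φ (x + s • v) - φ x‖ₑ ^ 2
      ≤ (‖v‖ₑ * ∫⁻ t in Ioc 0 s, ‖gradE φ (x + t • v)‖ₑ) ^ 2 :=
        pow_le_pow_left' (enorm_sub_le_lintegral hφ x v hs.le) 2
    _ = ‖v‖ₑ ^ 2 * (∫⁻ t in Ioc 0 s, ‖gradE φ (x + t • v)‖ₑ) ^ 2 := mul_pow _ _ _
    _ ≤ _ := mul_le_mul' hvn (sq_lintegral_Ioc_le hs (hgm.comp (by fun_prop)))

/-- An inequality of Hardy type. The gain `s ^ (1/2)` weakens the kernel to the exponent `-(d -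
1/2)`; integrating first over the `y` with `t ≤ 2 / ρ * ‖x - y‖` gives at most `C * t ^ (-1/2)`,
which cancels the weight `t ^ (1/2)`. -/
theorem lintegral_kernel_meanIncr_le [IsFiniteMeasure (surf Ω)] (hP : IsTransversalPiece Ω P e ρ C)
    {φ : Euc d → ℂ} (hφ : ContDiff ℝ 1 φ) {x : Euc d} (hx : x ∈ P) :
    ∫⁻ y in P, ENNReal.ofReal (‖x - y‖ ^ (-(d : ℝ))) * meanIncr φ e ρ x (2 / ρ * ‖x - y‖) ∂(surf Ω)
      ≤ ENNReal.ofReal ((‖e‖ + ρ) ^ 2 * (2 * (2 / ρ) ^ (1 / 2 : ℝ))) * C *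
        ∫⁻ v in Metric.ball e ρ, ∫⁻ t in Ioc (0 : ℝ) 1, ‖gradE φ (x + t • v)‖ₑ ^ 2 := by
  have hρ := hP.pos
  have hgm : Measurable fun x => ‖gradE φ x‖ₑ := (continuous_gradE hφ).measurable.enorm
  set a : ℝ := (‖e‖ + ρ) ^ 2 * (2 * (2 / ρ) ^ (1 / 2 : ℝ)) with ha
  have ha0 : 0 ≤ a := by positivity
  set ν := ((volume : Measure (Euc d)).restrict (Metric.ball e ρ)).prod
    ((volume : Measure ℝ).restrict (Ioc 0 1)) with hν
  set k : Euc d → ℝ → ℝ≥0∞ := fun y t => {y : Euc d | t ≤ 2 / ρ * ‖x - y‖}.indicator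
    (fun y => ENNReal.ofReal (‖x - y‖ ^ (-((d : ℝ) - 1 / 2)))) y with hk
  set f : Euc d × ℝ → ℝ≥0∞ := fun p =>
    ENNReal.ofReal (p.2 ^ (1 / 2 : ℝ)) * ‖gradE φ (x + p.2 • p.1)‖ₑ ^ 2 with hf
  have hfm : Measurable f := (Measurable.ennreal_ofReal (by fun_prop)).mul
    ((hgm.comp (by fun_prop)).pow_const 2)
  have hkm : Measurable fun q : Euc d × ℝ => k q.1 q.2 := by
    have : (fun q : Euc d × ℝ => k q.1 q.2) = {q : Euc d × ℝ | q.2 ≤ 2 / ρ * ‖x - q.1‖}.indicator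
        (fun q => ENNReal.ofReal (‖x - q.1‖ ^ (-((d : ℝ) - 1 / 2)))) := by
      ext q; simp only [hk, indicator, mem_ofPred_eq]
    rw [this]
    refine Measurable.indicator (by fun_prop) (measurableSet_le (by fun_prop) (by fun_prop))
  have h1 : ∀ y ∈ P, ENNReal.ofReal (‖x - y‖ ^ (-(d : ℝ))) * meanIncr φ e ρ x (2 / ρ * ‖x - y‖)
      ≤ ENNReal.ofReal a * ∫⁻ p, k y p.2 * f p ∂ν := by
    intro y hy
    rcases eq_or_ne x y with rfl | hxy
    · have : meanIncr φ e ρ x (2 / ρ * ‖x - x‖) = 0 := by simp [meanIncr]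
      rw [this, mul_zero]; exact zero_le
    · have hn : 0 < ‖x - y‖ := norm_pos_iff.2 (sub_ne_zero.2 hxy)
      have hs1 : 2 / ρ * ‖x - y‖ ≤ 1 := by
        have := hP.norm_sub_le x hx y hy
        rw [div_mul_eq_mul_div, div_le_one hρ]; exact this
      refine (mul_le_mul' le_rfl (meanIncr_le hφ x (by positivity) hs1)).trans (le_of_eq ?_)
      rw [hν, lintegral_prod]
      · rw [← mul_assoc, ← ENNReal.ofReal_mul (by positivity)]
        have h2 : ‖x - y‖ ^ (-(d : ℝ)) * ((‖e‖ + ρ) ^ 2 * (2 * (2 / ρ * ‖x - y‖) ^ (1 / 2 : ℝ)))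
            = a * ‖x - y‖ ^ (-((d : ℝ) - 1 / 2)) := by
          rw [Real.mul_rpow (by positivity) hn.le, ha,
            show -((d : ℝ) - 1 / 2) = -(d : ℝ) + 1 / 2 by ring, Real.rpow_add hn]
          ring
        rw [h2, ENNReal.ofReal_mul ha0, mul_assoc, ← lintegral_const_mul' _ _ ENNReal.ofReal_ne_top]
        congr 1
        refine lintegral_congr fun v => ?_
        rw [← lintegral_const_mul' _ _ ENNReal.ofReal_ne_top]
        refine lintegral_congr fun t => ?_
        by_cases ht : t ≤ 2 / ρ * ‖x - y‖
        · simp only [hk]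
          rw [indicator_of_mem (show t ∈ Iic _ from ht),
            indicator_of_mem (show y ∈ {y : Euc d | t ≤ 2 / ρ * ‖x - y‖} from ht), Pi.one_apply,
            one_mul]
        · simp only [hk]
          rw [indicator_of_notMem (show t ∉ Iic _ from ht),
            indicator_of_notMem (show y ∉ {y : Euc d | t ≤ 2 / ρ * ‖x - y‖} from ht), zero_mul,
            mul_zero]
      · exact ((hkm.comp (measurable_const.prodMk measurable_snd)).mul hfm).aemeasurable
  refine (setLIntegral_mono' hP.measurableSet h1).trans ?_
  rw [lintegral_const_mul' _ _ ENNReal.ofReal_ne_top, mul_assoc]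
  refine mul_le_mul' le_rfl ?_
  rw [lintegral_lintegral_swap]
  · have h3 : ∀ᵐ p ∂ν, ∫⁻ y in P, k y p.2 * f p ∂(surf Ω) ≤ C * ‖gradE φ (x + p.2 • p.1)‖ₑ ^ 2 := by
      have hpos : ∀ᵐ p ∂ν, p.2 ∈ Ioc (0 : ℝ) 1 :=
        Measure.quasiMeasurePreserving_snd.ae (ae_restrict_mem measurableSet_Ioc)
      filter_upwards [hpos] with p hp
      have hSm : MeasurableSet {y : Euc d | p.2 ≤ 2 / ρ * ‖x - y‖} :=
        measurableSet_le measurable_const (by fun_prop)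
      rw [lintegral_mul_const' _ _ (by rw [hf]; finiteness)]
      simp only [hk]
      rw [lintegral_indicator hSm, Measure.restrict_restrict hSm, inter_comm]
      refine (mul_le_mul' (hP.kernel_le x hx p.2 hp.1) le_rfl).trans (le_of_eq ?_)
      have h0 : 0 ≤ p.2 ^ (-(1 / 2) : ℝ) := Real.rpow_nonneg hp.1.le _
      simp only [hf]
      rw [mul_assoc, ← mul_assoc (ENNReal.ofReal _) (ENNReal.ofReal _), ← ENNReal.ofReal_mul h0,
        ← Real.rpow_add hp.1]
      norm_num
    refine (lintegral_mono_ae h3).trans (le_of_eq ?_)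
    rw [lintegral_const_mul' _ _ hP.ne_top, hν, lintegral_prod]
    exact ((hgm.comp (by fun_prop)).pow_const 2).aemeasurable
  · refine Measurable.aemeasurable ?_
    exact (hkm.comp (measurable_fst.prodMk (measurable_snd.comp measurable_snd))).mul
      (hfm.comp measurable_snd)

/-- The mean square of the increments of `φ` from `x` at the scale of `y`, with the kernel of the
Gagliardo seminorm. -/
def kernelIncr (φ : Euc d → ℂ) (e : Euc d) (ρ : ℝ) (x y : Euc d) : ℝ≥0∞ :=
  ENNReal.ofReal (‖x - y‖ ^ (-(d : ℝ))) * meanIncr φ e ρ x (2 / ρ * ‖x - y‖)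

theorem measurable_kernelIncr {φ : Euc d → ℂ} (hφ : Continuous φ) (e : Euc d) (ρ : ℝ) :
    Measurable fun q : Euc d × Euc d => kernelIncr φ e ρ q.1 q.2 := by
  have hs : Measurable fun q : Euc d × Euc d => 2 / ρ * ‖q.1 - q.2‖ := by fun_prop
  have hK : Measurable fun q : Euc d × Euc d => ENNReal.ofReal (‖q.1 - q.2‖ ^ (-(d : ℝ))) := by
    fun_prop
  unfold kernelIncr
  have hA : Measurable fun q : Euc d × Euc d => meanIncr φ e ρ q.1 (2 / ρ * ‖q.1 - q.2‖) :=
    measurable_meanIncr_comp hφ e ρ hs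
  exact hK.mul hA

theorem kernel_mul_enorm_sub_sq_le (hρ : 0 < ρ) {φ : Euc d → ℂ} (hφ : Continuous φ)
    (x y : Euc d) :
    ENNReal.ofReal (‖x - y‖ ^ (-(d : ℝ))) * ‖φ x - φ y‖ₑ ^ 2
      ≤ (volume (Metric.ball e (ρ / 2)))⁻¹ * 2 * (kernelIncr φ e ρ x y + kernelIncr φ e ρ y x) := by
  rcases eq_or_ne x y with rfl | hxy
  · simp
  · have hb0 : volume (Metric.ball e (ρ / 2)) ≠ 0 :=
      (Metric.measure_ball_pos _ _ (by positivity)).ne'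
    have hbt : volume (Metric.ball e (ρ / 2)) ≠ ∞ := measure_ball_lt_top.ne
    have h3 : ‖φ x - φ y‖ₑ ^ 2 ≤ (volume (Metric.ball e (ρ / 2)))⁻¹ *
        (2 * (meanIncr φ e ρ x (2 / ρ * ‖x - y‖) + meanIncr φ e ρ y (2 / ρ * ‖x - y‖))) := by
      calc ‖φ x - φ y‖ₑ ^ 2 = (volume (Metric.ball e (ρ / 2)))⁻¹ *
            (volume (Metric.ball e (ρ / 2)) * ‖φ x - φ y‖ₑ ^ 2) := by
            rw [← mul_assoc, ENNReal.inv_mul_cancel hb0 hbt, one_mul]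
        _ ≤ _ := mul_le_mul' le_rfl (enorm_sub_sq_le (e := e) hρ hφ hxy)
    refine (mul_le_mul' le_rfl h3).trans (le_of_eq ?_)
    rw [kernelIncr, kernelIncr, norm_sub_rev y x]
    ring

/-- After the `y`-integration only means of the squared gradient along segments remain. For each
fixed `v` their integral over the piece is bounded by the Dirichlet integral, and `v` ranges over a
ball of finite volume. -/
theorem lintegral_kernelIncr_le [IsFiniteMeasure (surf Ω)] (hP : IsTransversalPiece Ω P e ρ C)
    {φ : Euc d → ℂ} (hφ : ContDiff ℝ 1 φ) :
    ∫⁻ x in P, (∫⁻ y in P, kernelIncr φ e ρ x y ∂(surf Ω)) ∂(surf Ω)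
      ≤ ENNReal.ofReal ((‖e‖ + ρ) ^ 2 * (2 * (2 / ρ) ^ (1 / 2 : ℝ))) * C *
        (volume (Metric.ball e ρ) * C) * ∫⁻ x in Ω, ‖gradE φ x‖ₑ ^ 2 := by
  have hgm : Measurable fun x => ‖gradE φ x‖ₑ := (continuous_gradE hφ).measurable.enorm
  refine (setLIntegral_mono' hP.measurableSet
    (fun x hx => hP.lintegral_kernel_meanIncr_le hφ hx)).trans ?_
  rw [lintegral_const_mul' _ _ (ENNReal.mul_ne_top ENNReal.ofReal_ne_top hP.ne_top),
    mul_assoc _ (volume (Metric.ball e ρ) * C)]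
  refine mul_le_mul' le_rfl ?_
  rw [lintegral_lintegral_swap]
  · refine (setLIntegral_mono' measurableSet_ball fun v hv => hP.line_le v
      (by rwa [Metric.mem_ball, dist_eq_norm] at hv) (fun x => ‖gradE φ x‖ₑ ^ 2)
      (hgm.pow_const 2)).trans (le_of_eq ?_)
    rw [setLIntegral_const]; ring
  · refine (Measurable.lintegral_prod_right' (ν := (volume : Measure ℝ).restrict (Ioc 0 1))
      (f := fun p : (Euc d × Euc d) × ℝ => ‖gradE φ (p.1.1 + p.2 • p.1.2)‖ₑ ^ 2) ?_).aemeasurable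
    exact (hgm.comp (by fun_prop)).pow_const 2

theorem lintegral_lintegral_add_swap {α : Type*} [MeasurableSpace α] (μ : Measure α) [SFinite μ]
    {I : α → α → ℝ≥0∞} (hI : Measurable fun q : α × α => I q.1 q.2) :
    ∫⁻ x, (∫⁻ y, (I x y + I y x) ∂μ) ∂μ = 2 * ∫⁻ x, (∫⁻ y, I x y ∂μ) ∂μ := by
  have hI' : Measurable fun q : α × α => I q.2 q.1 := hI.comp measurable_swap
  have hinner : ∀ x, Measurable fun y => I x y := fun x => hI.comp measurable_prodMk_left
  have h1 : ∀ x, ∫⁻ y, (I x y + I y x) ∂μ = (∫⁻ y, I x y ∂μ) + ∫⁻ y, I y x ∂μ :=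
    fun x => lintegral_add_left (hinner x) _
  simp_rw [h1]
  have h2 : Measurable fun x => ∫⁻ y, I x y ∂μ := hI.lintegral_prod_right'
  rw [lintegral_add_left h2, lintegral_lintegral_swap (f := fun x y => I y x) hI'.aemeasurable,
    two_mul]

/-- The Gagliardo seminorm estimate near a boundary point. -/
theorem lintegral_gagliardo_le [IsFiniteMeasure (surf Ω)] (hP : IsTransversalPiece Ω P e ρ C) :
    ∃ C' : ℝ≥0∞, C' ≠ ∞ ∧ ∀ φ : Euc d → ℂ, ContDiff ℝ 1 φ →
    ∫⁻ x in P, (∫⁻ y in P, ENNReal.ofReal (‖x - y‖ ^ (-(d : ℝ))) * ‖φ x - φ y‖ₑ ^ 2 ∂(surf Ω))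
      ∂(surf Ω) ≤ C' * ∫⁻ x in Ω, ‖gradE φ x‖ₑ ^ 2 := by
  have hρ := hP.pos
  have hb0 : volume (Metric.ball e (ρ / 2)) ≠ 0 :=
    (Metric.measure_ball_pos _ _ (by positivity)).ne'
  have hbt' : (volume (Metric.ball e (ρ / 2)))⁻¹ * 2 ≠ ∞ :=
    ENNReal.mul_ne_top (ENNReal.inv_ne_top.2 hb0) (by simp)
  refine ⟨(volume (Metric.ball e (ρ / 2)))⁻¹ * 2 * (2 *
    (ENNReal.ofReal ((‖e‖ + ρ) ^ 2 * (2 * (2 / ρ) ^ (1 / 2 : ℝ))) * C *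
        (volume (Metric.ball e ρ) * C))), ?_, fun φ hφ => ?_⟩
  · have := hP.ne_top
    have h2 : volume (Metric.ball e ρ) ≠ ∞ := measure_ball_lt_top.ne
    refine ENNReal.mul_ne_top hbt' ?_
    exact ENNReal.mul_ne_top (by simp) (ENNReal.mul_ne_top
      (ENNReal.mul_ne_top ENNReal.ofReal_ne_top this) (ENNReal.mul_ne_top h2 this))
  refine (lintegral_mono fun x => lintegral_mono fun y =>
    kernel_mul_enorm_sub_sq_le (e := e) hρ hφ.continuous x y).trans ?_
  simp_rw [lintegral_const_mul' _ _ hbt']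
  rw [lintegral_lintegral_add_swap _ (measurable_kernelIncr hφ.continuous e ρ)]
  exact (mul_le_mul' le_rfl (mul_le_mul' le_rfl (hP.lintegral_kernelIncr_le hφ))).trans
    (le_of_eq (by ring))

end IsTransversalPiece

/-- The square of the `H¹(Ω)` norm of a smooth function. -/
def energy (Ω : Set (Euc d)) (φ : Euc d → ℂ) : ℝ≥0∞ :=
  (∫⁻ x in Ω, ‖φ x‖ₑ ^ 2) + ∫⁻ x in Ω, ‖gradE φ x‖ₑ ^ 2

theorem isCompact_frontier_of_isBounded {Ω : Set (Euc d)} (hΩ : Bornology.IsBounded Ω) :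
    IsCompact (frontier Ω) :=
  Metric.isCompact_of_isClosed_isBounded isClosed_frontier
    (hΩ.closure.subset frontier_subset_closure)

theorem surf_restrict_frontier (Ω : Set (Euc d)) : (surf Ω).restrict (frontier Ω) = surf Ω := by
  rw [surf, Measure.restrict_restrict isClosed_frontier.measurableSet, inter_self]

/-- The `L²` trace estimate for smooth functions. -/
theorem IsBoundedLipschitzDomain.lintegral_surf_le (hd : 2 ≤ d) {Ω : Set (Euc d)}
    (hΩ : IsBoundedLipschitzDomain Ω) :
    ∃ C : ℝ≥0∞, C ≠ ∞ ∧ ∀ φ : Euc d → ℂ, ContDiff ℝ 1 φ →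
      ∫⁻ x, ‖φ x‖ₑ ^ 2 ∂(surf Ω) ≤ C * energy Ω φ := by
  have := hΩ.isFiniteMeasure_surf
  rw [← surf_restrict_frontier]
  refine (isCompact_frontier_of_isBounded hΩ.isBounded).induction_on
    (p := fun s => ∃ C : ℝ≥0∞, C ≠ ∞ ∧ ∀ φ : Euc d → ℂ, ContDiff ℝ 1 φ →
      ∫⁻ x in s, ‖φ x‖ₑ ^ 2 ∂(surf Ω) ≤ C * energy Ω φ) ?_ ?_ ?_ ?_
  · exact ⟨0, by simp, fun φ _ => by simp⟩
  · rintro s t hst ⟨C, hC, h⟩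
    exact ⟨C, hC, fun φ hφ => (lintegral_mono_set hst).trans (h φ hφ)⟩
  · rintro s t ⟨C, hC, h⟩ ⟨C', hC', h'⟩
    refine ⟨C + C', ENNReal.add_ne_top.2 ⟨hC, hC'⟩, fun φ hφ => ?_⟩
    rw [add_mul]
    exact (lintegral_union_le _ _ _).trans (add_le_add (h φ hφ) (h' φ hφ))
  · intro x₀ hx₀
    obtain ⟨r, e, ρ, C, hr, hP⟩ := hΩ.exists_isTransversalPiece hd hx₀
    refine ⟨_, inter_mem self_mem_nhdsWithin
      (mem_nhdsWithin_of_mem_nhds (Metric.ball_mem_nhds _ hr)), _, ?_,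
      fun φ hφ => hP.lintegral_sq_le hφ⟩
    exact ENNReal.mul_ne_top (ENNReal.mul_ne_top (by simp) hP.ne_top) (by finiteness)

/-- The trace estimate for smooth functions in the Gagliardo seminorm. -/
theorem IsBoundedLipschitzDomain.lintegral_gagliardo_le (hd : 2 ≤ d) {Ω : Set (Euc d)}
    (hΩ : IsBoundedLipschitzDomain Ω) :
    ∃ C : ℝ≥0∞, C ≠ ∞ ∧ ∀ φ : Euc d → ℂ, ContDiff ℝ 1 φ →
      ∫⁻ z, ENNReal.ofReal (‖z.1 - z.2‖ ^ (-(d : ℝ))) * ‖φ z.1 - φ z.2‖ₑ ^ 2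
        ∂((surf Ω).prod (surf Ω)) ≤ C * energy Ω φ := by
  have := hΩ.isFiniteMeasure_surf
  have hc := isCompact_frontier_of_isBounded hΩ.isBounded
  obtain ⟨C₀, hC₀, hL2⟩ := hΩ.lintegral_surf_le hd
  have hres : (surf Ω).prod (surf Ω)
      = ((surf Ω).prod (surf Ω)).restrict (frontier Ω ×ˢ frontier Ω) := by
    rw [← Measure.prod_restrict, surf_restrict_frontier]
  have hm : ∀ φ : Euc d → ℂ, ContDiff ℝ 1 φ → Measurable fun z : Euc d × Euc d =>
      ENNReal.ofReal (‖z.1 - z.2‖ ^ (-(d : ℝ))) * ‖φ z.1 - φ z.2‖ₑ ^ 2 := by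
    intro φ hφ
    have := hφ.continuous
    refine Measurable.mul (by fun_prop) (Measurable.pow_const (Measurable.enorm ?_) 2)
    exact Continuous.measurable (by fun_prop)
  rw [hres]
  refine (hc.prod hc).induction_on
    (p := fun s => ∃ C : ℝ≥0∞, C ≠ ∞ ∧ ∀ φ : Euc d → ℂ, ContDiff ℝ 1 φ →
      ∫⁻ z in s, ENNReal.ofReal (‖z.1 - z.2‖ ^ (-(d : ℝ))) * ‖φ z.1 - φ z.2‖ₑ ^ 2
        ∂((surf Ω).prod (surf Ω)) ≤ C * energy Ω φ) ?_ ?_ ?_ ?_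
  · exact ⟨0, by simp, fun φ _ => by simp⟩
  · rintro s t hst ⟨C, hC, h⟩
    exact ⟨C, hC, fun φ hφ => (lintegral_mono_set hst).trans (h φ hφ)⟩
  · rintro s t ⟨C, hC, h⟩ ⟨C', hC', h'⟩
    refine ⟨C + C', ENNReal.add_ne_top.2 ⟨hC, hC'⟩, fun φ hφ => ?_⟩
    rw [add_mul]
    exact (lintegral_union_le _ _ _).trans (add_le_add (h φ hφ) (h' φ hφ))
  · rintro ⟨x₀, y₀⟩ ⟨hx₀, hy₀⟩
    simp only at hx₀ hy₀
    -- On the diagonal the local seminorm estimate applies. Off the diagonal, points of the two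
    -- balls of radius `δ / 4` are at least `δ / 2` apart, so the kernel is bounded and the `L²`
    -- estimate suffices.
    rcases eq_or_ne x₀ y₀ with rfl | hxy
    · obtain ⟨r, e, ρ, C, hr, hP⟩ := hΩ.exists_isTransversalPiece hd hx₀
      obtain ⟨C', hC', h⟩ := hP.lintegral_gagliardo_le
      refine ⟨(frontier Ω ∩ Metric.ball x₀ r) ×ˢ (frontier Ω ∩ Metric.ball x₀ r), ?_, C', hC',
        fun φ hφ => ?_⟩
      · rw [prod_inter_prod.symm]
        exact inter_mem self_mem_nhdsWithin (mem_nhdsWithin_of_mem_nhds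
          (prod_mem_nhds (Metric.ball_mem_nhds _ hr) (Metric.ball_mem_nhds _ hr)))
      · rw [← Measure.prod_restrict, lintegral_prod _ (hm φ hφ).aemeasurable]
        exact (h φ hφ).trans (mul_le_mul' le_rfl le_add_self)
    · set δ := dist x₀ y₀ with hδ
      have hδ0 : 0 < δ := dist_pos.2 hxy
      refine ⟨Metric.ball x₀ (δ / 4) ×ˢ Metric.ball y₀ (δ / 4), mem_nhdsWithin_of_mem_nhds
        (prod_mem_nhds (Metric.ball_mem_nhds _ (by positivity))
          (Metric.ball_mem_nhds _ (by positivity))),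
        ENNReal.ofReal ((δ / 2) ^ (-(d : ℝ))) * (4 * surf Ω univ * C₀), ?_, fun φ hφ => ?_⟩
      · have : surf Ω univ ≠ ∞ := measure_ne_top _ _
        finiteness
      have hφm : Measurable fun x => ‖φ x‖ₑ ^ 2 := hφ.continuous.measurable.enorm.pow_const 2
      have h1 : ∀ z ∈ Metric.ball x₀ (δ / 4) ×ˢ Metric.ball y₀ (δ / 4),
          ENNReal.ofReal (‖z.1 - z.2‖ ^ (-(d : ℝ))) * ‖φ z.1 - φ z.2‖ₑ ^ 2
          ≤ ENNReal.ofReal ((δ / 2) ^ (-(d : ℝ))) * (2 * ‖φ z.1‖ₑ ^ 2 + 2 * ‖φ z.2‖ₑ ^ 2) := by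
        rintro ⟨x, y⟩ ⟨hx, hy⟩
        simp only [Metric.mem_ball] at hx hy ⊢
        refine mul_le_mul' (ENNReal.ofReal_le_ofReal ?_) ?_
        · refine Real.rpow_le_rpow_of_nonpos (by positivity) ?_ (by simp)
          rw [← dist_eq_norm]
          have := dist_triangle4 x₀ x y y₀
          rw [dist_comm x₀ x] at this
          linarith
        · exact (pow_le_pow_left' (enorm_sub_le) 2).trans (ennreal_add_sq_le _ _)
      refine (setLIntegral_mono' (measurableSet_ball.prod measurableSet_ball) h1).trans ?_
      rw [lintegral_const_mul' _ _ ENNReal.ofReal_ne_top, mul_assoc]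
      refine mul_le_mul' le_rfl ((setLIntegral_le_lintegral _ _).trans ?_)
      have hm1 : Measurable fun z : Euc d × Euc d => ‖φ z.1‖ₑ ^ 2 := hφm.comp measurable_fst
      have hm2 : Measurable fun z : Euc d × Euc d => ‖φ z.2‖ₑ ^ 2 := hφm.comp measurable_snd
      have e1 : ∫⁻ z : Euc d × Euc d, ‖φ z.1‖ₑ ^ 2 ∂((surf Ω).prod (surf Ω))
          = surf Ω univ * ∫⁻ x, ‖φ x‖ₑ ^ 2 ∂(surf Ω) := by
        rw [lintegral_prod _ hm1.aemeasurable]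
        simp only [lintegral_const]
        rw [lintegral_mul_const _ hφm, mul_comm]
      have e2 : ∫⁻ z : Euc d × Euc d, ‖φ z.2‖ₑ ^ 2 ∂((surf Ω).prod (surf Ω))
          = surf Ω univ * ∫⁻ x, ‖φ x‖ₑ ^ 2 ∂(surf Ω) := by
        rw [lintegral_prod _ hm2.aemeasurable]
        simp only [lintegral_const]
        rw [mul_comm]
      rw [lintegral_add_left (hm1.const_mul 2),
        lintegral_const_mul' _ _ (by simp), lintegral_const_mul' _ _ (by simp), e1, e2]
      calc _ = 4 * surf Ω univ * ∫⁻ x, ‖φ x‖ₑ ^ 2 ∂(surf Ω) := by ring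
        _ ≤ 4 * surf Ω univ * (C₀ * energy Ω φ) := mul_le_mul' le_rfl (hL2 φ hφ)
        _ = _ := by ring

/-! ### The Poincaré inequality for smooth functions -/

/-- On `A`, smooth functions differ from a constant by at most a multiple of the norm of their
gradient on `Ω`. -/
def HasPoincare (Ω A : Set (Euc d)) : Prop :=
  ∃ C : ℝ≥0∞, C ≠ ∞ ∧ ∀ φ : Euc d → ℂ, ContDiff ℝ 1 φ → ∃ c : ℂ,
    ∫⁻ x in A, ‖φ x - c‖ₑ ^ 2 ≤ C * ∫⁻ x in Ω, ‖gradE φ x‖ₑ ^ 2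

theorem HasPoincare.mono {Ω A B : Set (Euc d)} (h : HasPoincare Ω B) (hAB : A ⊆ B) :
    HasPoincare Ω A := by
  obtain ⟨C, hC, h⟩ := h
  refine ⟨C, hC, fun φ hφ => ?_⟩
  obtain ⟨c, hc⟩ := h φ hφ
  exact ⟨c, (lintegral_mono_set hAB).trans hc⟩

/-- With `x = y + h`, the double integral of `‖φ x - φ y‖ₑ ^ 2` becomes an integral over `h` of
translation differences. Convexity keeps the segments in the ball, and only `h` with `‖h‖ < 2 * r`
contribute. -/
theorem hasPoincare_ball {Ω : Set (Euc d)} (hΩ : MeasurableSet Ω) {x₀ : Euc d} {r : ℝ} (hr : 0 < r)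
    (hsub : Metric.ball x₀ r ⊆ Ω) : HasPoincare Ω (Metric.ball x₀ r) := by
  set B := Metric.ball x₀ r with hB
  have hBm : MeasurableSet B := measurableSet_ball
  set b := volume B with hb
  have hb0 : b ≠ 0 := (Metric.measure_ball_pos _ _ hr).ne'
  have hbt : b ≠ ∞ := measure_ball_lt_top.ne
  set K := ENNReal.ofReal (2 * r) ^ 2 * volume (Metric.ball (0 : Euc d) (2 * r)) with hK
  have hKt : K ≠ ∞ := by
    have : volume (Metric.ball (0 : Euc d) (2 * r)) ≠ ∞ := measure_ball_lt_top.ne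
    finiteness
  refine ⟨b⁻¹ * K, ENNReal.mul_ne_top (ENNReal.inv_ne_top.2 hb0) hKt, fun φ hφ => ?_⟩
  set D := ∫⁻ x in Ω, ‖gradE φ x‖ₑ ^ 2 with hD
  have hφm : Measurable fun q : Euc d × Euc d => ‖φ q.1 - φ q.2‖ₑ ^ 2 := by
    have := hφ.continuous
    exact (Continuous.measurable (by fun_prop)).enorm.pow_const 2
  have hBset : MeasurableSet {q : Euc d × Euc d | q.1 ∈ B ∧ q.1 + q.2 ∈ B} :=
    (measurable_fst hBm).inter ((measurable_fst.add measurable_snd) hBm)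
  have hdouble : ∫⁻ y in B, ∫⁻ x in B, ‖φ x - φ y‖ₑ ^ 2 ≤ K * D := by
    have e1 : ∀ y ∈ B, ∫⁻ x in B, ‖φ x - φ y‖ₑ ^ 2
        = ∫⁻ h, {h | y + h ∈ B}.indicator (fun h => ‖φ (y + h) - φ y‖ₑ ^ 2) h := by
      intro y _
      rw [← lintegral_indicator hBm, ← lintegral_add_left_eq_self _ y]
      rfl
    have e2 : ∫⁻ y in B, ∫⁻ x in B, ‖φ x - φ y‖ₑ ^ 2
        = ∫⁻ y, ∫⁻ h, {q : Euc d × Euc d | q.1 ∈ B ∧ q.1 + q.2 ∈ B}.indicator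
          (fun q => ‖φ (q.1 + q.2) - φ q.1‖ₑ ^ 2) (y, h) := by
      rw [setLIntegral_congr_fun hBm e1, ← lintegral_indicator hBm]
      refine lintegral_congr fun y => ?_
      by_cases hy : y ∈ B
      · rw [indicator_of_mem hy]
        refine lintegral_congr fun h => ?_
        by_cases hyh : y + h ∈ B <;> simp [indicator, hy, hyh]
      · rw [indicator_of_notMem hy]
        simp [indicator, hy]
    have hm : Measurable ({q : Euc d × Euc d | q.1 ∈ B ∧ q.1 + q.2 ∈ B}.indicator
        fun q => ‖φ (q.1 + q.2) - φ q.1‖ₑ ^ 2) := by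
      refine Measurable.indicator ?_ hBset
      have := hφ.continuous
      exact (Continuous.measurable (by fun_prop)).enorm.pow_const 2
    rw [e2, lintegral_lintegral_swap (f := fun y h => {q : Euc d × Euc d | q.1 ∈ B ∧ q.1 + q.2 ∈ B}.indicator
          (fun q => ‖φ (q.1 + q.2) - φ q.1‖ₑ ^ 2) (y, h)) hm.aemeasurable]
    have e3 : ∀ h, ∫⁻ y, {q : Euc d × Euc d | q.1 ∈ B ∧ q.1 + q.2 ∈ B}.indicator
          (fun q => ‖φ (q.1 + q.2) - φ q.1‖ₑ ^ 2) (y, h)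
        ≤ (Metric.ball (0 : Euc d) (2 * r)).indicator
          (fun _ => ENNReal.ofReal (2 * r) ^ 2 * D) h := by
      intro h
      have hAm : MeasurableSet {y | y ∈ B ∧ y + h ∈ B} :=
        hBm.inter ((measurable_id.add_const h) hBm)
      have e4 : ∫⁻ y, {q : Euc d × Euc d | q.1 ∈ B ∧ q.1 + q.2 ∈ B}.indicator
          (fun q => ‖φ (q.1 + q.2) - φ q.1‖ₑ ^ 2) (y, h)
          = ∫⁻ y in {y | y ∈ B ∧ y + h ∈ B}, ‖φ (y + h) - φ y‖ₑ ^ 2 := by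
        rw [← lintegral_indicator hAm]; rfl
      rw [e4]
      by_cases hh : h ∈ Metric.ball (0 : Euc d) (2 * r)
      · rw [indicator_of_mem hh]
        refine (lintegral_translate_sub_le hφ hAm hΩ h ?_).trans ?_
        · rintro y ⟨hy, hyh⟩ t ht
          exact hsub ((convex_ball x₀ r).add_smul_mem hy hyh ⟨ht.1.le, ht.2⟩)
        · refine mul_le_mul' (pow_le_pow_left' ?_ 2) le_rfl
          rw [mem_ball_zero_iff] at hh
          rw [← ofReal_norm]
          exact ENNReal.ofReal_le_ofReal hh.le
      · rw [indicator_of_notMem hh]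
        have : {y | y ∈ B ∧ y + h ∈ B} = ∅ := by
          refine eq_empty_of_forall_notMem fun y hy => hh ?_
          have h1 := hy.1
          have h2 := hy.2
          rw [hB, Metric.mem_ball] at h1 h2
          rw [mem_ball_zero_iff]
          have h3 := dist_triangle_right (y + h) y x₀
          rw [dist_eq_norm (y + h) y, add_sub_cancel_left] at h3
          linarith
        rw [this]; simp
    refine (lintegral_mono e3).trans (le_of_eq ?_)
    rw [lintegral_indicator measurableSet_ball, setLIntegral_const]
    ring
  have hmy : Measurable fun y => ∫⁻ x in B, ‖φ x - φ y‖ₑ ^ 2 :=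
    Measurable.lintegral_prod_left' (μ := volume.restrict B) (f := fun q : Euc d × Euc d => ‖φ q.1 - φ q.2‖ₑ ^ 2) hφm
  -- Some `y` does no worse than the average; its value `φ y` serves as the constant, and no mean
  -- value of `φ` is needed.
  obtain ⟨y, -, hy⟩ := exists_le_setLAverage hb0 hbt hmy.aemeasurable
  refine ⟨φ y, hy.trans ?_⟩
  rw [setLAverage_eq, ENNReal.div_eq_inv_mul, mul_assoc]
  exact mul_le_mul' le_rfl hdouble

/-- The two constants are compared on the overlap, which is open and nonempty and hence of positive
measure; the constant of `A` then also serves on `B`. -/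
theorem HasPoincare.union {Ω A B : Set (Euc d)} (hA : HasPoincare Ω A) (hB : HasPoincare Ω B)
    (hAo : IsOpen A) (hBo : IsOpen B) (hne : (A ∩ B).Nonempty) (hBv : volume B ≠ ∞) :
    HasPoincare Ω (A ∪ B) := by
  obtain ⟨C, hC, hA⟩ := hA
  obtain ⟨C', hC', hB⟩ := hB
  set m := volume (A ∩ B) with hm
  have hm0 : m ≠ 0 := ((hAo.inter hBo).measure_pos volume hne).ne'
  have hmt : m ≠ ∞ := ne_top_of_le_ne_top hBv (measure_mono inter_subset_right)
  have hmi : m⁻¹ ≠ ∞ := ENNReal.inv_ne_top.2 hm0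
  refine ⟨C + (2 * C' + 2 * (m⁻¹ * (2 * C + 2 * C')) * volume B), by finiteness,
    fun φ hφ => ?_⟩
  obtain ⟨a, ha⟩ := hA φ hφ
  obtain ⟨b, hb⟩ := hB φ hφ
  set D := ∫⁻ x in Ω, ‖gradE φ x‖ₑ ^ 2 with hD
  have hφm : ∀ c : ℂ, Measurable fun x => ‖φ x - c‖ₑ ^ 2 := fun c =>
    (hφ.continuous.measurable.sub_const c).enorm.pow_const 2
  have h1 : ‖a - b‖ₑ ^ 2 ≤ m⁻¹ * ((2 * C + 2 * C') * D) := by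
    have h2 : m * ‖a - b‖ₑ ^ 2 ≤ (2 * C + 2 * C') * D := by
      calc m * ‖a - b‖ₑ ^ 2 = ∫⁻ _ in A ∩ B, ‖a - b‖ₑ ^ 2 := by rw [setLIntegral_const, mul_comm]
        _ ≤ ∫⁻ x in A ∩ B, (2 * ‖φ x - a‖ₑ ^ 2 + 2 * ‖φ x - b‖ₑ ^ 2) := by
          refine lintegral_mono fun x => ?_
          refine le_trans (pow_le_pow_left' ?_ 2) (ennreal_add_sq_le _ _)
          rw [enorm_sub_rev (φ x) a]
          refine le_trans (le_of_eq ?_) (enorm_add_le _ _)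
          congr 1; ring
        _ = 2 * (∫⁻ x in A ∩ B, ‖φ x - a‖ₑ ^ 2) + 2 * ∫⁻ x in A ∩ B, ‖φ x - b‖ₑ ^ 2 := by
          rw [lintegral_add_left ((hφm a).const_mul 2), lintegral_const_mul' _ _ (by simp),
            lintegral_const_mul' _ _ (by simp)]
        _ ≤ 2 * (C * D) + 2 * (C' * D) := by
          refine add_le_add (mul_le_mul' le_rfl ?_) (mul_le_mul' le_rfl ?_)
          · exact (lintegral_mono_set inter_subset_left).trans ha
          · exact (lintegral_mono_set inter_subset_right).trans hb
        _ = _ := by ring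
    calc ‖a - b‖ₑ ^ 2 = m⁻¹ * (m * ‖a - b‖ₑ ^ 2) := by
          rw [← mul_assoc, ENNReal.inv_mul_cancel hm0 hmt, one_mul]
      _ ≤ _ := mul_le_mul' le_rfl h2
  refine ⟨a, (lintegral_union_le _ _ _).trans ?_⟩
  rw [add_mul]
  refine add_le_add ha ?_
  calc ∫⁻ x in B, ‖φ x - a‖ₑ ^ 2 ≤ ∫⁻ x in B, (2 * ‖φ x - b‖ₑ ^ 2 + 2 * ‖a - b‖ₑ ^ 2) := by
        refine lintegral_mono fun x => ?_
        refine le_trans (pow_le_pow_left' ?_ 2) (ennreal_add_sq_le _ _)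
        rw [enorm_sub_rev a b]
        refine le_trans (le_of_eq ?_) (enorm_add_le _ _)
        congr 1; ring
    _ = 2 * (∫⁻ x in B, ‖φ x - b‖ₑ ^ 2) + 2 * ‖a - b‖ₑ ^ 2 * volume B := by
        rw [lintegral_add_left ((hφm b).const_mul 2), lintegral_const_mul' _ _ (by simp),
          setLIntegral_const]
    _ ≤ 2 * (C' * D) + 2 * (m⁻¹ * ((2 * C + 2 * C') * D)) * volume B := by gcongr
    _ = _ := by ring

/-- The constant of `B` is used on `A`: the error of the translation is controlled by the gradient
along segments inside of `Ω`. -/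
theorem HasPoincare.of_translate {Ω A B : Set (Euc d)} (hB : HasPoincare Ω B)
    (hA : MeasurableSet A) (hBm : MeasurableSet B) (hΩ : MeasurableSet Ω) (h : Euc d)
    (hAB : ∀ x ∈ A, x + h ∈ B)
    (hseg : ∀ x ∈ A, ∀ t ∈ Ioc (0 : ℝ) 1, x + t • h ∈ Ω) : HasPoincare Ω A := by
  obtain ⟨C, hC, hB⟩ := hB
  refine ⟨2 * ‖h‖ₑ ^ 2 + 2 * C, by finiteness, fun φ hφ => ?_⟩
  obtain ⟨c, hc⟩ := hB φ hφ
  refine ⟨c, ?_⟩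
  have := hφ.continuous
  have hm : Measurable fun x => ‖φ (x + h) - φ x‖ₑ ^ 2 :=
    (Continuous.measurable (by fun_prop)).enorm.pow_const 2
  have h2 : ∫⁻ x in A, ‖φ (x + h) - c‖ₑ ^ 2 ≤ ∫⁻ x in B, ‖φ x - c‖ₑ ^ 2 := by
    rw [← lintegral_indicator hA, ← lintegral_indicator hBm,
      ← lintegral_add_right_eq_self (B.indicator _) h]
    refine lintegral_mono fun x => ?_
    by_cases hx : x ∈ A
    · rw [indicator_of_mem hx, indicator_of_mem (hAB x hx)]
    · rw [indicator_of_notMem hx]; exact zero_le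
  calc ∫⁻ x in A, ‖φ x - c‖ₑ ^ 2
      ≤ ∫⁻ x in A, (2 * ‖φ (x + h) - φ x‖ₑ ^ 2 + 2 * ‖φ (x + h) - c‖ₑ ^ 2) := by
        refine lintegral_mono fun x => ?_
        refine le_trans (pow_le_pow_left' ?_ 2) (ennreal_add_sq_le _ _)
        rw [enorm_sub_rev (φ (x + h)) (φ x)]
        refine le_trans (le_of_eq ?_) (enorm_add_le _ _)
        congr 1; ring
    _ = 2 * (∫⁻ x in A, ‖φ (x + h) - φ x‖ₑ ^ 2) + 2 * ∫⁻ x in A, ‖φ (x + h) - c‖ₑ ^ 2 := by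
        rw [lintegral_add_left (hm.const_mul 2), lintegral_const_mul' _ _ (by simp),
          lintegral_const_mul' _ _ (by simp)]
    _ ≤ 2 * (‖h‖ₑ ^ 2 * ∫⁻ x in Ω, ‖gradE φ x‖ₑ ^ 2)
          + 2 * (C * ∫⁻ x in Ω, ‖gradE φ x‖ₑ ^ 2) :=
        add_le_add (mul_le_mul' le_rfl (lintegral_translate_sub_le hφ hA hΩ h hseg))
          (mul_le_mul' le_rfl (h2.trans hc))
    _ = _ := by ring

/-- Translation by the axis `e` of the cone moves the piece into the ball around `x₀ + e`. That ball
lies in `Ω`, because its points are `x₀ + v` with `v` in the cone. -/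
theorem IsBoundedLipschitzDomain.hasPoincare_inter_ball {Ω : Set (Euc d)}
    (hΩ : IsBoundedLipschitzDomain Ω) {x₀ : Euc d} (hx₀ : x₀ ∈ closure Ω) :
    ∃ r > 0, HasPoincare Ω (Ω ∩ Metric.ball x₀ r) := by
  obtain ⟨e, ρ, r, hρ, hr, hcone⟩ := hΩ.exists_cone hx₀
  have hΩm := hΩ.isOpen.measurableSet
  have hball : Metric.ball (x₀ + e) ρ ⊆ Ω := by
    intro y hy
    have := hcone x₀ hx₀ (by simpa using hr) (y - x₀) (by
      rw [Metric.mem_ball, dist_eq_norm] at hy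
      rwa [sub_sub]) 1 (by simp)
    simpa using this
  refine ⟨min r ρ, lt_min hr hρ, (hasPoincare_ball hΩm hρ hball).of_translate
    (hΩm.inter measurableSet_ball) measurableSet_ball hΩm e ?_ ?_⟩
  · rintro x ⟨-, hx⟩
    rw [Metric.mem_ball, dist_add_right]
    exact (Metric.mem_ball.1 hx).trans_le (min_le_right _ _)
  · rintro x ⟨hx, hxr⟩ t ht
    exact hcone x (subset_closure hx) ((Metric.mem_ball.1 hxr).trans_le (min_le_left _ _)) e
      (by simpa using hρ) t ht

/-- The Poincaré inequality for smooth functions on a Lipschitz domain. -/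
theorem IsBoundedLipschitzDomain.hasPoincare {Ω : Set (Euc d)}
    (hΩ : IsBoundedLipschitzDomain Ω) : HasPoincare Ω Ω := by
  have hvol : ∀ A ⊆ Ω, volume A ≠ ∞ := fun A hA => (hΩ.isBounded.subset hA).measure_lt_top.ne
  obtain ⟨z₀, hz₀⟩ := hΩ.isConnected.nonempty
  have hchain : ∀ x ∈ Ω, ∃ A ⊆ Ω, IsOpen A ∧ z₀ ∈ A ∧ HasPoincare Ω A ∧ x ∈ A := by
    -- The points reachable from `z₀` form an open set. It is relatively closed in `Ω`, as a local
    -- piece around a limit point can be attached to a set it meets; connectedness gives all of `Ω`.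
    set u := ⋃₀ {A : Set (Euc d) | A ⊆ Ω ∧ IsOpen A ∧ z₀ ∈ A ∧ HasPoincare Ω A} with hu
    have huo : IsOpen u := isOpen_sUnion fun A hA => hA.2.1
    have hsub : Ω ⊆ u := by
      refine hΩ.isConnected.isPreconnected.subset_of_closure_inter_subset huo ?_ ?_
      · obtain ⟨r, hr, hP⟩ := hΩ.hasPoincare_inter_ball (subset_closure hz₀)
        have hz : z₀ ∈ Ω ∩ Metric.ball z₀ r := ⟨hz₀, Metric.mem_ball_self hr⟩
        exact ⟨z₀, hz₀, mem_sUnion.2 ⟨_, ⟨inter_subset_left, hΩ.isOpen.inter Metric.isOpen_ball,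
          hz, hP⟩, hz⟩⟩
      · rintro x ⟨hxu, hx⟩
        obtain ⟨r, hr, hP⟩ := hΩ.hasPoincare_inter_ball (subset_closure hx)
        have hO : IsOpen (Ω ∩ Metric.ball x r) := hΩ.isOpen.inter Metric.isOpen_ball
        have hxO : x ∈ Ω ∩ Metric.ball x r := ⟨hx, Metric.mem_ball_self hr⟩
        obtain ⟨y, hyO, A, ⟨hA, hAo, hzA, hPA⟩, hyA⟩ := mem_closure_iff.1 hxu _ hO hxO
        exact mem_sUnion.2 ⟨A ∪ (Ω ∩ Metric.ball x r), ⟨union_subset hA inter_subset_left,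
          hAo.union hO, Or.inl hzA, hPA.union hP hAo hO ⟨y, hyA, hyO⟩ (hvol _ inter_subset_left)⟩,
          Or.inr hxO⟩
    intro x hx
    obtain ⟨A, ⟨h1, h2, h3, h4⟩, hxA⟩ := hsub hx
    exact ⟨A, h1, h2, h3, h4, hxA⟩
  have hc : IsCompact (closure Ω) := hΩ.isBounded.isCompact_closure
  -- Compactness of the closure makes finitely many pieces enough. Keeping `z₀` in each set
  -- guarantees that any two of them overlap and can be merged.
  obtain ⟨A, hA, -, -, hPA, hsub⟩ := hc.induction_on
    (p := fun s => ∃ A ⊆ Ω, IsOpen A ∧ z₀ ∈ A ∧ HasPoincare Ω A ∧ s ∩ Ω ⊆ A)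
    (by
      obtain ⟨A, h1, h2, h3, h4, h5⟩ := hchain z₀ hz₀
      exact ⟨A, h1, h2, h3, h4, by simp⟩)
    (by
      rintro s t hst ⟨A, h1, h2, h3, h4, h5⟩
      exact ⟨A, h1, h2, h3, h4, (inter_subset_inter_left _ hst).trans h5⟩)
    (by
      rintro s t ⟨A, h1, h2, h3, h4, h5⟩ ⟨A', h1', h2', h3', h4', h5'⟩
      refine ⟨A ∪ A', union_subset h1 h1', h2.union h2', Or.inl h3,
        h4.union h4' h2 h2' ⟨z₀, h3, h3'⟩ (hvol _ h1'), ?_⟩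
      rw [union_inter_distrib_right]
      exact union_subset_union h5 h5')
    (by
      intro x hx
      obtain ⟨r, hr, hP⟩ := hΩ.hasPoincare_inter_ball hx
      have hO : IsOpen (Ω ∩ Metric.ball x r) := hΩ.isOpen.inter Metric.isOpen_ball
      obtain ⟨y, hyr, hy⟩ := mem_closure_iff.1 hx _ Metric.isOpen_ball (Metric.mem_ball_self hr)
      obtain ⟨A, h1, h2, h3, h4, h5⟩ := hchain y hy
      refine ⟨Metric.ball x r, mem_nhdsWithin_of_mem_nhds (Metric.ball_mem_nhds _ hr),
        A ∪ (Ω ∩ Metric.ball x r), union_subset h1 inter_subset_left, h2.union hO, Or.inl h3,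
        h4.union hP h2 hO ⟨y, h5, hy, hyr⟩ (hvol _ inter_subset_left), ?_⟩
      rw [inter_comm]
      exact subset_union_right)
  exact hPA.mono fun x hx => hsub ⟨subset_closure hx, hx⟩

/-! ### The Sobolev space `H¹(Ω)` -/

theorem enorm_sq_eq_lintegral {X E : Type*} [MeasurableSpace X] {μ : Measure X}
    [NormedAddCommGroup E] (f : Lp E 2 μ) : ‖f‖ₑ ^ 2 = ∫⁻ x, ‖f x‖ₑ ^ 2 ∂μ := by
  rw [Lp.enorm_def]
  have h := eLpNorm_nnreal_pow_eq_lintegral (f := f) (μ := μ) (p := 2) (by norm_num)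
  have h2 : ((2 : NNReal) : ℝ) = ((2 : ℕ) : ℝ) := by norm_num
  rw [h2] at h
  simp only [ENNReal.rpow_natCast] at h
  exact h

theorem continuous_integral_inner {X E : Type*} [MeasurableSpace X] {μ : Measure X}
    [NormedAddCommGroup E] [InnerProductSpace ℂ E] {w : X → E} (hw : MemLp w 2 μ) :
    Continuous fun u : Lp E 2 μ => ∫ x, inner ℂ (w x) (u x) ∂μ := by
  have h : (fun u : Lp E 2 μ => ∫ x, inner ℂ (w x) (u x) ∂μ)
      = fun u => inner ℂ (hw.toLp w) u := by
    ext u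
    rw [L2.inner_def]
    refine integral_congr_ae ?_
    filter_upwards [hw.coeFn_toLp] with x hx
    rw [hx]
  rw [h]
  fun_prop

theorem continuous_integral_smul {μ : Measure (Euc d)} [IsFiniteMeasureOnCompacts μ]
    {ψ : Euc d → ℝ} (hψ : Continuous ψ) (hc : HasCompactSupport ψ) :
    Continuous fun u : Lp ℂ 2 μ => ∫ x, ψ x • u x ∂μ := by
  have hw : MemLp (fun x => (ψ x : ℂ)) 2 μ :=
    (hψ.memLp_of_hasCompactSupport hc).ofReal
  have h := continuous_integral_inner hw
  refine h.congr fun u => ?_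
  refine integral_congr_ae (Eventually.of_forall fun x => ?_)
  simp [mul_comm]

theorem continuous_integral_smul_coord {μ : Measure (Euc d)} [IsFiniteMeasureOnCompacts μ]
    {ψ : Euc d → ℝ} (hψ : Continuous ψ) (hc : HasCompactSupport ψ) (i : Fin d) :
    Continuous fun G : Lp (EuclideanSpace ℂ (Fin d)) 2 μ => ∫ x, ψ x • (G x i) ∂μ := by
  have hw : MemLp (fun x => ψ x • (EuclideanSpace.single i 1 : EuclideanSpace ℂ (Fin d))) 2 μ :=
    Continuous.memLp_of_hasCompactSupport (by fun_prop) hc.smul_right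
  have h := continuous_integral_inner hw
  refine h.congr fun u => ?_
  refine integral_congr_ae (Eventually.of_forall fun x => ?_)
  simp only
  rw [← Complex.coe_smul, inner_smul_left, EuclideanSpace.inner_single_left]
  simp

/-- For a fixed test function both sides of the defining identity depend continuously on the pair,
so the condition is an intersection of closed ones. Completeness of `H1 Ω` follows. -/
theorem isClosed_h1Submodule (Ω : Set (Euc d)) :
    IsClosed (h1Submodule Ω : Set (WithLp 2 (Lp ℂ 2 (volume.restrict Ω) ×
      Lp (EuclideanSpace ℂ (Fin d)) 2 (volume.restrict Ω)))) := by
  have h : (h1Submodule Ω : Set (WithLp 2 (Lp ℂ 2 (volume.restrict Ω) ×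
      Lp (EuclideanSpace ℂ (Fin d)) 2 (volume.restrict Ω)))) =
      {p | ∀ φ : Euc d → ℝ, ContDiff ℝ (⊤ : ℕ∞) φ → HasCompactSupport φ → tsupport φ ⊆ Ω →
        ∀ i : Fin d, ∫ x in Ω, (fderiv ℝ φ x (EuclideanSpace.single i 1)) • p.fst x
          = - ∫ x in Ω, φ x • (p.snd x i)} := rfl
  rw [h]
  simp only [ofPred_forall]
  refine isClosed_iInter fun φ => isClosed_iInter fun hφ => isClosed_iInter fun hc =>
    isClosed_iInter fun _ => isClosed_iInter fun i => ?_
  have hc2 := WithLp.prod_continuous_ofLp 2 (Lp ℂ 2 (volume.restrict Ω))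
    (Lp (EuclideanSpace ℂ (Fin d)) 2 (volume.restrict Ω))
  have hD : Continuous fun x => fderiv ℝ φ x (EuclideanSpace.single i 1) :=
    ((hφ.of_le (by exact_mod_cast le_top) : ContDiff ℝ 1 φ).continuous_fderiv
      (by norm_num)).clm_apply continuous_const
  refine isClosed_eq ?_ (Continuous.neg ?_)
  · exact (continuous_integral_smul hD (hc.fderiv_apply ℝ _)).comp hc2.fst
  · exact (continuous_integral_smul_coord hφ.continuous hc i).comp hc2.snd

instance (Ω : Set (Euc d)) : CompleteSpace (H1 Ω) :=
  (isClosed_h1Submodule Ω).completeSpace_coe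

/-- The weak gradient, as a linear map. -/
def h1GradL (Ω : Set (Euc d)) :
    H1 Ω →L[ℂ] Lp (EuclideanSpace ℂ (Fin d)) 2 (volume.restrict Ω) where
  toFun := h1Grad
  map_add' _ _ := rfl
  map_smul' _ _ := rfl
  cont := (WithLp.prod_continuous_ofLp 2 _ _).snd.comp continuous_subtype_val

theorem h1_norm_sq {Ω : Set (Euc d)} (u : H1 Ω) : ‖u‖ ^ 2 = ‖h1Fun u‖ ^ 2 + ‖h1Grad u‖ ^ 2 :=
  WithLp.prod_norm_sq_eq_of_L2 (Subtype.val (p := fun p => p ∈ h1Submodule Ω) u)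

theorem h1_enorm_sq {Ω : Set (Euc d)} (u : H1 Ω) :
    ‖u‖ₑ ^ 2 = ‖h1Fun u‖ₑ ^ 2 + ‖h1Grad u‖ₑ ^ 2 := by
  simp only [← ofReal_norm]
  rw [← ENNReal.ofReal_pow (norm_nonneg _), ← ENNReal.ofReal_pow (norm_nonneg _),
    ← ENNReal.ofReal_pow (norm_nonneg _), ← ENNReal.ofReal_add (by positivity) (by positivity),
    h1_norm_sq]

theorem isWeakGradient_h1 {Ω : Set (Euc d)} (u : H1 Ω) :
    IsWeakGradient Ω (h1Fun u) (h1Grad u) :=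
  Subtype.prop (p := fun p => p ∈ h1Submodule Ω) u

theorem IsWeakGradient.congr {Ω : Set (Euc d)} {u u' : Euc d → ℂ}
    {G G' : Euc d → EuclideanSpace ℂ (Fin d)} (h : IsWeakGradient Ω u G)
    (hu : u' =ᵐ[volume.restrict Ω] u) (hG : G' =ᵐ[volume.restrict Ω] G) :
    IsWeakGradient Ω u' G' := by
  intro φ hφ hc hs i
  have e1 : ∫ x in Ω, (fderiv ℝ φ x (EuclideanSpace.single i 1)) • u' x
      = ∫ x in Ω, (fderiv ℝ φ x (EuclideanSpace.single i 1)) • u x := by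
    refine integral_congr_ae ?_
    filter_upwards [hu] with x hx
    rw [hx]
  have e2 : ∫ x in Ω, φ x • G' x i = ∫ x in Ω, φ x • G x i := by
    refine integral_congr_ae ?_
    filter_upwards [hG] with x hx
    rw [hx]
  rw [e1, e2]
  exact h φ hφ hc hs i

/-- Weak gradients are unique. -/
theorem IsWeakGradient.ae_eq {Ω : Set (Euc d)} (hΩ : IsOpen Ω) {u : Euc d → ℂ}
    {G G' : Euc d → EuclideanSpace ℂ (Fin d)} (h : IsWeakGradient Ω u G)
    (h' : IsWeakGradient Ω u G') (hG : MemLp G 2 (volume.restrict Ω))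
    (hG' : MemLp G' 2 (volume.restrict Ω)) : G =ᵐ[volume.restrict Ω] G' := by
  have hi : ∀ i : Fin d, ∀ᵐ x ∂(volume.restrict Ω), G x i = G' x i := by
    intro i
    have hL : MemLp (fun x => G x i - G' x i) 2 (volume.restrict Ω) :=
      (memLp_coord hG i).sub (memLp_coord hG' i)
    have h1 := hΩ.ae_eq_zero_of_integral_contDiff_smul_eq_zero (μ := volume)
      (f := fun x => G x i - G' x i)
      (locallyIntegrableOn_of_locallyIntegrable_restrict (hL.locallyIntegrable (by norm_num))) ?_
    · rw [ae_restrict_iff' hΩ.measurableSet]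
      filter_upwards [h1] with x hx hxΩ
      exact sub_eq_zero.1 (hx hxΩ)
    · intro g hg hc hs
      have e1 : ∫ x, g x • (G x i - G' x i) = ∫ x in Ω, g x • (G x i - G' x i) := by
        refine (setIntegral_eq_integral_of_forall_compl_eq_zero fun x hx => ?_).symm
        rw [image_eq_zero_of_notMem_tsupport fun hx' => hx (hs hx'), zero_smul]
      rw [e1]
      simp_rw [smul_sub]
      rw [integral_sub (integrable_test_smul hg.continuous hc (memLp_coord hG i))
        (integrable_test_smul hg.continuous hc (memLp_coord hG' i))]
      have h2 := h g hg hc hs i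
      rw [h' g hg hc hs i] at h2
      rw [neg_injective h2, sub_self]
  have := ae_all_iff.2 hi
  filter_upwards [this] with x hx
  exact PiLp.ext hx

/-- Weak gradients are unique, so the gradient component carries no further information. -/
theorem h1_ext {Ω : Set (Euc d)} (hΩ : IsOpen Ω) {u v : H1 Ω} (h : h1Fun u = h1Fun v) : u = v := by
  have h2 : h1Grad u = h1Grad v := by
    refine Lp.ext ?_
    refine (isWeakGradient_h1 u).ae_eq hΩ ?_ (Lp.memLp _) (Lp.memLp _)
    rw [h]
    exact isWeakGradient_h1 v
  exact Subtype.ext (WithLp.ofLp_injective 2 (Prod.ext h h2))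

/-- The element of `H¹(Ω)` given by a function and its weak gradient. -/
def mkH1 {Ω : Set (Euc d)} {u : Euc d → ℂ} {G : Euc d → EuclideanSpace ℂ (Fin d)}
    (hu : MemLp u 2 (volume.restrict Ω)) (hG : MemLp G 2 (volume.restrict Ω))
    (h : IsWeakGradient Ω u G) : H1 Ω :=
  ⟨WithLp.toLp 2 (hu.toLp u, hG.toLp G), h.congr hu.coeFn_toLp hG.coeFn_toLp⟩

theorem h1Fun_mkH1 {Ω : Set (Euc d)} {u : Euc d → ℂ} {G : Euc d → EuclideanSpace ℂ (Fin d)}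
    (hu : MemLp u 2 (volume.restrict Ω)) (hG : MemLp G 2 (volume.restrict Ω))
    (h : IsWeakGradient Ω u G) : h1Fun (mkH1 hu hG h) =ᵐ[volume.restrict Ω] u :=
  hu.coeFn_toLp

theorem h1Grad_mkH1 {Ω : Set (Euc d)} {u : Euc d → ℂ} {G : Euc d → EuclideanSpace ℂ (Fin d)}
    (hu : MemLp u 2 (volume.restrict Ω)) (hG : MemLp G 2 (volume.restrict Ω))
    (h : IsWeakGradient Ω u G) : h1Grad (mkH1 hu hG h) =ᵐ[volume.restrict Ω] G :=
  hG.coeFn_toLp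

theorem memLp_top_of_continuous {E : Type*} [NormedAddCommGroup E]
    [SecondCountableTopology E] {Ω : Set (Euc d)}
    (hΩ : Bornology.IsBounded Ω) {f : Euc d → E} (hf : Continuous f) :
    MemLp f ⊤ (volume.restrict Ω) := by
  obtain ⟨C, hC⟩ := hΩ.isCompact_closure.exists_bound_of_continuousOn hf.continuousOn
  refine memLp_top_of_bound hf.aestronglyMeasurable C ?_
  exact ae_restrict_of_ae_restrict_of_subset subset_closure
    (ae_restrict_of_forall_mem isClosed_closure.measurableSet hC)

theorem isWeakGradient_gradE {Ω : Set (Euc d)} {φ : Euc d → ℂ} (hφ : ContDiff ℝ 1 φ) :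
    IsWeakGradient Ω φ (gradE φ) := by
  intro ψ hψ hc hs i
  have hψ1 : ContDiff ℝ 1 ψ := hψ.of_le (by exact_mod_cast le_top)
  have hDψ : Continuous fun x => fderiv ℝ ψ x (EuclideanSpace.single i 1) :=
    (hψ1.continuous_fderiv (by norm_num)).clm_apply continuous_const
  have hDφ : Continuous fun x => fderiv ℝ φ x (EuclideanSpace.single i 1) :=
    (hφ.continuous_fderiv (by norm_num)).clm_apply continuous_const
  have hcD := hc.fderiv_apply ℝ (EuclideanSpace.single i (1 : ℝ))
  rw [setIntegral_eq_integral_of_forall_compl_eq_zero, setIntegral_eq_integral_of_forall_compl_eq_zero]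
  · have h := integral_smul_fderiv_eq_neg_fderiv_smul_of_integrable (μ := volume) (𝕜 := ℝ) (f := ψ)
      (g := φ) (v := EuclideanSpace.single i 1)
      (((hDψ.smul hφ.continuous).integrable_of_hasCompactSupport hcD.smul_right))
      (((hψ.continuous.smul hDφ).integrable_of_hasCompactSupport hc.smul_right))
      (((hψ.continuous.smul hφ.continuous).integrable_of_hasCompactSupport hc.smul_right))
      (fun x _ => hψ1.differentiable (by norm_num) x) (fun x _ => hφ.differentiable (by norm_num) x)
    simp only [gradE_apply]
    rw [h, neg_neg]
  · intro x hx
    rw [image_eq_zero_of_notMem_tsupport fun hx' => hx (hs hx'), zero_smul]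
  · intro x hx
    rw [image_eq_zero_of_notMem_tsupport fun hx' => hx (hs (tsupport_fderiv_apply_subset ℝ _ hx')),
      zero_smul]

/-- The functions in `H¹(Ω)` that are restrictions of smooth functions. -/
def smoothH1 (Ω : Set (Euc d)) : Submodule ℂ (H1 Ω) where
  carrier := {u | ∃ φ : Euc d → ℂ, ContDiff ℝ (⊤ : ℕ∞) φ ∧ h1Fun u =ᵐ[volume.restrict Ω] φ}
  zero_mem' := ⟨0, contDiff_const, Lp.coeFn_zero _ _ _⟩
  add_mem' := by
    rintro u v ⟨φ, hφ, hu⟩ ⟨ψ, hψ, hv⟩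
    exact ⟨φ + ψ, hφ.add hψ, (Lp.coeFn_add (h1Fun u) (h1Fun v)).trans (hu.add hv)⟩
  smul_mem' := by
    rintro c u ⟨φ, hφ, hu⟩
    refine ⟨c • φ, contDiff_const.smul hφ, (Lp.coeFn_smul c (h1Fun u)).trans ?_⟩
    filter_upwards [hu] with x hx
    simp [hx]

theorem h1Grad_ae_eq_gradE {Ω : Set (Euc d)} (hΩ : IsOpen Ω) (hb : Bornology.IsBounded Ω)
    {φ : Euc d → ℂ} (hφ : ContDiff ℝ 1 φ) {u : H1 Ω} (hu : h1Fun u =ᵐ[volume.restrict Ω] φ) :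
    h1Grad u =ᵐ[volume.restrict Ω] gradE φ := by
  have : IsFiniteMeasure (volume.restrict Ω) := ⟨by simpa using hb.measure_lt_top⟩
  refine (isWeakGradient_h1 u).ae_eq hΩ ((isWeakGradient_gradE hφ).congr hu (ae_eq_refl _))
    (Lp.memLp _) ?_
  exact (memLp_top_of_continuous hb (continuous_gradE hφ)).mono_exponent le_top

theorem energy_eq {Ω : Set (Euc d)} (hΩ : IsOpen Ω) (hb : Bornology.IsBounded Ω)
    {φ : Euc d → ℂ} (hφ : ContDiff ℝ 1 φ) {u : H1 Ω} (hu : h1Fun u =ᵐ[volume.restrict Ω] φ) :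
    energy Ω φ = ‖u‖ₑ ^ 2 := by
  rw [h1_enorm_sq, enorm_sq_eq_lintegral, enorm_sq_eq_lintegral, energy]
  congr 1
  · refine lintegral_congr_ae ?_
    filter_upwards [hu] with x hx
    rw [hx]
  · refine lintegral_congr_ae ?_
    filter_upwards [h1Grad_ae_eq_gradE hΩ hb hφ hu] with x hx
    rw [hx]

theorem exists_smoothH1 {Ω : Set (Euc d)} (hb : Bornology.IsBounded Ω)
    {φ : Euc d → ℂ} (hφ : ContDiff ℝ 1 φ) : ∃ u : H1 Ω, h1Fun u =ᵐ[volume.restrict Ω] φ := by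
  have : IsFiniteMeasure (volume.restrict Ω) := ⟨by simpa using hb.measure_lt_top⟩
  exact ⟨mkH1 ((memLp_top_of_continuous hb hφ.continuous).mono_exponent le_top)
    ((memLp_top_of_continuous hb (continuous_gradE hφ)).mono_exponent le_top)
    (isWeakGradient_gradE hφ), h1Fun_mkH1 _ _ _⟩

theorem h1Grad_eq_zero_of_mem_constH1 {Ω : Set (Euc d)} (hΩ : IsOpen Ω)
    (hb : Bornology.IsBounded Ω) {u : H1 Ω} (hu : u ∈ constH1 Ω) : h1Grad u = 0 := by
  obtain ⟨c, hc⟩ := hu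
  refine Lp.ext ?_
  filter_upwards [h1Grad_ae_eq_gradE hΩ hb (φ := fun _ => c) contDiff_const hc,
    Lp.coeFn_zero (EuclideanSpace ℂ (Fin d)) 2 (volume.restrict Ω)] with x hx h0
  rw [hx, h0]
  refine PiLp.ext fun i => ?_
  simp

/-- The product of an element of `H¹(Ω)` and a smooth function. -/
theorem exists_mul_h1 {Ω : Set (Euc d)} (hb : Bornology.IsBounded Ω) {χ : Euc d → ℝ}
    (hχ : ContDiff ℝ (⊤ : ℕ∞) χ) (u : H1 Ω) :
    ∃ w : H1 Ω, (h1Fun w =ᵐ[volume.restrict Ω] fun x => χ x • h1Fun u x) ∧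
      h1Grad w =ᵐ[volume.restrict Ω] fun x => χ x • h1Grad u x +
        h1Fun u x • gradE (fun y => (χ y : ℂ)) x := by
  have hχ1 : ContDiff ℝ 1 χ := hχ.of_le (by exact_mod_cast le_top)
  have hχc : ContDiff ℝ 1 (fun y => (χ y : ℂ)) := Complex.ofRealCLM.contDiff.comp hχ1
  have h1 : MemLp (fun x => χ x • h1Fun u x) 2 (volume.restrict Ω) :=
    (Lp.memLp (h1Fun u)).smul (memLp_top_of_continuous hb hχ.continuous)
  have h2 : MemLp (fun x => χ x • h1Grad u x) 2 (volume.restrict Ω) :=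
    (Lp.memLp (h1Grad u)).smul (memLp_top_of_continuous hb hχ.continuous)
  have h3 : MemLp (fun x => h1Fun u x • gradE (fun y => (χ y : ℂ)) x) 2 (volume.restrict Ω) :=
    (memLp_top_of_continuous hb (continuous_gradE hχc)).smul (Lp.memLp (h1Fun u))
  refine ⟨mkH1 h1 (h2.add h3) ?_, h1Fun_mkH1 _ _ _, h1Grad_mkH1 _ _ _⟩
  intro ψ hψ hc hs i
  have hψ1 : ContDiff ℝ 1 ψ := hψ.of_le (by exact_mod_cast le_top)
  have hDχ : ∀ x, fderiv ℝ (fun y => (χ y : ℂ)) x (EuclideanSpace.single i 1)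
      = ((fderiv ℝ χ x (EuclideanSpace.single i 1) : ℝ) : ℂ) := by
    intro x
    have := (Complex.ofRealCLM.hasFDerivAt.comp x
      (hχ1.differentiable (by norm_num) x).hasFDerivAt).fderiv
    change fderiv ℝ (Complex.ofRealCLM ∘ χ) x _ = _
    rw [this]; rfl
  have hDprod : ∀ x, fderiv ℝ (fun y => ψ y * χ y) x (EuclideanSpace.single i 1)
      = ψ x * fderiv ℝ χ x (EuclideanSpace.single i 1)
        + χ x * fderiv ℝ ψ x (EuclideanSpace.single i 1) := by
    intro x
    rw [fderiv_fun_mul (hψ1.differentiable (by norm_num) x) (hχ1.differentiable (by norm_num) x)]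
    simp
  have hDχc : Continuous fun x => fderiv ℝ χ x (EuclideanSpace.single i 1) :=
    (hχ1.continuous_fderiv (by norm_num)).clm_apply continuous_const
  have hDψc : Continuous fun x => fderiv ℝ ψ x (EuclideanSpace.single i 1) :=
    (hψ1.continuous_fderiv (by norm_num)).clm_apply continuous_const
  -- The product rule is moved to the test side: `ψ * χ` is itself an admissible test function for
  -- `u`.
  have hw := isWeakGradient_h1 u (fun y => ψ y * χ y) (hψ.mul hχ) hc.mul_right
    ((tsupport_mul_subset_left).trans hs) i
  have i1 : Integrable (fun x => (χ x * fderiv ℝ ψ x (EuclideanSpace.single i 1)) • h1Fun u x)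
      (volume.restrict Ω) :=
    integrable_test_smul (hχ.continuous.mul hDψc) (hc.fderiv_apply ℝ _).mul_left (Lp.memLp _)
  have i2 : Integrable (fun x => (ψ x * fderiv ℝ χ x (EuclideanSpace.single i 1)) • h1Fun u x)
      (volume.restrict Ω) :=
    integrable_test_smul (hψ.continuous.mul hDχc) hc.mul_right (Lp.memLp _)
  have i3 : Integrable (fun x => (ψ x * χ x) • h1Grad u x i) (volume.restrict Ω) :=
    integrable_test_smul (hψ.continuous.mul hχ.continuous) hc.mul_right (memLp_coord (Lp.memLp _) i)
  have e1 : ∫ x in Ω, fderiv ℝ (fun y => ψ y * χ y) x (EuclideanSpace.single i 1) • h1Fun u x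
      = (∫ x in Ω, (ψ x * fderiv ℝ χ x (EuclideanSpace.single i 1)) • h1Fun u x)
        + ∫ x in Ω, (χ x * fderiv ℝ ψ x (EuclideanSpace.single i 1)) • h1Fun u x := by
    rw [← integral_add i2 i1]
    refine integral_congr_ae (Eventually.of_forall fun x => ?_)
    simp only [hDprod, add_smul]
  have e2 : ∫ x in Ω, fderiv ℝ ψ x (EuclideanSpace.single i 1) • χ x • h1Fun u x
      = ∫ x in Ω, (χ x * fderiv ℝ ψ x (EuclideanSpace.single i 1)) • h1Fun u x := by
    refine integral_congr_ae (Eventually.of_forall fun x => ?_)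
    simp only [smul_smul, mul_comm]
  have e3 : ∫ x in Ω, ψ x • ((fun x => χ x • h1Grad u x) + fun x =>
        h1Fun u x • gradE (fun y => (χ y : ℂ)) x) x i
      = (∫ x in Ω, (ψ x * χ x) • h1Grad u x i)
        + ∫ x in Ω, (ψ x * fderiv ℝ χ x (EuclideanSpace.single i 1)) • h1Fun u x := by
    rw [← integral_add i3 i2]
    refine integral_congr_ae (Eventually.of_forall fun x => ?_)
    simp only [Pi.add_apply, PiLp.add_apply, PiLp.smul_apply, gradE_apply, hDχ, Complex.real_smul,
      Complex.ofReal_mul, smul_eq_mul]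
    ring
  rw [e2, e3]
  rw [e1] at hw
  linear_combination hw

/-! ### Mollification -/

/-- Translations are continuous in `L²`. -/
theorem tendsto_lintegral_translate_sub {F : Euc d → ℂ} (hF : MemLp F 2 volume) :
    Tendsto (fun h : Euc d => ∫⁻ x, ‖F (x + h) - F x‖ₑ ^ 2) (𝓝 0) (𝓝 0) := by
  have hmp : ∀ h : Euc d, MeasurePreserving
      (ContinuousMap.mk (fun x : Euc d => x + h) (by fun_prop)) volume volume :=
    fun h => measurePreserving_add_right volume h
  have hg : Continuous fun h : Euc d => ContinuousMap.mk (fun x : Euc d => x + h) (by fun_prop) :=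
    ContinuousMap.continuous_of_continuous_uncurry _ (by
      change Continuous fun p : Euc d × Euc d => p.2 + p.1
      fun_prop)
  have hc : Continuous fun h : Euc d => Lp.compMeasurePreserving _ (hmp h) (hF.toLp F) :=
    continuous_const.compMeasurePreservingLp hg hmp (by simp)
  have h0 : Lp.compMeasurePreserving _ (hmp 0) (hF.toLp F) = hF.toLp F := by
    refine Lp.ext ?_
    filter_upwards [Lp.coeFn_compMeasurePreserving (hF.toLp F) (hmp 0)] with x hx
    rw [hx]; simp
  have heq : ∀ h : Euc d, ∫⁻ x, ‖F (x + h) - F x‖ₑ ^ 2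
      = ‖Lp.compMeasurePreserving _ (hmp h) (hF.toLp F) - hF.toLp F‖ₑ ^ 2 := by
    intro h
    rw [enorm_sq_eq_lintegral]
    refine lintegral_congr_ae ?_
    have h1 : ∀ᵐ x : Euc d, hF.toLp F (x + h) = F (x + h) :=
      (hmp h).quasiMeasurePreserving.ae hF.coeFn_toLp
    filter_upwards [Lp.coeFn_compMeasurePreserving (hF.toLp F) (hmp h),
      Lp.coeFn_sub (Lp.compMeasurePreserving _ (hmp h) (hF.toLp F)) (hF.toLp F),
      hF.coeFn_toLp, h1] with x h2 h3 h4 h5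
    rw [h3, Pi.sub_apply, h2, h4]
    simp [h5]
  simp_rw [heq]
  have h1 : Continuous fun h : Euc d =>
      ‖Lp.compMeasurePreserving _ (hmp h) (hF.toLp F) - hF.toLp F‖ₑ ^ 2 :=
    (ENNReal.continuous_pow 2).comp (hc.sub continuous_const).enorm
  have h2 := h1.tendsto 0
  simp only [h0, sub_self, enorm_zero] at h2
  simpa using h2

/-- The mollification of `F` with the kernel `k` at the scale `ε`. -/
def moll (k : Euc d → ℝ) (ε : ℝ) (F : Euc d → ℂ) (x : Euc d) : ℂ :=
  ∫ y, ((ε ^ d)⁻¹ * k (ε⁻¹ • (y - x))) • F y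

theorem moll_eq {k : Euc d → ℝ} {ε : ℝ} (hε : 0 < ε) (F : Euc d → ℂ) (x : Euc d) :
    moll k ε F x = ∫ v, k v • F (x + ε • v) := by
  have h1 := Measure.integral_comp_smul_of_nonneg (volume : Measure (Euc d))
    (fun z => k (ε⁻¹ • z) • F (x + z)) ε (hR := hε.le)
  simp only [inv_smul_smul₀ hε.ne', finrank_euclideanSpace, Fintype.card_fin] at h1
  rw [h1, ← integral_sub_right_eq_self _ x, ← integral_smul]
  simp only [moll, add_sub_cancel, smul_smul]

/-- As `k` has integral one, the error is the integral of `k v • (F (x + ε • v) - F x)`.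
Cauchy–Schwarz on the support of `k` and Fubini's theorem reduce it to translation errors in `L²`.
-/
theorem lintegral_moll_sub_le {k : Euc d → ℝ} (hk : Continuous k) (hkc : HasCompactSupport k)
    (hk1 : ∫ v, k v = 1) {ε : ℝ} (hε : 0 < ε) {F : Euc d → ℂ} (hF : MemLp F 2 volume)
    (hFm : Measurable F) :
    ∫⁻ x, ‖moll k ε F x - F x‖ₑ ^ 2 ≤ (∫⁻ v, ‖k v‖ₑ ^ 2) *
      ∫⁻ v in tsupport k, ∫⁻ x, ‖F (x + ε • v) - F x‖ₑ ^ 2 := by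
  have hm2 : Measurable fun q : Euc d × Euc d => ‖F (q.1 + ε • q.2) - F q.1‖ₑ ^ 2 :=
    ((hFm.comp (by fun_prop)).sub (hFm.comp measurable_fst)).enorm.pow_const 2
  have hpt : ∀ x, ‖moll k ε F x - F x‖ₑ ^ 2 ≤ (∫⁻ v, ‖k v‖ₑ ^ 2) *
      ∫⁻ v in tsupport k, ‖F (x + ε • v) - F x‖ₑ ^ 2 := by
    intro x
    have hmp : MemLp (fun v : Euc d => F (x + ε • v)) 2 volume := by
      refine ⟨(hFm.comp (by fun_prop)).aestronglyMeasurable, ?_⟩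
      have h1 : ∫⁻ v : Euc d, ‖F (x + ε • v)‖ₑ ^ 2 < ∞ := by
        have hm : Measurable fun y => ‖F (x + y)‖ₑ ^ 2 := (hFm.comp (by fun_prop)).enorm.pow_const 2
        rw [← lintegral_map (f := fun y => ‖F (x + y)‖ₑ ^ 2) (g := fun v : Euc d => ε • v) hm
          (by fun_prop), Measure.map_addHaar_smul _ hε.ne', lintegral_smul_measure,
          lintegral_add_left_eq_self (fun y => ‖F y‖ₑ ^ 2)]
        have h2 : ∫⁻ y, ‖F y‖ₑ ^ 2 < ∞ := by
          have := (eLpNorm_lt_top_iff_lintegral_rpow_enorm_lt_top (by norm_num) (by simp)).1 hF.2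
          simpa using this
        exact ENNReal.mul_lt_top ENNReal.ofReal_lt_top h2
      rw [eLpNorm_lt_top_iff_lintegral_rpow_enorm_lt_top (by norm_num) (by simp)]
      simpa using h1
    have i1 : Integrable (fun v => k v • F (x + ε • v)) := integrable_test_smul hk hkc hmp
    have i2 : Integrable (fun v => k v • F x) :=
      (hk.smul continuous_const).integrable_of_hasCompactSupport hkc.smul_right
    have h1 : moll k ε F x - F x = ∫ v, k v • (F (x + ε • v) - F x) := by
      simp_rw [smul_sub]
      rw [integral_sub i1 i2, integral_smul_const, hk1, one_smul, moll_eq hε]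
    rw [h1]
    calc ‖∫ v, k v • (F (x + ε • v) - F x)‖ₑ ^ 2
        ≤ (∫⁻ v, ‖k v • (F (x + ε • v) - F x)‖ₑ) ^ 2 :=
          pow_le_pow_left' (enorm_integral_le_lintegral_enorm _) 2
      _ = (∫⁻ v in tsupport k, ‖k v‖ₑ * ‖F (x + ε • v) - F x‖ₑ) ^ 2 := by
          congr 1
          rw [← lintegral_indicator (isClosed_tsupport k).measurableSet]
          refine lintegral_congr fun v => ?_
          by_cases hv : v ∈ tsupport k
          · rw [indicator_of_mem hv, enorm_smul]
          · rw [indicator_of_notMem hv, image_eq_zero_of_notMem_tsupport hv, zero_smul, enorm_zero]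
      _ ≤ (∫⁻ v in tsupport k, ‖k v‖ₑ ^ 2) * ∫⁻ v in tsupport k, ‖F (x + ε • v) - F x‖ₑ ^ 2 :=
          sq_lintegral_mul_le _ hk.measurable.enorm.aemeasurable
            ((hFm.comp (by fun_prop)).sub_const _).enorm.aemeasurable
      _ ≤ _ := mul_le_mul' (setLIntegral_le_lintegral _ _) le_rfl
  have hkt : ∫⁻ v, ‖k v‖ₑ ^ 2 ≠ ∞ := by
    have := (eLpNorm_lt_top_iff_lintegral_rpow_enorm_lt_top (p := 2) (by norm_num) (by simp)).1
      (hk.memLp_of_hasCompactSupport (μ := (volume : Measure (Euc d))) hkc).2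
    refine ne_of_lt ?_
    simpa using this
  refine (lintegral_mono hpt).trans ?_
  rw [lintegral_const_mul' _ _ hkt]
  refine mul_le_mul' le_rfl (le_of_eq ?_)
  exact lintegral_lintegral_swap (f := fun x v => ‖F (x + ε • v) - F x‖ₑ ^ 2) hm2.aemeasurable

/-- Mollifications converge in `L²`. -/
theorem tendsto_lintegral_moll_sub {k : Euc d → ℝ} (hk : Continuous k) (hkc : HasCompactSupport k)
    (hk1 : ∫ v, k v = 1) {F : Euc d → ℂ} (hF : MemLp F 2 volume) (hFm : Measurable F) :
    Tendsto (fun ε => ∫⁻ x, ‖moll k ε F x - F x‖ₑ ^ 2) (𝓝[>] (0 : ℝ)) (𝓝 0) := by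
  have hkt : ∫⁻ v, ‖k v‖ₑ ^ 2 ≠ ∞ := by
    have := (eLpNorm_lt_top_iff_lintegral_rpow_enorm_lt_top (p := 2) (by norm_num) (by simp)).1
      (hk.memLp_of_hasCompactSupport (μ := (volume : Measure (Euc d))) hkc).2
    refine ne_of_lt ?_
    simpa using this
  have hvt : volume (tsupport k) ≠ ∞ := hkc.isCompact.measure_lt_top.ne
  obtain ⟨R, hR⟩ := hkc.isCompact.isBounded.exists_norm_le
  have htr := tendsto_lintegral_translate_sub hF
  rw [ENNReal.tendsto_nhds_zero] at htr ⊢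
  intro δ hδ
  set c := (∫⁻ v, ‖k v‖ₑ ^ 2) * volume (tsupport k) with hc
  have hct : c ≠ ∞ := ENNReal.mul_ne_top hkt hvt
  obtain ⟨δ', hδ'0, hδ'⟩ : ∃ δ' > 0, c * δ' ≤ δ := by
    rcases eq_or_ne c 0 with h0 | h0
    · exact ⟨1, one_pos, by simp [h0]⟩
    · refine ⟨c⁻¹ * δ, ENNReal.mul_pos (ENNReal.inv_ne_zero.2 hct) hδ.ne', ?_⟩
      rw [← mul_assoc, ENNReal.mul_inv_cancel h0 hct, one_mul]
  obtain ⟨r, hr, hball⟩ := Metric.eventually_nhds_iff.1 (htr δ' hδ'0)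
  have hR1 : 0 < |R| + 1 := by positivity
  have hev : ∀ᶠ ε in 𝓝[>] (0 : ℝ), ε < r / (|R| + 1) :=
    nhdsWithin_le_nhds (Iio_mem_nhds (by positivity))
  filter_upwards [hev, self_mem_nhdsWithin] with ε hε1 hε0
  have hε0 : 0 < ε := hε0
  refine (lintegral_moll_sub_le hk hkc hk1 hε0 hF hFm).trans ?_
  have h1 : ∫⁻ v in tsupport k, ∫⁻ x, ‖F (x + ε • v) - F x‖ₑ ^ 2 ≤ volume (tsupport k) * δ' := by
    rw [mul_comm, ← setLIntegral_const]
    refine setLIntegral_mono' (isClosed_tsupport k).measurableSet fun v hv => hball ?_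
    rw [dist_zero_right, norm_smul, Real.norm_of_nonneg hε0.le]
    have h2 := hR v hv
    rw [lt_div_iff₀ hR1] at hε1
    have h3 : ε * ‖v‖ ≤ ε * (|R| + 1) :=
      mul_le_mul_of_nonneg_left (by linarith [le_abs_self R]) hε0.le
    linarith
  refine (mul_le_mul' le_rfl h1).trans ?_
  rw [← mul_assoc]
  exact hδ'

/-- The derivative of a mollification. -/
theorem contDiff_moll {k : Euc d → ℝ} (hk : ContDiff ℝ (⊤ : ℕ∞) k) (hkc : HasCompactSupport k)
    {ε : ℝ} (hε : 0 < ε) {F : Euc d → ℂ} (hF : MemLp F 2 volume) :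
    ContDiff ℝ (⊤ : ℕ∞) (moll k ε F) ∧ ∀ x v, fderiv ℝ (moll k ε F) x v =
      - ∫ y, (fderiv ℝ (fun y => (ε ^ d)⁻¹ * k (ε⁻¹ • (y - x))) y v) • F y := by
  set g : Euc d → ℝ := fun z => (ε ^ d)⁻¹ * k (-(ε⁻¹ • z)) with hg
  have hgs : ContDiff ℝ (⊤ : ℕ∞) g := by
    have h1 : ContDiff ℝ (⊤ : ℕ∞) fun z : Euc d => -(ε⁻¹ • z) := by fun_prop
    exact contDiff_const.mul (hk.comp h1)
  have hg1 : ContDiff ℝ 1 g := hgs.of_le (by exact_mod_cast le_top)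
  have hgc : HasCompactSupport g := by
    have h1 : HasCompactSupport fun z : Euc d => k (-(ε⁻¹ • z)) := by
      have := hkc.comp_homeomorph ((Homeomorph.smulOfNeZero (ε⁻¹) (inv_ne_zero hε.ne')).trans
        (Homeomorph.neg (Euc d)))
      exact this
    exact h1.mul_left
  have hFl : LocallyIntegrable F volume := hF.locallyIntegrable (by norm_num)
  set L := (ContinuousLinearMap.lsmul ℝ ℝ (E := ℂ)).flip with hL
  -- With the kernel reflected, the forward average is an ordinary convolution, and all derivatives
  -- fall on the kernel.
  have hconv : moll k ε F = convolution F g L volume := by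
    ext x
    rw [convolution_def, moll]
    refine integral_congr_ae (Eventually.of_forall fun y => ?_)
    simp only [hL, hg, ContinuousLinearMap.flip_apply, ContinuousLinearMap.lsmul_apply]
    congr 3
    rw [← smul_neg, neg_sub]
  refine ⟨?_, fun x v => ?_⟩
  · rw [hconv]
    exact hgc.contDiff_convolution_right L hFl hgs
  · rw [hconv, (hgc.hasFDerivAt_convolution_right L hFl hg1 x).fderiv,
      convolution_precompR_apply L hFl (hgc.fderiv ℝ) (hg1.continuous_fderiv (by norm_num)),
      convolution_def, ← integral_neg]
    refine integral_congr_ae (Eventually.of_forall fun y => ?_)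
    simp only [hL, ContinuousLinearMap.flip_apply, ContinuousLinearMap.lsmul_apply]
    rw [← neg_smul]
    congr 1
    have h2 : (fun y => (ε ^ d)⁻¹ * k (ε⁻¹ • (y - x))) = fun y => g (x - y) := by
      ext y
      simp only [hg]
      rw [← smul_neg, neg_sub]
    have h3 : HasFDerivAt (fun y => g (x - y))
        ((fderiv ℝ g (x - y)).comp (-ContinuousLinearMap.id ℝ (Euc d))) y :=
      ((hg1.differentiable (by norm_num) (x - y)).hasFDerivAt).comp y
        ((hasFDerivAt_id y).const_sub x)
    rw [h2, h3.fderiv]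
    simp

/-! ### Density of smooth functions -/

theorem enorm_sq_eq_sum (z : EuclideanSpace ℂ (Fin d)) : ‖z‖ₑ ^ 2 = ∑ i, ‖z i‖ₑ ^ 2 := by
  simp only [← ofReal_norm]
  rw [← ENNReal.ofReal_pow (norm_nonneg _), EuclideanSpace.norm_sq_eq,
    ENNReal.ofReal_sum_of_nonneg fun i _ => by positivity]
  exact Finset.sum_congr rfl fun i _ => ENNReal.ofReal_pow (norm_nonneg _) 2

/-- The bump is centred at `e` instead of the origin, so the mollification samples at `x + ε • v`
with `v` in the cone. -/
theorem exists_kernel (e : Euc d) {ρ : ℝ} (hρ : 0 < ρ) : ∃ k : Euc d → ℝ,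
    ContDiff ℝ (⊤ : ℕ∞) k ∧ HasCompactSupport k ∧ ∫ v, k v = 1 ∧
      ∀ v ∈ tsupport k, ‖v - e‖ < ρ := by
  let b : ContDiffBump e := ⟨ρ / 4, ρ / 2, by positivity, by linarith⟩
  refine ⟨b.normed volume, b.contDiff_normed, b.hasCompactSupport_normed, b.integral_normed, ?_⟩
  intro v hv
  rw [b.tsupport_normed_eq, Metric.mem_closedBall, dist_eq_norm] at hv
  have : b.rOut = ρ / 2 := rfl
  linarith

/-- Mollification commutes with weak differentiation where the kernel stays inside of `Ω`, and
where the function vanishes. -/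
theorem gradE_moll_apply {Ω : Set (Euc d)} (hΩ : IsOpen Ω) {k : Euc d → ℝ}
    (hk : ContDiff ℝ (⊤ : ℕ∞) k) (hkc : HasCompactSupport k) {ε : ℝ} (hε : 0 < ε) (w : H1 Ω)
    (hF : MemLp (Ω.indicator (h1Fun w)) 2 volume) {x : Euc d}
    (hx : (∀ v ∈ tsupport k, x + ε • v ∈ Ω) ∨
      ((∀ᵐ y ∂(volume.restrict Ω), ε⁻¹ • (y - x) ∈ tsupport k → h1Fun w y = 0) ∧
        ∀ᵐ y ∂(volume.restrict Ω), ε⁻¹ • (y - x) ∈ tsupport k → h1Grad w y = 0)) (i : Fin d) :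
    gradE (moll k ε (Ω.indicator (h1Fun w))) x i
      = moll k ε (Ω.indicator fun y => h1Grad w y i) x := by
  rw [gradE_apply, (contDiff_moll hk hkc hε hF).2, moll]
  set ψ : Euc d → ℝ := fun y => (ε ^ d)⁻¹ * k (ε⁻¹ • (y - x)) with hψ
  have hψs : ContDiff ℝ (⊤ : ℕ∞) ψ := by
    have h1 : ContDiff ℝ (⊤ : ℕ∞) fun y : Euc d => ε⁻¹ • (y - x) := by fun_prop
    exact contDiff_const.mul (hk.comp h1)
  let Φ := (Homeomorph.subRight x).trans (Homeomorph.smulOfNeZero (ε⁻¹) (inv_ne_zero hε.ne'))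
  have hψc : HasCompactSupport ψ := by
    have h1 : HasCompactSupport (k ∘ Φ) := hkc.comp_homeomorph Φ
    exact h1.mul_left
  have hψt : ∀ y ∈ tsupport ψ, ε⁻¹ • (y - x) ∈ tsupport k := by
    intro y hy
    have h1 : tsupport ψ ⊆ tsupport (k ∘ Φ) := tsupport_mul_subset_right
    have h2 := h1 hy
    exact tsupport_comp_subset_preimage k Φ.continuous h2
  have e1 : ∫ y, (fderiv ℝ ψ y (EuclideanSpace.single i 1)) • Ω.indicator (h1Fun w) y
      = ∫ y in Ω, (fderiv ℝ ψ y (EuclideanSpace.single i 1)) • h1Fun w y := by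
    rw [← integral_indicator hΩ.measurableSet]
    refine integral_congr_ae (Eventually.of_forall fun y => ?_)
    by_cases hy : y ∈ Ω <;> simp [hy]
  have e2 : ∫ y, ψ y • Ω.indicator (fun y => h1Grad w y i) y
      = ∫ y in Ω, ψ y • h1Grad w y i := by
    rw [← integral_indicator hΩ.measurableSet]
    refine integral_congr_ae (Eventually.of_forall fun y => ?_)
    by_cases hy : y ∈ Ω <;> simp [hy]
  rw [e1]
  refine Eq.trans ?_ e2.symm
  -- In the first case the rescaled kernel is a test function supported in `Ω` and the weak gradient
  -- identity applies; in the second case both integrands vanish almost everywhere.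
  rcases hx with hx | ⟨hx1, hx2⟩
  · have hs : tsupport ψ ⊆ Ω := by
      intro y hy
      have h1 := hx _ (hψt y hy)
      rwa [smul_inv_smul₀ hε.ne', add_sub_cancel] at h1
    rw [isWeakGradient_h1 w ψ hψs hψc hs i, neg_neg]
  · rw [integral_eq_zero_of_ae, integral_eq_zero_of_ae, neg_zero]
    · filter_upwards [hx2] with y hy
      by_cases h : y ∈ tsupport ψ
      · simp [hy (hψt y h)]
      · simp [image_eq_zero_of_notMem_tsupport h]
    · filter_upwards [hx1] with y hy
      by_cases h : y ∈ tsupport ψ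
      · simp [hy (hψt y h)]
      · have h1 : fderiv ℝ ψ y (EuclideanSpace.single i 1) = 0 :=
          image_eq_zero_of_notMem_tsupport (f := fun y => fderiv ℝ ψ y (EuclideanSpace.single i 1))
            fun h' => h (tsupport_fderiv_apply_subset ℝ _ h')
        simp [h1]

/-- The zero extension is mollified in the direction of the cone. From points of `Ω` near `x₀` the
samples stay in `Ω`, so the jump of the extension across the boundary is never seen; from points
farther away the samples miss the ball that carries `w`. Hence on `Ω` the mollification commutes
with the gradient, and convergence in `L²` of function and gradient suffices. -/
theorem mem_closure_smoothH1_of_cone {Ω : Set (Euc d)} (hΩ : IsOpen Ω)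
    (hb : Bornology.IsBounded Ω) {x₀ e : Euc d} {ρ r : ℝ} (hρ : 0 < ρ) (hr : 0 < r)
    (hcone : ∀ x ∈ closure Ω, dist x x₀ < r → ∀ v, ‖v - e‖ < ρ → ∀ t ∈ Ioc (0 : ℝ) 1,
      x + t • v ∈ Ω) {w : H1 Ω}
    (hw0 : ∀ᵐ x ∂(volume.restrict Ω), x ∉ Metric.ball x₀ (r / 2) → h1Fun w x = 0)
    (hw1 : ∀ᵐ x ∂(volume.restrict Ω), x ∉ Metric.ball x₀ (r / 2) → h1Grad w x = 0) :
    w ∈ (smoothH1 Ω).topologicalClosure := by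
  obtain ⟨k, hk, hkc, hk1, hkt⟩ := exists_kernel e hρ
  have hF : MemLp (Ω.indicator (h1Fun w)) 2 volume :=
    (memLp_indicator_iff_restrict hΩ.measurableSet).2 (Lp.memLp _)
  have hFm : Measurable (Ω.indicator (h1Fun w)) :=
    (Lp.stronglyMeasurable (h1Fun w)).measurable.indicator hΩ.measurableSet
  have hG : ∀ i, MemLp (Ω.indicator fun y => h1Grad w y i) 2 volume := fun i =>
    (memLp_indicator_iff_restrict hΩ.measurableSet).2 (memLp_coord (Lp.memLp _) i)
  have hGm : ∀ i, Measurable (Ω.indicator fun y => h1Grad w y i) := fun i =>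
    ((EuclideanSpace.proj (𝕜 := ℂ) i).continuous.measurable.comp
      (Lp.stronglyMeasurable (h1Grad w)).measurable).indicator hΩ.measurableSet
  set B : ℝ → ℝ≥0∞ := fun ε =>
    (∫⁻ x, ‖moll k ε (Ω.indicator (h1Fun w)) x - Ω.indicator (h1Fun w) x‖ₑ ^ 2) +
    ∑ i, ∫⁻ x, ‖moll k ε (Ω.indicator fun y => h1Grad w y i) x
      - Ω.indicator (fun y => h1Grad w y i) x‖ₑ ^ 2 with hB
  have hBt : Tendsto B (𝓝[>] 0) (𝓝 0) := by
    have h1 := tendsto_lintegral_moll_sub hk.continuous hkc hk1 hF hFm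
    have h2 := tendsto_finsetSum Finset.univ fun i (_ : i ∈ Finset.univ) =>
      tendsto_lintegral_moll_sub hk.continuous hkc hk1 (hG i) (hGm i)
    simpa using h1.add h2
  have hclose : ∀ᶠ ε in 𝓝[>] (0 : ℝ), ∃ u ∈ smoothH1 Ω, ‖u - w‖ₑ ^ 2 ≤ B ε := by
    have hep : 0 < ‖e‖ + ρ := by positivity
    have ev1 : ∀ᶠ ε in 𝓝[>] (0 : ℝ), ε < r / 2 / (‖e‖ + ρ) :=
      nhdsWithin_le_nhds (Iio_mem_nhds (by positivity))
    have ev2 : ∀ᶠ ε in 𝓝[>] (0 : ℝ), ε < 1 := nhdsWithin_le_nhds (Iio_mem_nhds one_pos)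
    filter_upwards [ev1, ev2, self_mem_nhdsWithin] with ε h1 h2 h3
    have h3 : 0 < ε := h3
    rw [lt_div_iff₀ hep] at h1
    have hsm := (contDiff_moll hk hkc h3 hF).1
    have hsm1 : ContDiff ℝ 1 (moll k ε (Ω.indicator (h1Fun w))) :=
      hsm.of_le (by exact_mod_cast le_top)
    obtain ⟨u, hu⟩ := exists_smoothH1 hb hsm1
    refine ⟨u, ⟨_, hsm, hu⟩, ?_⟩
    have hgrad : ∀ x ∈ Ω, ∀ i, gradE (moll k ε (Ω.indicator (h1Fun w))) x i
        = moll k ε (Ω.indicator fun y => h1Grad w y i) x := by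
      intro x hx i
      refine gradE_moll_apply hΩ hk hkc h3 w hF ?_ i
      by_cases hxr : dist x x₀ < r
      · exact Or.inl fun v hv => hcone x (subset_closure hx) hxr v (hkt v hv) ε ⟨h3, h2.le⟩
      · have hfar : ∀ y, ε⁻¹ • (y - x) ∈ tsupport k → y ∉ Metric.ball x₀ (r / 2) := by
          intro y hy hyb
          have h4 := hkt _ hy
          have h5 : ‖ε⁻¹ • (y - x)‖ < ‖e‖ + ρ := by
            have := norm_le_norm_add_norm_sub' (ε⁻¹ • (y - x)) e
            linarith
          rw [norm_smul, norm_inv, Real.norm_of_nonneg h3.le, inv_mul_lt_iff₀ h3] at h5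
          rw [Metric.mem_ball] at hyb
          have h6 := dist_triangle x y x₀
          rw [dist_comm x y, dist_eq_norm y x] at h6
          linarith
        refine Or.inr ⟨?_, ?_⟩
        · filter_upwards [hw0] with y hy hyk using hy (hfar y hyk)
        · filter_upwards [hw1] with y hy hyk using hy (hfar y hyk)
    rw [h1_enorm_sq, enorm_sq_eq_lintegral, enorm_sq_eq_lintegral, hB]
    refine add_le_add ?_ ?_
    · refine le_trans (le_of_eq ?_) (setLIntegral_le_lintegral Ω _)
      refine lintegral_congr_ae ?_
      filter_upwards [hu, Lp.coeFn_sub (h1Fun u) (h1Fun w), ae_restrict_mem hΩ.measurableSet]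
        with x h4 h5 h6
      have h7 : h1Fun (u - w) x = h1Fun u x - h1Fun w x := h5
      rw [h7, h4, indicator_of_mem h6]
    · rw [← lintegral_finsetSum']
      · refine le_trans (le_of_eq ?_) (setLIntegral_le_lintegral Ω _)
        refine lintegral_congr_ae ?_
        filter_upwards [h1Grad_ae_eq_gradE hΩ hb hsm1 hu, Lp.coeFn_sub (h1Grad u) (h1Grad w),
          ae_restrict_mem hΩ.measurableSet] with x h4 h5 h6
        have h7 : h1Grad (u - w) x = h1Grad u x - h1Grad w x := h5
        rw [h7, h4, enorm_sq_eq_sum]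
        refine Finset.sum_congr rfl fun i _ => ?_
        rw [indicator_of_mem h6, PiLp.sub_apply, hgrad x h6]
      · intro i _
        have := (contDiff_moll hk hkc h3 (hG i)).1.continuous.measurable
        exact (this.sub (hGm i)).enorm.aemeasurable.pow_const 2
  rw [← SetLike.mem_coe, Submodule.topologicalClosure_coe, EMetric.mem_closure_iff]
  intro δ hδ
  have hlt : ∀ᶠ ε in 𝓝[>] (0 : ℝ), B ε < δ ^ 2 :=
    hBt.eventually_lt_const (by positivity)
  obtain ⟨ε, ⟨u, hu, hle⟩, hlt⟩ := (hclose.and hlt).exists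
  refine ⟨u, hu, ?_⟩
  rw [edist_comm, edist_eq_enorm_sub]
  by_contra hcon
  exact absurd (hle.trans_lt hlt) (not_lt.2 (pow_le_pow_left' (not_lt.1 hcon) 2))

/-- A partition of unity in multiplicative form. The induction over the compact closure produces a
cutoff `ψ` that vanishes on the covered set and for which `u - ψ u` is approximable; once all of the
closure is covered, `ψ u` is zero. -/
theorem IsBoundedLipschitzDomain.topologicalClosure_smoothH1 {Ω : Set (Euc d)}
    (hΩ : IsBoundedLipschitzDomain Ω) : (smoothH1 Ω).topologicalClosure = ⊤ := by
  have hb := hΩ.isBounded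
  have key : ∃ ψ : Euc d → ℝ, ContDiff ℝ (⊤ : ℕ∞) ψ ∧ (∀ x ∈ closure Ω, ψ x = 0) ∧
      ∀ u w : H1 Ω, h1Fun w =ᵐ[volume.restrict Ω] (fun x => ψ x • h1Fun u x) →
        u - w ∈ (smoothH1 Ω).topologicalClosure := by
    refine IsCompact.induction_on (p := fun s => ∃ ψ : Euc d → ℝ, ContDiff ℝ (⊤ : ℕ∞) ψ ∧
      (∀ x ∈ s, ψ x = 0) ∧ ∀ u w : H1 Ω, h1Fun w =ᵐ[volume.restrict Ω] (fun x => ψ x • h1Fun u x) →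
        u - w ∈ (smoothH1 Ω).topologicalClosure) hb.isCompact_closure ?_ ?_ ?_ ?_
    · refine ⟨fun _ => 1, contDiff_const, by simp, fun u w h => ?_⟩
      have : w = u := h1_ext hΩ.isOpen (Lp.ext (h.trans (by simp)))
      rw [this, sub_self]
      exact Submodule.zero_mem _
    · rintro s t hst ⟨ψ, h1, h2, h3⟩
      exact ⟨ψ, h1, fun x hx => h2 x (hst hx), h3⟩
    · rintro s t ⟨ψ, h1, h2, h3⟩ ⟨ψ', h1', h2', h3'⟩
      -- The error telescopes: `u - ψ' ψ u = (u - ψ u) + (ψ u - ψ' (ψ u))`.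
      refine ⟨fun x => ψ' x * ψ x, h1'.mul h1, ?_, fun u w h => ?_⟩
      · rintro x (hx | hx)
        · simp [h2 x hx]
        · simp [h2' x hx]
      · obtain ⟨v, hv, -⟩ := exists_mul_h1 hb h1 u
        have h4 := h3' v w (by
          filter_upwards [h, hv] with x h5 h6
          rw [h5, h6, smul_smul])
        have := Submodule.add_mem _ (h3 u v hv) h4
        rwa [sub_add_sub_cancel] at this
    · intro x₀ hx₀
      obtain ⟨e, ρ, r, hρ, hr, hcone⟩ := hΩ.exists_cone hx₀
      let b : ContDiffBump x₀ := ⟨r / 8, r / 4, by positivity, by linarith⟩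
      refine ⟨Metric.closedBall x₀ (r / 8), mem_nhdsWithin_of_mem_nhds
        (Metric.closedBall_mem_nhds _ (by positivity)), fun x => 1 - b x,
        contDiff_const.sub b.contDiff, ?_, fun u w h => ?_⟩
      · intro x hx
        simp [b.one_of_mem_closedBall hx]
      · obtain ⟨v, hv, hv'⟩ := exists_mul_h1 hb (b.contDiff (n := (⊤ : ℕ∞))) u
        have huw : u - w = v := by
          refine h1_ext hΩ.isOpen (Lp.ext ?_)
          filter_upwards [Lp.coeFn_sub (h1Fun u) (h1Fun w), h, hv] with x h4 h5 h6
          have h7 : h1Fun (u - w) x = h1Fun u x - h1Fun w x := h4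
          rw [h7, h5, h6, sub_smul, one_smul, sub_sub_cancel]
        rw [huw]
        have hfar : ∀ x, x ∉ Metric.ball x₀ (r / 2) → x ∉ tsupport (fun y => ((b y : ℝ) : ℂ)) := by
          intro x hx hx'
          have h4 : tsupport (fun y => ((b y : ℝ) : ℂ)) ⊆ tsupport b :=
            closure_mono fun y hy hy' => hy (by simp [hy'])
          have h5 := h4 hx'
          rw [b.tsupport_eq, Metric.mem_closedBall] at h5
          have h6 : b.rOut = r / 4 := rfl
          refine hx (Metric.mem_ball.2 ?_)
          linarith
        have hz : ∀ x, x ∉ Metric.ball x₀ (r / 2) → b x = 0 := fun x hx => by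
          have := image_eq_zero_of_notMem_tsupport (hfar x hx)
          exact_mod_cast this
        refine mem_closure_smoothH1_of_cone hΩ.isOpen hb hρ hr hcone ?_ ?_
        · filter_upwards [hv] with x hx hxb
          rw [hx, hz x hxb, zero_smul]
        · filter_upwards [hv'] with x hx hxb
          rw [hx, hz x hxb, zero_smul, zero_add]
          have h4 : gradE (fun y => ((b y : ℝ) : ℂ)) x = 0 := by
            refine PiLp.ext fun i => ?_
            rw [gradE_apply]
            have h5 : fderiv ℝ (fun y => ((b y : ℝ) : ℂ)) x = 0 :=
              image_eq_zero_of_notMem_tsupport fun h' => hfar x hxb (tsupport_fderiv_subset ℝ h')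
            rw [h5]; rfl
          rw [h4, smul_zero]
  obtain ⟨ψ, -, h0, hψ⟩ := key
  refine eq_top_iff.2 fun u _ => ?_
  have := hψ u 0 (by
    filter_upwards [Lp.coeFn_zero ℂ 2 (volume.restrict Ω), ae_restrict_mem hΩ.isOpen.measurableSet]
      with x hx hxΩ
    rw [h0 x (subset_closure hxΩ), zero_smul]
    exact hx)
  rwa [sub_zero] at this

/-! ### The quotient by the constants and the Poincaré inequality -/

/-- The quotient map `H¹(Ω) → H¹(Ω)/ℂ`. -/
def h1ClassL (Ω : Set (Euc d)) : H1 Ω →L[ℂ] H1C Ω := (constH1 Ω).mkQL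

instance (Ω : Set (Euc d)) : CompleteSpace (H1C Ω) :=
  inferInstanceAs (CompleteSpace (H1 Ω ⧸ constH1 Ω))

theorem norm_h1Class_le {Ω : Set (Euc d)} (u : H1 Ω) : ‖h1Class u‖ ≤ ‖u‖ :=
  Submodule.Quotient.norm_mk_le (constH1 Ω) u

theorem h1Class_eq_iff {Ω : Set (Euc d)} {u v : H1 Ω} :
    h1Class u = h1Class v ↔ u - v ∈ constH1 Ω :=
  Submodule.Quotient.eq (constH1 Ω)

theorem h1Class_surjective {Ω : Set (Euc d)} : Function.Surjective (h1Class (Ω := Ω)) :=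
  Submodule.Quotient.mk_surjective (constH1 Ω)

theorem IsBoundedLipschitzDomain.dense_smoothH1 {Ω : Set (Euc d)}
    (hΩ : IsBoundedLipschitzDomain Ω) : Dense (smoothH1 Ω : Set (H1 Ω)) :=
  Submodule.dense_iff_topologicalClosure_eq_top.2 hΩ.topologicalClosure_smoothH1

/-- The Poincaré inequality. -/
theorem IsBoundedLipschitzDomain.exists_norm_h1Class_le {Ω : Set (Euc d)}
    (hΩ : IsBoundedLipschitzDomain Ω) :
    ∃ C : ℝ, 0 ≤ C ∧ ∀ u : H1 Ω, ‖h1Class u‖ ≤ C * ‖h1Grad u‖ := by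
  obtain ⟨C, hC, h⟩ := hΩ.hasPoincare
  have hC0 : 0 ≤ C.toReal := ENNReal.toReal_nonneg
  -- The squared norm of `u - v` is at most `C + 1` times that of the gradient, and `C + 1 ≤ (C + 1)
  -- ^ 2` avoids a square root.
  refine ⟨C.toReal + 1, by positivity, fun u => ?_⟩
  refine hΩ.dense_smoothH1.induction (P := fun u => ‖h1Class u‖ ≤ (C.toReal + 1) * ‖h1Grad u‖)
    ?_ ?_ u
  · rintro u ⟨φ, hφ, hu⟩
    have hφ1 : ContDiff ℝ 1 φ := hφ.of_le (by exact_mod_cast le_top)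
    obtain ⟨c, hc⟩ := h φ hφ1
    obtain ⟨v, hv⟩ := exists_smoothH1 (Ω := Ω) hΩ.isBounded (φ := fun _ => c) contDiff_const
    have hvc : v ∈ constH1 Ω := ⟨c, hv⟩
    have hg : h1Grad (u - v) = h1Grad u := by
      have h1 : h1Grad (u - v) = h1Grad u - h1Grad v := rfl
      rw [h1, h1Grad_eq_zero_of_mem_constH1 hΩ.isOpen hΩ.isBounded hvc, sub_zero]
    have h2 : h1Class (u - v) = h1Class u :=
      h1Class_eq_iff.2 (by simpa using (constH1 Ω).neg_mem hvc)
    have h3 : ‖h1Fun (u - v)‖ₑ ^ 2 ≤ C * ‖h1Grad u‖ₑ ^ 2 := by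
      rw [enorm_sq_eq_lintegral, enorm_sq_eq_lintegral]
      refine le_trans (le_of_eq ?_) (hc.trans (le_of_eq ?_))
      · refine lintegral_congr_ae ?_
        filter_upwards [Lp.coeFn_sub (h1Fun u) (h1Fun v), hu, hv] with x h4 h5 h6
        have h7 : h1Fun (u - v) x = h1Fun u x - h1Fun v x := h4
        rw [h7, h5, h6]
      · congr 1
        refine lintegral_congr_ae ?_
        filter_upwards [h1Grad_ae_eq_gradE hΩ.isOpen hΩ.isBounded hφ1 hu] with x hx
        rw [hx]
    have h4 : ‖h1Fun (u - v)‖ ^ 2 ≤ C.toReal * ‖h1Grad u‖ ^ 2 := by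
      have := ENNReal.toReal_mono (ENNReal.mul_ne_top hC (by simp)) h3
      simpa using this
    rw [← h2]
    refine (norm_h1Class_le _).trans ?_
    refine le_of_sq_le_sq ?_ (by positivity)
    rw [h1_norm_sq, hg, mul_pow]
    nlinarith [sq_nonneg ‖h1Grad u‖, mul_nonneg hC0 (sq_nonneg ‖h1Grad u‖),
      mul_nonneg (mul_nonneg hC0 hC0) (sq_nonneg ‖h1Grad u‖)]
  · exact isClosed_le (h1ClassL Ω).continuous.norm (continuous_const.mul (h1GradL Ω).continuous.norm)

/-! ### The space `H^{1/2}(∂Ω)` -/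

/-- The underlying function, as a linear map. -/
def h12FunL (Ω : Set (Euc d)) : H12 Ω →L[ℂ] Lp ℂ 2 (surf Ω) where
  toFun := h12Fun
  map_add' _ _ := rfl
  map_smul' _ _ := rfl
  cont := (WithLp.prod_continuous_ofLp 2 _ _).fst.comp continuous_subtype_val

theorem h12_ext {Ω : Set (Euc d)} {g h : H12 Ω} (hgh : h12Fun g = h12Fun h) : g = h := by
  refine Subtype.ext (WithLp.ofLp_injective 2 (Prod.ext hgh (Lp.ext ?_)))
  have h1 := Subtype.prop (p := fun p => p ∈ h12Submodule Ω) g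
  have h2 := Subtype.prop (p := fun p => p ∈ h12Submodule Ω) h
  change ∀ᵐ z ∂((surf Ω).prod (surf Ω)), _ at h1
  change ∀ᵐ z ∂((surf Ω).prod (surf Ω)), _ at h2
  filter_upwards [h1, h2] with z h3 h4
  refine h3.trans (Eq.trans ?_ h4.symm)
  have h5 : (Subtype.val (p := fun p => p ∈ h12Submodule Ω) g).fst
    = (Subtype.val (p := fun p => p ∈ h12Submodule Ω) h).fst := hgh
  rw [h5]

/-- Convergence in `L²` gives almost everywhere convergence along a subsequence. It is extracted
first for the functions and then for the difference quotients, so the pointwise relation passes to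
the limit. -/
theorem isClosed_h12Submodule (Ω : Set (Euc d)) :
    IsClosed (h12Submodule Ω : Set (WithLp 2 (Lp ℂ 2 (surf Ω) ×
      Lp ℂ 2 ((surf Ω).prod (surf Ω))))) := by
  refine IsSeqClosed.isClosed fun p q hp hpq => ?_
  have hc2 := WithLp.prod_continuous_ofLp 2 (Lp ℂ 2 (surf Ω)) (Lp ℂ 2 ((surf Ω).prod (surf Ω)))
  have h1 : Tendsto (fun n => (p n).fst) atTop (𝓝 q.fst) := (hc2.fst.tendsto q).comp hpq
  have h2 : Tendsto (fun n => (p n).snd) atTop (𝓝 q.snd) := (hc2.snd.tendsto q).comp hpq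
  obtain ⟨s, hs, h3⟩ := (tendstoInMeasure_of_tendsto_Lp h1).exists_seq_tendsto_ae
  have h2' := h2.comp hs.tendsto_atTop
  obtain ⟨s', hs', h4⟩ := (tendstoInMeasure_of_tendsto_Lp h2').exists_seq_tendsto_ae
  have h5 : ∀ᵐ z ∂((surf Ω).prod (surf Ω)), ∀ n, (p n).snd z
      = ((‖z.1 - z.2‖ ^ (-(d : ℝ) / 2) : ℝ) : ℂ) * ((p n).fst z.1 - (p n).fst z.2) :=
    ae_all_iff.2 hp
  change ∀ᵐ z ∂((surf Ω).prod (surf Ω)), _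
  filter_upwards [h4, h5, Measure.quasiMeasurePreserving_fst.ae h3,
    Measure.quasiMeasurePreserving_snd.ae h3] with z e1 e2 e3 e4
  have e5 := ((e3.comp hs'.tendsto_atTop).sub (e4.comp hs'.tendsto_atTop)).const_mul
    ((‖z.1 - z.2‖ ^ (-(d : ℝ) / 2) : ℝ) : ℂ)
  refine tendsto_nhds_unique e1 (e5.congr fun n => ?_)
  exact (e2 _).symm

instance (Ω : Set (Euc d)) : CompleteSpace (H12 Ω) :=
  (isClosed_h12Submodule Ω).completeSpace_coe

theorem h12_enorm_sq {Ω : Set (Euc d)} (g : H12 Ω) : ‖g‖ₑ ^ 2 = ‖h12Fun g‖ₑ ^ 2 +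
    ‖(Subtype.val (p := fun p => p ∈ h12Submodule Ω) g).snd‖ₑ ^ 2 := by
  have h := WithLp.prod_norm_sq_eq_of_L2 (Subtype.val (p := fun p => p ∈ h12Submodule Ω) g)
  have h' : ‖g‖ ^ 2 = ‖h12Fun g‖ ^ 2 +
    ‖(Subtype.val (p := fun p => p ∈ h12Submodule Ω) g).snd‖ ^ 2 := h
  simp only [← ofReal_norm]
  rw [← ENNReal.ofReal_pow (norm_nonneg _), ← ENNReal.ofReal_pow (norm_nonneg _),
    ← ENNReal.ofReal_pow (norm_nonneg _), ← ENNReal.ofReal_add (by positivity) (by positivity), h']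

theorem memLp_two_of_lintegral_sq {X E : Type*} [MeasurableSpace X] {μ : Measure X}
    [NormedAddCommGroup E] {f : X → E} (hf : AEStronglyMeasurable f μ)
    (h : ∫⁻ x, ‖f x‖ₑ ^ 2 ∂μ < ∞) : MemLp f 2 μ := by
  refine ⟨hf, ?_⟩
  rw [eLpNorm_lt_top_iff_lintegral_rpow_enorm_lt_top (by norm_num) (by simp)]
  simpa using h

/-- Smooth functions have boundary values in `H^{1/2}(∂Ω)`, bounded by the norm in `H¹(Ω)`. -/
theorem IsBoundedLipschitzDomain.exists_h12 {Ω : Set (Euc d)} (hΩ : IsBoundedLipschitzDomain Ω)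
    (hd : 2 ≤ d) : ∃ C : ℝ≥0∞, C ≠ ∞ ∧ ∀ φ : Euc d → ℂ, ContDiff ℝ 1 φ →
      ∃ g : H12 Ω, h12Fun g =ᵐ[surf Ω] φ ∧ ‖g‖ₑ ^ 2 ≤ C * energy Ω φ := by
  obtain ⟨C₁, hC₁, h₁⟩ := hΩ.lintegral_surf_le hd
  obtain ⟨C₂, hC₂, h₂⟩ := hΩ.lintegral_gagliardo_le hd
  refine ⟨C₁ + C₂, ENNReal.add_ne_top.2 ⟨hC₁, hC₂⟩, fun φ hφ => ?_⟩
  have hen : energy Ω φ < ∞ := by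
    obtain ⟨u, hu⟩ := exists_smoothH1 hΩ.isBounded hφ
    rw [energy_eq hΩ.isOpen hΩ.isBounded hφ hu]
    exact ENNReal.pow_lt_top enorm_lt_top
  set k : Euc d × Euc d → ℂ := fun z =>
    ((‖z.1 - z.2‖ ^ (-(d : ℝ) / 2) : ℝ) : ℂ) * (φ z.1 - φ z.2) with hk
  have hkm : Measurable k := by
    have h1 : Measurable fun z : Euc d × Euc d => ‖z.1 - z.2‖ ^ (-(d : ℝ) / 2) := by fun_prop
    have h2 : Measurable fun z : Euc d × Euc d => φ z.1 - φ z.2 :=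
      ((hφ.continuous.comp continuous_fst).sub (hφ.continuous.comp continuous_snd)).measurable
    exact (Complex.measurable_ofReal.comp h1).mul h2
  have hkn : ∀ z, ‖k z‖ₑ ^ 2
      = ENNReal.ofReal (‖z.1 - z.2‖ ^ (-(d : ℝ))) * ‖φ z.1 - φ z.2‖ₑ ^ 2 := by
    intro z
    have h0 : 0 ≤ ‖z.1 - z.2‖ ^ (-(d : ℝ) / 2) := Real.rpow_nonneg (norm_nonneg _) _
    rw [hk, enorm_mul, mul_pow, ← ofReal_norm, Complex.norm_real, Real.norm_of_nonneg h0,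
      ← ENNReal.ofReal_pow h0, ← Real.rpow_natCast, ← Real.rpow_mul (norm_nonneg _)]
    congr 3
    push_cast
    ring
  have hφ2 : MemLp φ 2 (surf Ω) := memLp_two_of_lintegral_sq hφ.continuous.aestronglyMeasurable
    ((h₁ φ hφ).trans_lt (ENNReal.mul_lt_top hC₁.lt_top hen))
  have hk2' : ∫⁻ z, ‖k z‖ₑ ^ 2 ∂((surf Ω).prod (surf Ω)) ≤ C₂ * energy Ω φ := by
    simp_rw [hkn]
    exact h₂ φ hφ
  have hk2 : MemLp k 2 ((surf Ω).prod (surf Ω)) := memLp_two_of_lintegral_sq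
    hkm.aestronglyMeasurable (hk2'.trans_lt (ENNReal.mul_lt_top hC₂.lt_top hen))
  have hmem : WithLp.toLp 2 (hφ2.toLp φ, hk2.toLp k) ∈ h12Submodule Ω := by
    change ∀ᵐ z ∂((surf Ω).prod (surf Ω)), _
    filter_upwards [hk2.coeFn_toLp, Measure.quasiMeasurePreserving_fst.ae hφ2.coeFn_toLp,
      Measure.quasiMeasurePreserving_snd.ae hφ2.coeFn_toLp] with z e1 e2 e3
    change hk2.toLp k z = _ * (hφ2.toLp φ z.1 - hφ2.toLp φ z.2)
    rw [e1, e2, e3]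
  let g : H12 Ω := ⟨_, hmem⟩
  refine ⟨g, hφ2.coeFn_toLp, ?_⟩
  rw [h12_enorm_sq, enorm_sq_eq_lintegral, enorm_sq_eq_lintegral, add_mul]
  refine add_le_add (le_trans (le_of_eq ?_) (h₁ φ hφ)) (le_trans (le_of_eq ?_) hk2')
  · refine lintegral_congr_ae ?_
    filter_upwards [hφ2.coeFn_toLp] with x hx
    exact congrArg (fun y => ‖y‖ₑ ^ 2) hx
  · refine lintegral_congr_ae ?_
    filter_upwards [hk2.coeFn_toLp] with x hx
    exact congrArg (fun y => ‖y‖ₑ ^ 2) hx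

/-! ### The trace -/

theorem energy_sub_eq_zero {Ω : Set (Euc d)} (hΩ : IsOpen Ω) (hb : Bornology.IsBounded Ω)
    {φ ψ : Euc d → ℂ} (hφ : ContDiff ℝ 1 φ) (hψ : ContDiff ℝ 1 ψ)
    (h : φ =ᵐ[volume.restrict Ω] ψ) : energy Ω (φ - ψ) = 0 := by
  rw [energy_eq (φ := φ - ψ) hΩ hb (hφ.sub hψ) (u := 0)]
  · simp
  · refine (Lp.coeFn_zero ℂ 2 (volume.restrict Ω)).trans ?_
    filter_upwards [h] with x hx
    simp [hx]

/-- The boundary value must not depend on the smooth representative: two of them agree almost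
everywhere in `Ω`, so their difference has zero energy, and the `L²` trace estimate makes it vanish
on the boundary. -/
theorem IsBoundedLipschitzDomain.exists_trace_smooth {Ω : Set (Euc d)}
    (hΩ : IsBoundedLipschitzDomain Ω) (hd : 2 ≤ d) :
    ∃ C : ℝ, ∀ u : smoothH1 Ω, ∃ g : H12 Ω, ‖g‖ ≤ C * ‖(u : H1 Ω)‖ ∧
      ∀ φ : Euc d → ℂ, ContDiff ℝ (⊤ : ℕ∞) φ → h1Fun (u : H1 Ω) =ᵐ[volume.restrict Ω] φ →
        h12Fun g =ᵐ[surf Ω] φ := by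
  obtain ⟨C, hC, h⟩ := hΩ.exists_h12 hd
  obtain ⟨C₁, hC₁, h₁⟩ := hΩ.lintegral_surf_le hd
  refine ⟨√C.toReal, fun u => ?_⟩
  obtain ⟨φ₀, hφ₀, hu⟩ := u.2
  have hφ₀1 : ContDiff ℝ 1 φ₀ := hφ₀.of_le (by exact_mod_cast le_top)
  obtain ⟨g, hg, hgn⟩ := h φ₀ hφ₀1
  refine ⟨g, ?_, fun φ hφ huφ => ?_⟩
  · rw [energy_eq hΩ.isOpen hΩ.isBounded hφ₀1 hu] at hgn
    have h2 := ENNReal.toReal_mono (ENNReal.mul_ne_top hC (by simp)) hgn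
    have h3 : ‖g‖ ^ 2 ≤ C.toReal * ‖(u : H1 Ω)‖ ^ 2 := by simpa using h2
    refine le_of_sq_le_sq ?_ (by positivity)
    rwa [mul_pow, Real.sq_sqrt ENNReal.toReal_nonneg]
  · have hφ1 : ContDiff ℝ 1 φ := hφ.of_le (by exact_mod_cast le_top)
    refine hg.trans ?_
    have h2 := h₁ (φ₀ - φ) (hφ₀1.sub hφ1)
    rw [energy_sub_eq_zero hΩ.isOpen hΩ.isBounded hφ₀1 hφ1 (hu.symm.trans huφ), mul_zero] at h2
    have h3 := (lintegral_eq_zero_iff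
      ((hφ₀1.sub hφ1).continuous.measurable.enorm.pow_const 2)).1 (le_antisymm h2 zero_le)
    filter_upwards [h3] with x hx
    have h4 : ‖φ₀ x - φ x‖ₑ ^ 2 = 0 := hx
    simpa [sub_eq_zero] using h4

/-- Independence of the representative makes the boundary value linear on smooth functions; density
gives both the bounded extension and its uniqueness. -/
theorem IsBoundedLipschitzDomain.existsUnique_isTrace {Ω : Set (Euc d)}
    (hΩ : IsBoundedLipschitzDomain Ω) (hd : 2 ≤ d) :
    ∃! T : H1 Ω →L[ℂ] H12 Ω, IsTrace Ω T := by
  obtain ⟨C, h⟩ := hΩ.exists_trace_smooth hd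
  choose g hgn hg using h
  have hadd : ∀ u v, g (u + v) = g u + g v := by
    intro u v
    obtain ⟨φ, hφ, hu⟩ := u.2
    obtain ⟨ψ, hψ, hv⟩ := v.2
    refine h12_ext (Lp.ext ?_)
    have h1 := hg (u + v) (φ + ψ) (hφ.add hψ)
      ((Lp.coeFn_add (h1Fun (u : H1 Ω)) (h1Fun (v : H1 Ω))).trans (hu.add hv))
    exact h1.trans ((Lp.coeFn_add (h12Fun (g u)) (h12Fun (g v))).trans
      ((hg u φ hφ hu).add (hg v ψ hψ hv))).symm
  have hsmul : ∀ (c : ℂ) u, g (c • u) = c • g u := by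
    intro c u
    obtain ⟨φ, hφ, hu⟩ := u.2
    refine h12_ext (Lp.ext ?_)
    have h1 := hg (c • u) (c • φ) (contDiff_const.smul hφ)
      ((Lp.coeFn_smul c (h1Fun (u : H1 Ω))).trans (hu.const_smul c))
    exact h1.trans ((Lp.coeFn_smul c (h12Fun (g u))).trans ((hg u φ hφ hu).const_smul c)).symm
  let T₀ : smoothH1 Ω →ₗ[ℂ] H12 Ω := ⟨⟨g, hadd⟩, hsmul⟩
  have hdense : DenseRange (smoothH1 Ω).subtype := by
    rw [DenseRange, Submodule.coe_subtype, Subtype.range_coe]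
    exact hΩ.dense_smoothH1
  have hT : ∀ u : smoothH1 Ω, T₀.extendOfNorm (smoothH1 Ω).subtype (u : H1 Ω) = g u := fun u =>
    LinearMap.extendOfNorm_eq (f := T₀) (e := (smoothH1 Ω).subtype) hdense ⟨C, hgn⟩ u
  have hTr : IsTrace Ω (T₀.extendOfNorm (smoothH1 Ω).subtype) := by
    intro φ hφ u hu
    rw [hT ⟨u, φ, hφ, hu⟩]
    exact hg _ φ hφ hu
  refine ⟨_, hTr, fun T' hT' => ?_⟩
  refine ContinuousLinearMap.coeFn_injective
    (Continuous.ext_on hΩ.dense_smoothH1 T'.continuous (ContinuousLinearMap.continuous _) ?_)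
  rintro u ⟨φ, hφ, hu⟩
  refine h12_ext (Lp.ext ?_)
  have h1 : h12Fun (T' u) =ᵐ[surf Ω] φ := hT' φ hφ u hu
  exact h1.trans (EventuallyEq.symm (hTr φ hφ u hu))

theorem IsBoundedLipschitzDomain.isTrace_trace {Ω : Set (Euc d)}
    (hΩ : IsBoundedLipschitzDomain Ω) (hd : 2 ≤ d) : IsTrace Ω (trace Ω) := by
  have h : ∃ T, IsTrace Ω T := (hΩ.existsUnique_isTrace hd).exists
  rw [trace, dif_pos h]
  exact h.choose_spec

theorem IsBoundedLipschitzDomain.trace_mem_constH12 {Ω : Set (Euc d)}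
    (hΩ : IsBoundedLipschitzDomain Ω) (hd : 2 ≤ d) {u : H1 Ω} (hu : u ∈ constH1 Ω) :
    trace Ω u ∈ constH12 Ω := by
  obtain ⟨c, hc⟩ := hu
  exact ⟨c, hΩ.isTrace_trace hd (fun _ => c) contDiff_const u hc⟩

/-! ### The mean-free trace -/

theorem isClosed_h12mSubmodule (Ω : Set (Euc d)) : IsClosed (h12mSubmodule Ω : Set (H12 Ω)) :=
  (Submodule.isClosed_orthogonal (constL2 (surf Ω))).preimage (h12FunL Ω).continuous

instance (Ω : Set (Euc d)) : CompleteSpace (H12m Ω) :=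
  (isClosed_h12mSubmodule Ω).completeSpace_coe

/-- A mean-free constant is orthogonal to itself. This is what makes mean-free representatives
unique. -/
theorem eq_zero_of_h12mIncl_mem {Ω : Set (Euc d)} {g : H12m Ω}
    (hg : h12mIncl g ∈ constH12 Ω) : g = 0 := by
  have h1 : h12Fun (h12mIncl g) ∈ (constL2 (surf Ω))ᗮ :=
    Subtype.prop (p := fun p => p ∈ h12mSubmodule Ω) g
  have h2 : h12Fun (h12mIncl g) = 0 := inner_self_eq_zero.1 (h1 _ hg)
  exact Subtype.ext (h12_ext h2)

/-- Constants are smooth, so they have boundary values in `H12 Ω`. Removing the mean therefore does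
not leave this space. -/
theorem IsBoundedLipschitzDomain.exists_h12Fun_eq {Ω : Set (Euc d)}
    (hΩ : IsBoundedLipschitzDomain Ω) (hd : 2 ≤ d) {f : Lp ℂ 2 (surf Ω)}
    (hf : f ∈ constL2 (surf Ω)) : ∃ g : constH12 Ω, h12Fun (g : H12 Ω) = f := by
  obtain ⟨C, -, h⟩ := hΩ.exists_h12 hd
  obtain ⟨c, hc⟩ := hf
  obtain ⟨g, hg, -⟩ := h (fun _ => c) contDiff_const
  exact ⟨⟨g, c, hg⟩, Lp.ext (hg.trans (EventuallyEq.symm hc))⟩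

/-- The projection of `H^{1/2}(∂Ω)` onto the mean-free functions. -/
theorem IsBoundedLipschitzDomain.exists_meanFree {Ω : Set (Euc d)}
    (hΩ : IsBoundedLipschitzDomain Ω) (hd : 2 ≤ d) :
    ∃ M : H12 Ω →L[ℂ] H12m Ω, ∀ g, g - h12mIncl (M g) ∈ constH12 Ω := by
  have : CompleteSpace (constL2 (surf Ω)) := (isClosed_constL2 (surf Ω)).completeSpace_coe
  have : FiniteDimensional ℂ (constL2 (surf Ω)) := by
    obtain ⟨g, hg⟩ := constL2_le_span (surf Ω)
    exact Submodule.finiteDimensional_of_le hg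
  let J : constH12 Ω →ₗ[ℂ] constL2 (surf Ω) :=
    { toFun := fun g => ⟨h12Fun (g : H12 Ω), g.2⟩
      map_add' := fun _ _ => rfl
      map_smul' := fun _ _ => rfl }
  have hJ : Function.Bijective J := by
    refine ⟨fun g h hgh => Subtype.ext (h12_ext (congrArg Subtype.val hgh)), fun f => ?_⟩
    obtain ⟨g, hg⟩ := hΩ.exists_h12Fun_eq hd f.2
    exact ⟨g, Subtype.ext hg⟩
  -- The lift is continuous into the stronger norm because its domain is finite-dimensional.
  let I : constL2 (surf Ω) →L[ℂ] H12 Ω :=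
    LinearMap.toContinuousLinearMap ((constH12 Ω).subtype ∘ₗ
      (LinearEquiv.ofBijective J hJ).symm.toLinearMap)
  have hI : ∀ f, I f ∈ constH12 Ω := fun f => ((LinearEquiv.ofBijective J hJ).symm f).2
  have hI' : ∀ f, h12Fun (I f) = f := fun f =>
    congrArg Subtype.val ((LinearEquiv.ofBijective J hJ).apply_symm_apply f)
  let Q : H12 Ω →L[ℂ] H12 Ω := ContinuousLinearMap.id ℂ (H12 Ω) -
    I ∘L (constL2 (surf Ω)).orthogonalProjectionOnto ∘L h12FunL Ω
  have hQ : ∀ g, Q g ∈ h12mSubmodule Ω := by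
    intro g
    have h1 : h12Fun (Q g) = h12Fun g -
        h12Fun (I ((constL2 (surf Ω)).orthogonalProjectionOnto (h12Fun g))) := rfl
    change h12Fun (Q g) ∈ (constL2 (surf Ω))ᗮ
    rw [h1, hI']
    exact Submodule.sub_starProjection_mem_orthogonal _
  let M : H12 Ω →L[ℂ] H12m Ω := Q.codRestrict (h12mSubmodule Ω) hQ
  refine ⟨M, fun g => ?_⟩
  have h1 : g - h12mIncl (M g)
      = I ((constL2 (surf Ω)).orthogonalProjectionOnto (h12Fun g)) := by
    change g - (g - I ((constL2 (surf Ω)).orthogonalProjectionOnto (h12Fun g))) = _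
    rw [sub_sub_cancel]
  rw [h1]
  exact hI _

/-- The trace of a constant is a constant, so the mean-free part of the trace descends to the
quotient. -/
theorem IsBoundedLipschitzDomain.existsUnique_isMeanFreeTrace {Ω : Set (Euc d)}
    (hΩ : IsBoundedLipschitzDomain Ω) (hd : 2 ≤ d) :
    ∃! T : H1C Ω →L[ℂ] H12m Ω, IsMeanFreeTrace Ω T := by
  obtain ⟨M, hM⟩ := hΩ.exists_meanFree hd
  have hker : constH1 Ω ≤ LinearMap.ker (M ∘L trace Ω).toLinearMap := by
    intro u hu
    refine eq_zero_of_h12mIncl_mem ?_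
    have := (constH12 Ω).sub_mem (hΩ.trace_mem_constH12 hd hu) (hM (trace Ω u))
    rwa [sub_sub_cancel] at this
  refine ⟨(constH1 Ω).liftQL (M ∘L trace Ω) hker, fun v => hM (trace Ω v), fun T hT => ?_⟩
  refine ContinuousLinearMap.ext fun x => ?_
  obtain ⟨v, rfl⟩ := h1Class_surjective x
  rw [← sub_eq_zero]
  refine eq_zero_of_h12mIncl_mem ?_
  have := (constH12 Ω).sub_mem (hM (trace Ω v)) (hT v)
  rwa [sub_sub_sub_cancel_left] at this

theorem IsBoundedLipschitzDomain.isMeanFreeTrace_tr {Ω : Set (Euc d)}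
    (hΩ : IsBoundedLipschitzDomain Ω) (hd : 2 ≤ d) : IsMeanFreeTrace Ω (tr Ω) := by
  have h : ∃ T, IsMeanFreeTrace Ω T := (hΩ.existsUnique_isMeanFreeTrace hd).exists
  rw [tr, dif_pos h]
  exact h.choose_spec

/-! ### Multiplication operators and the sesquilinear form -/

theorem ae_abs_le_norm {Ω : Set (Euc d)} (s : LInf Ω) :
    ∀ᵐ x ∂(volume.restrict Ω), |s x| ≤ ‖s‖ := by
  have h := ae_le_eLpNormEssSup (f := s) (μ := volume.restrict Ω)
  filter_upwards [h] with x hx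
  rw [← eLpNorm_exponent_top] at hx
  have h2 := ENNReal.toReal_mono (Lp.eLpNorm_ne_top s) hx
  simpa [Lp.norm_def] using h2

theorem isOpen_lInfPos (Ω : Set (Euc d)) : IsOpen (LInfPos Ω) := by
  refine Metric.isOpen_iff.2 ?_
  rintro σ ⟨c, hc, hσ⟩
  refine ⟨c / 2, by positivity, fun τ hτ => ⟨c / 2, by positivity, ?_⟩⟩
  rw [Metric.mem_ball, dist_eq_norm] at hτ
  filter_upwards [hσ, ae_abs_le_norm (τ - σ), Lp.coeFn_sub τ σ] with x h1 h2 h3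
  rw [h3, Pi.sub_apply] at h2
  have := (abs_le.1 h2).1
  linarith

/-- The space of square integrable vector fields on `Ω`. -/
abbrev VecL2 (Ω : Set (Euc d)) : Type :=
  Lp (EuclideanSpace ℂ (Fin d)) 2 (volume.restrict Ω)

theorem coeFn_lInf_smul {Ω : Set (Euc d)} (s : LInf Ω) (g : VecL2 Ω) :
    ((s • g : VecL2 Ω) : Euc d → EuclideanSpace ℂ (Fin d)) =ᵐ[volume.restrict Ω]
      fun x => s x • g x := Lp.coeFn_lpSMul s g

theorem norm_lInf_smul_le {Ω : Set (Euc d)} (s : LInf Ω) (g : VecL2 Ω) :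
    ‖(s • g : VecL2 Ω)‖ ≤ ‖s‖ * ‖g‖ := Lp.norm_smul_le s g

/-- Multiplication by a bounded function. -/
def mulCLM {Ω : Set (Euc d)} (s : LInf Ω) : VecL2 Ω →L[ℂ] VecL2 Ω :=
  LinearMap.mkContinuous
    { toFun := fun g => (s • g : VecL2 Ω)
      map_add' := fun g h => by
        refine Lp.ext ?_
        filter_upwards [coeFn_lInf_smul s (g + h), coeFn_lInf_smul s g, coeFn_lInf_smul s h,
          Lp.coeFn_add g h, Lp.coeFn_add (s • g : VecL2 Ω) (s • h)] with x h1 h2 h3 h4 h5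
        rw [h1, h5, Pi.add_apply, h2, h3, h4, Pi.add_apply, smul_add]
      map_smul' := fun c g => by
        refine Lp.ext ?_
        filter_upwards [coeFn_lInf_smul s (c • g), coeFn_lInf_smul s g,
          Lp.coeFn_smul c g, Lp.coeFn_smul c (s • g : VecL2 Ω)] with x h1 h2 h4 h5
        rw [RingHom.id_apply, h1, h5, Pi.smul_apply, h2, h4, Pi.smul_apply, smul_comm] }
    ‖s‖ (norm_lInf_smul_le s)

theorem coeFn_mulCLM {Ω : Set (Euc d)} (s : LInf Ω) (g : VecL2 Ω) :
    (mulCLM s g : Euc d → EuclideanSpace ℂ (Fin d)) =ᵐ[volume.restrict Ω] fun x => s x • g x :=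
  coeFn_lInf_smul s g

theorem mulCLM_add {Ω : Set (Euc d)} (s t : LInf Ω) : mulCLM (s + t) = mulCLM s + mulCLM t := by
  refine ContinuousLinearMap.ext fun g => Lp.ext ?_
  filter_upwards [coeFn_mulCLM (s + t) g, coeFn_mulCLM s g, coeFn_mulCLM t g,
    Lp.coeFn_add s t, Lp.coeFn_add (mulCLM s g) (mulCLM t g)] with x h1 h2 h3 h4 h5
  rw [h1, add_apply, h5, Pi.add_apply, h2, h3, h4, Pi.add_apply, add_smul]

theorem mulCLM_smul {Ω : Set (Euc d)} (c : ℝ) (s : LInf Ω) : mulCLM (c • s) = c • mulCLM s := by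
  refine ContinuousLinearMap.ext fun g => Lp.ext ?_
  filter_upwards [coeFn_mulCLM (c • s) g, coeFn_mulCLM s g,
    Lp.coeFn_smul c s, Lp.coeFn_smul c (mulCLM s g)] with x h1 h2 h4 h5
  rw [h1, smul_apply, h5, Pi.smul_apply, h2, h4, Pi.smul_apply, smul_assoc]

/-- The linear dependence of the multiplication operator on the factor. -/
def mulOp {Ω : Set (Euc d)} : LInf Ω →L[ℝ] (VecL2 Ω →L[ℂ] VecL2 Ω) :=
  LinearMap.mkContinuous ⟨⟨mulCLM, mulCLM_add⟩, mulCLM_smul⟩ 1 fun s =>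
    (ContinuousLinearMap.opNorm_le_bound (mulCLM s) (norm_nonneg s)
      (norm_lInf_smul_le s)).trans_eq (one_mul _).symm

theorem coeFn_mulOp {Ω : Set (Euc d)} (s : LInf Ω) (g : VecL2 Ω) :
    (mulOp s g : Euc d → EuclideanSpace ℂ (Fin d)) =ᵐ[volume.restrict Ω] fun x => s x • g x :=
  coeFn_mulCLM s g

theorem form_eq_inner {Ω : Set (Euc d)} (s : LInf Ω) (u v : H1 Ω) :
    form s u v = inner ℂ (h1Grad v) (mulOp s (h1Grad u)) := by
  rw [form, L2.inner_def]
  refine integral_congr_ae ?_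
  filter_upwards [coeFn_mulOp s (h1Grad u)] with x hx
  rw [hx, ← Complex.coe_smul, inner_smul_right]

/-- As `s` is real, the pairing is the real integral of `s * ‖g‖ ^ 2`, and the lower bound on `s`
gives coercivity. -/
theorem le_norm_inner_mulOp {Ω : Set (Euc d)} {s : LInf Ω} {c : ℝ}
    (hs : ∀ᵐ x ∂(volume.restrict Ω), c ≤ s x) (g : VecL2 Ω) :
    c * ‖g‖ ^ 2 ≤ ‖inner ℂ g (mulOp s g)‖ := by
  have h1 : inner ℂ g (mulOp s g) = ((∫ x in Ω, s x * ‖g x‖ ^ 2 : ℝ) : ℂ) := by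
    rw [L2.inner_def, ← integral_complex_ofReal]
    refine integral_congr_ae ?_
    filter_upwards [coeFn_mulOp s g] with x hx
    rw [hx, ← Complex.coe_smul, inner_smul_right, inner_self_eq_norm_sq_to_K]
    push_cast
    rfl
  have h2 : ‖g‖ ^ 2 = ∫ x in Ω, ‖g x‖ ^ 2 := by
    have h3 : ((‖g‖ ^ 2 : ℝ) : ℂ) = inner ℂ g g := by
      rw [inner_self_eq_norm_sq_to_K]; push_cast; rfl
    have h4 : inner ℂ g g = ((∫ x in Ω, ‖g x‖ ^ 2 : ℝ) : ℂ) := by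
      rw [L2.inner_def, ← integral_complex_ofReal]
      refine integral_congr_ae (Eventually.of_forall fun x => ?_)
      simp only
      rw [inner_self_eq_norm_sq_to_K]
      push_cast
      rfl
    exact_mod_cast h3.trans h4
  have i1 : Integrable (fun x => ‖g x‖ ^ 2) (volume.restrict Ω) := (Lp.memLp g).integrable_norm_pow
    two_ne_zero
  have i2 : Integrable (fun x => s x * ‖g x‖ ^ 2) (volume.restrict Ω) :=
    i1.bdd_mul (Lp.aestronglyMeasurable s) (ae_abs_le_norm s)
  rw [h1, Complex.norm_real, h2, ← integral_const_mul]
  refine le_trans (integral_mono_ae (i1.const_mul c) i2 ?_) (le_abs_self _)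
  filter_upwards [hs] with x hx
  exact mul_le_mul_of_nonneg_right hx (by positivity)

/-! ### Coercive problems in Hilbert spaces -/

section Coercive

variable {X H : Type*} [NormedAddCommGroup X] [NormedSpace ℂ X] [NormedAddCommGroup H]
  [InnerProductSpace ℂ H]

theorem eq_zero_of_coercive {D : X →L[ℂ] H} {K : ℝ} (hD : ∀ x, ‖x‖ ≤ K * ‖D x‖) {M : H →L[ℂ] H}
    {c : ℝ} (hc : 0 < c) (hM : ∀ g, c * ‖g‖ ^ 2 ≤ ‖inner ℂ g (M g)‖) {w : X}
    (hw : ∀ x, inner ℂ (D x) (M (D w)) = 0) : w = 0 := by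
  have h1 := hM (D w)
  rw [hw w, norm_zero] at h1
  have h2 : ‖D w‖ ^ 2 ≤ 0 := by nlinarith
  have h3 : ‖D w‖ = 0 := by nlinarith [norm_nonneg (D w)]
  have h4 := hD w
  rw [h3, mul_zero] at h4
  exact norm_le_zero_iff.1 h4

variable [CompleteSpace X] [CompleteSpace H]

/-- An operator that is bounded below is an isomorphism onto its closed range. This moves problems
on `X`, which carries no inner product, to a Hilbert space. -/
theorem exists_equiv_range (D : X →L[ℂ] H) {K : ℝ} (hD : ∀ x, ‖x‖ ≤ K * ‖D x‖) :
    ∃ R : Submodule ℂ H, IsClosed (R : Set H) ∧ ∃ E : X ≃L[ℂ] R, ∀ x, (E x : H) = D x := by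
  have hanti : AntilipschitzWith K.toNNReal D := by
    refine D.antilipschitz_of_bound fun x => (hD x).trans ?_
    exact mul_le_mul_of_nonneg_right (Real.le_coe_toNNReal K) (norm_nonneg _)
  have hcl : IsClosed (range D) := hanti.isClosed_range D.uniformContinuous
  exact ⟨D.range, hcl, D.equivRange hanti.injective hcl, fun _ => rfl⟩

/-- The solution operator of a coercive problem. -/
theorem exists_solution_operator (D : X →L[ℂ] H) {K : ℝ} (hD : ∀ x, ‖x‖ ≤ K * ‖D x‖)
    (M : H →L[ℂ] H) {c : ℝ} (hc : 0 < c) (hM : ∀ g, c * ‖g‖ ^ 2 ≤ ‖inner ℂ g (M g)‖) :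
    ∃ W : H →L[ℂ] X, ∀ g x, inner ℂ (D x) (M (D (W g))) = inner ℂ (D x) g := by
  obtain ⟨R, hR, E, hE⟩ := exists_equiv_range D hD
  have : CompleteSpace R := hR.completeSpace_coe
  -- The compression of `M` to the range inherits coercivity, so it is invertible, as in the
  -- Lax–Milgram theorem.
  let A : R →L[ℂ] R := R.orthogonalProjectionOnto ∘L M ∘L R.subtypeL
  have hproj : ∀ (x : R) (g : H), inner ℂ x (R.orthogonalProjectionOnto g) = inner ℂ (x : H) g :=
    fun x g => Submodule.inner_orthogonalProjectionOnto_eq_of_mem_left x g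
  have hA : IsUnit A := by
    refine ContinuousLinearMap.isUnit_of_forall_le_norm_inner_map A (c := ⟨c, hc.le⟩) hc fun x => ?_
    rw [norm_inner_symm]
    have h1 : inner ℂ x (A x) = inner ℂ (x : H) (M x) := hproj x (M x)
    rw [h1, mul_comm]
    exact hM x
  refine ⟨E.symm.toContinuousLinearMap ∘L (Ring.inverse A) ∘L R.orthogonalProjectionOnto,
    fun g x => ?_⟩
  set y : R := Ring.inverse A (R.orthogonalProjectionOnto g) with hy
  have h1 : A y = R.orthogonalProjectionOnto g := by
    have := congrArg (fun T : R →L[ℂ] R => T (R.orthogonalProjectionOnto g))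
      (Ring.mul_inverse_cancel A hA)
    exact this
  have h2 : D (E.symm y) = y := by rw [← hE, E.apply_symm_apply]
  change inner ℂ (D x) (M (D (E.symm y))) = _
  rw [h2, ← hE, ← hproj (E x) g, ← h1]
  exact (hproj (E x) (M y)).symm

/-- The Riesz representation of a family of conjugate-linear functionals. -/
theorem exists_riesz {Y : Type*} [NormedAddCommGroup Y] [NormedSpace ℂ Y] (D : X →L[ℂ] H) {K : ℝ}
    (hD : ∀ x, ‖x‖ ≤ K * ‖D x‖) (L : Y →ₗ[ℂ] (X →L⋆[ℂ] ℂ)) {C : ℝ} (hL : ∀ f, ‖L f‖ ≤ C * ‖f‖) :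
    ∃ F : Y →L[ℂ] H, ∀ f x, inner ℂ (D x) (F f) = L f x := by
  obtain ⟨R, hR, E, hE⟩ := exists_equiv_range D hD
  have : CompleteSpace R := hR.completeSpace_coe
  have hex : ∀ f, ∃ y : R, ∀ x, inner ℂ (E x) y = L f x := by
    intro f
    -- The Riesz theorem is stated for linear functionals, so the functional is conjugated; the
    -- representative then depends linearly on `f`.
    let l : R →L[ℂ] ℂ := ((starL ℂ : ℂ ≃L⋆[ℂ] ℂ) : ℂ →L⋆[ℂ] ℂ).comp
      ((L f).comp E.symm.toContinuousLinearMap)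
    refine ⟨(InnerProductSpace.toDual ℂ R).symm l, fun x => ?_⟩
    rw [← inner_conj_symm, InnerProductSpace.toDual_symm_apply]
    simp [l]
  choose y hy using hex
  have huniq : ∀ a b : R, (∀ x, inner ℂ (E x) a = inner ℂ (E x) b) → a = b := by
    intro a b h
    refine ext_inner_left ℂ fun z => ?_
    have := h (E.symm z)
    rwa [E.apply_symm_apply] at this
  let F₀ : Y →ₗ[ℂ] R :=
    { toFun := y
      map_add' := fun f g => huniq _ _ fun x => by
        rw [inner_add_right, hy, hy, hy, map_add, add_apply]
      map_smul' := fun a f => huniq _ _ fun x => by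
        rw [RingHom.id_apply, inner_smul_right, hy, hy, map_smul, smul_apply, smul_eq_mul] }
  have hbound : ∀ f, ‖F₀ f‖ ≤ (C * ‖E.symm.toContinuousLinearMap‖) * ‖f‖ := by
    intro f
    have h1 : ‖F₀ f‖ ^ 2 ≤ ‖F₀ f‖ * (C * ‖E.symm.toContinuousLinearMap‖ * ‖f‖) := by
      have h2 := hy f (E.symm (y f))
      rw [E.apply_symm_apply] at h2
      have h3 : ‖F₀ f‖ ^ 2 = ‖L f (E.symm (y f))‖ := by
        rw [← h2, inner_self_eq_norm_sq_to_K]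
        simp [F₀]
      have h4 : ‖E.symm (y f)‖ ≤ ‖E.symm.toContinuousLinearMap‖ * ‖F₀ f‖ :=
        E.symm.toContinuousLinearMap.le_opNorm (y f)
      rw [h3]
      calc ‖L f (E.symm (y f))‖ ≤ ‖L f‖ * ‖E.symm (y f)‖ := (L f).le_opNorm _
        _ ≤ (C * ‖f‖) * (‖E.symm.toContinuousLinearMap‖ * ‖F₀ f‖) :=
          mul_le_mul (hL f) h4 (norm_nonneg _) ((norm_nonneg _).trans (hL f))
        _ = _ := by ring
    rcases (norm_nonneg (F₀ f)).eq_or_lt with h0 | h0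
    · rw [← h0]
      have := (norm_nonneg _).trans (hL f)
      have h5 := mul_nonneg this (norm_nonneg E.symm.toContinuousLinearMap)
      linarith [h5]
    · rw [sq] at h1
      exact le_of_mul_le_mul_left h1 h0
  refine ⟨R.subtypeL ∘L F₀.mkContinuous _ hbound, fun f x => ?_⟩
  rw [← hE, ← hy f x]
  rfl

end Coercive

/-! ### The solution operators -/

theorem gradC_ker {Ω : Set (Euc d)} (hΩ : IsBoundedLipschitzDomain Ω) :
    constH1 Ω ≤ LinearMap.ker (h1GradL Ω).toLinearMap :=
  fun _ hu => h1Grad_eq_zero_of_mem_constH1 hΩ.isOpen hΩ.isBounded hu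

/-- The gradient on `H¹(Ω)/ℂ`. -/
def gradC {Ω : Set (Euc d)} (hΩ : IsBoundedLipschitzDomain Ω) : H1C Ω →L[ℂ] VecL2 Ω :=
  (constH1 Ω).liftQL (h1GradL Ω) (gradC_ker hΩ)

theorem exists_norm_le_gradC {Ω : Set (Euc d)} (hΩ : IsBoundedLipschitzDomain Ω) :
    ∃ K : ℝ, ∀ x, ‖x‖ ≤ K * ‖gradC hΩ x‖ := by
  obtain ⟨K, -, hK⟩ := hΩ.exists_norm_h1Class_le
  refine ⟨K, fun x => ?_⟩
  obtain ⟨u, rfl⟩ := h1Class_surjective x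
  exact hK u

theorem form_eq_inner_gradC {Ω : Set (Euc d)} (hΩ : IsBoundedLipschitzDomain Ω) (s : LInf Ω)
    (u v : H1 Ω) :
    form s u v = inner ℂ (gradC hΩ (h1Class v)) (mulOp s (gradC hΩ (h1Class u))) :=
  form_eq_inner s u v

/-- Testing with the difference itself, coercivity kills its gradient and the Poincaré inequality
its class. All uniqueness statements for the solution operators rest on this. -/
theorem eq_of_inner_gradC_eq {Ω : Set (Euc d)} (hΩ : IsBoundedLipschitzDomain Ω) {σ : LInf Ω}
    (hσ : σ ∈ LInfPos Ω) {w w' : H1C Ω}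
    (h : ∀ x, inner ℂ (gradC hΩ x) (mulOp σ (gradC hΩ w))
      = inner ℂ (gradC hΩ x) (mulOp σ (gradC hΩ w'))) : w = w' := by
  obtain ⟨c, hc, hσ⟩ := hσ
  obtain ⟨K, hK⟩ := exists_norm_le_gradC hΩ
  rw [← sub_eq_zero]
  refine eq_zero_of_coercive hK hc (le_norm_inner_mulOp hσ) fun x => ?_
  rw [map_sub, map_sub, inner_sub_right, h x, sub_self]

/-- The inclusion of the mean-free functions, as a linear map. -/
def h12mInclL (Ω : Set (Euc d)) : H12m Ω →L[ℂ] H12 Ω := (h12mSubmodule Ω).subtypeL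

/-- The functional on `H¹(Ω)/ℂ` given by boundary data. -/
def boundaryFunctional (Ω : Set (Euc d)) : Hneg12m Ω →ₗ[ℂ] (H1C Ω →L⋆[ℂ] ℂ) where
  toFun f := (hneg12Functional (hneg12mIncl f)).comp (h12mInclL Ω ∘L tr Ω)
  map_add' _ _ := rfl
  map_smul' _ _ := rfl

theorem norm_boundaryFunctional_le (Ω : Set (Euc d)) (f : Hneg12m Ω) :
    ‖boundaryFunctional Ω f‖ ≤ ‖h12mInclL Ω ∘L tr Ω‖ * ‖f‖ :=
  (ContinuousLinearMap.opNorm_comp_le _ _).trans_eq (mul_comm _ _)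

/-- The data annihilate constants, so the trace may be replaced by its mean-free part and the
right-hand side lives on `H1C Ω`. -/
theorem pairing_eq_of_sub_mem {Ω : Set (Euc d)} (f : Hneg12m Ω) {g h : H12 Ω}
    (hgh : g - h ∈ constH12 Ω) : pairing (hneg12mIncl f) g = pairing (hneg12mIncl f) h := by
  have h1 : pairing (hneg12mIncl f) (g - h) = 0 :=
    Subtype.prop (p := fun f => f ∈ hneg12mSubmodule Ω) f _ hgh
  have h2 : pairing (hneg12mIncl f) (g - h)
      = pairing (hneg12mIncl f) g - pairing (hneg12mIncl f) h :=
    map_sub (hneg12Functional (hneg12mIncl f)) g h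
  rw [h1] at h2
  exact sub_eq_zero.1 h2.symm

theorem pairing_trace {Ω : Set (Euc d)} (hΩ : IsBoundedLipschitzDomain Ω) (hd : 2 ≤ d)
    (f : Hneg12m Ω) (v : H1 Ω) :
    pairing (hneg12mIncl f) (trace Ω v) = boundaryFunctional Ω f (h1Class v) :=
  pairing_eq_of_sub_mem f (hΩ.isMeanFreeTrace_tr hd v)

theorem isNeumannSolution_iff {Ω : Set (Euc d)} (hΩ : IsBoundedLipschitzDomain Ω) (hd : 2 ≤ d)
    {σ : LInf Ω} {f : Hneg12m Ω} {u : H1 Ω} :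
    IsNeumannSolution σ f u ↔ ∀ x, inner ℂ (gradC hΩ x) (mulOp σ (gradC hΩ (h1Class u)))
      = boundaryFunctional Ω f x := by
  rw [h1Class_surjective.forall]
  refine forall_congr' fun v => ?_
  rw [form_eq_inner_gradC hΩ, pairing_trace hΩ hd]

theorem isNeumannOperator_iff {Ω : Set (Euc d)} (hΩ : IsBoundedLipschitzDomain Ω) (hd : 2 ≤ d)
    {σ : LInf Ω} {N : Hneg12m Ω →L[ℂ] H1C Ω} :
    IsNeumannOperator σ N ↔ ∀ f x, inner ℂ (gradC hΩ x) (mulOp σ (gradC hΩ (N f)))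
      = boundaryFunctional Ω f x := by
  refine forall_congr' fun f => ⟨?_, fun h => ?_⟩
  · rintro ⟨u, hu, hs⟩
    rw [← hu]
    exact (isNeumannSolution_iff hΩ hd).1 hs
  · obtain ⟨u, hu⟩ := h1Class_surjective (N f)
    refine ⟨u, hu, (isNeumannSolution_iff hΩ hd).2 ?_⟩
    rwa [hu]

theorem isPerturbOperator_iff {Ω : Set (Euc d)} (hΩ : IsBoundedLipschitzDomain Ω)
    {σ η : LInf Ω} {P : H1C Ω →L[ℂ] H1C Ω} :
    IsPerturbOperator σ η P ↔ ∀ y x, inner ℂ (gradC hΩ x) (mulOp σ (gradC hΩ (P y)))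
      = - inner ℂ (gradC hΩ x) (mulOp η (gradC hΩ y)) := by
  rw [h1Class_surjective.forall]
  refine forall_congr' fun u => ?_
  rw [h1Class_surjective.forall]
  constructor
  · rintro ⟨w, hw, h⟩ v
    rw [← hw, ← form_eq_inner_gradC, ← form_eq_inner_gradC, h v]
  · intro h
    obtain ⟨w, hw⟩ := h1Class_surjective (P (h1Class u))
    refine ⟨w, hw, fun v => ?_⟩
    rw [form_eq_inner_gradC hΩ, form_eq_inner_gradC hΩ, hw, h v]

theorem exists_solver {Ω : Set (Euc d)} (hΩ : IsBoundedLipschitzDomain Ω) {σ : LInf Ω}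
    (hσ : σ ∈ LInfPos Ω) : ∃ W : VecL2 Ω →L[ℂ] H1C Ω, ∀ g x,
      inner ℂ (gradC hΩ x) (mulOp σ (gradC hΩ (W g))) = inner ℂ (gradC hΩ x) g := by
  obtain ⟨c, hc, hσ⟩ := hσ
  obtain ⟨K, hK⟩ := exists_norm_le_gradC hΩ
  exact exists_solution_operator (gradC hΩ) hK (mulOp σ) hc (le_norm_inner_mulOp hσ)

theorem existsUnique_isNeumannOperator {Ω : Set (Euc d)} (hΩ : IsBoundedLipschitzDomain Ω)
    (hd : 2 ≤ d) {σ : LInf Ω} (hσ : σ ∈ LInfPos Ω) :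
    ∃! N : Hneg12m Ω →L[ℂ] H1C Ω, IsNeumannOperator σ N := by
  obtain ⟨W, hW⟩ := exists_solver hΩ hσ
  obtain ⟨K, hK⟩ := exists_norm_le_gradC hΩ
  obtain ⟨F, hF⟩ := exists_riesz (gradC hΩ) hK (boundaryFunctional Ω) (norm_boundaryFunctional_le Ω)
  have hN : IsNeumannOperator σ (W ∘L F) := (isNeumannOperator_iff hΩ hd).2 fun f x => by
    rw [ContinuousLinearMap.comp_apply, hW, hF]
  refine ⟨_, hN, fun N' hN' => ContinuousLinearMap.ext fun f =>
    eq_of_inner_gradC_eq hΩ hσ fun x => ?_⟩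
  rw [(isNeumannOperator_iff hΩ hd).1 hN, (isNeumannOperator_iff hΩ hd).1 hN']

theorem inner_neumannOp {Ω : Set (Euc d)} (hΩ : IsBoundedLipschitzDomain Ω) (hd : 2 ≤ d)
    {σ : LInf Ω} (hσ : σ ∈ LInfPos Ω) (f : Hneg12m Ω) (x : H1C Ω) :
    inner ℂ (gradC hΩ x) (mulOp σ (gradC hΩ (neumannOp σ f))) = boundaryFunctional Ω f x := by
  have h : ∃ N, IsNeumannOperator σ N := (existsUnique_isNeumannOperator hΩ hd hσ).exists
  rw [neumannOp, dif_pos h]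
  exact (isNeumannOperator_iff hΩ hd).1 h.choose_spec f x

/-- The perturbation operator depends linearly and boundedly on the perturbation. -/
theorem exists_isPerturbOperator {Ω : Set (Euc d)} (hΩ : IsBoundedLipschitzDomain Ω)
    {σ : LInf Ω} (hσ : σ ∈ LInfPos Ω) :
    ∃ B : LInf Ω →L[ℝ] (H1C Ω →L[ℂ] H1C Ω), ∀ η, IsPerturbOperator σ η (B η) := by
  obtain ⟨W, hW⟩ := exists_solver hΩ hσ
  let B₁ : (VecL2 Ω →L[ℂ] VecL2 Ω) →L[ℂ] (H1C Ω →L[ℂ] VecL2 Ω) :=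
    (ContinuousLinearMap.compL ℂ (H1C Ω) (VecL2 Ω) (VecL2 Ω)).flip (gradC hΩ)
  let B₂ : (H1C Ω →L[ℂ] VecL2 Ω) →L[ℂ] (H1C Ω →L[ℂ] H1C Ω) :=
    ContinuousLinearMap.compL ℂ (H1C Ω) (VecL2 Ω) (H1C Ω) W
  -- The operator is `η ↦ -W ∘ (multiplication by η) ∘ gradient`, which is linear only over the
  -- reals because `η` is real.
  refine ⟨-((B₂ ∘L B₁).restrictScalars ℝ ∘L mulOp), fun η => (isPerturbOperator_iff hΩ).2 ?_⟩
  intro y x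
  change inner ℂ (gradC hΩ x) (mulOp σ (gradC hΩ (-(W (mulOp η (gradC hΩ y)))))) = _
  rw [map_neg, map_neg, inner_neg_right, hW]

theorem existsUnique_isPerturbOperator {Ω : Set (Euc d)} (hΩ : IsBoundedLipschitzDomain Ω)
    {σ : LInf Ω} (hσ : σ ∈ LInfPos Ω) (η : LInf Ω) :
    ∃! P : H1C Ω →L[ℂ] H1C Ω, IsPerturbOperator σ η P := by
  obtain ⟨B, hB⟩ := exists_isPerturbOperator hΩ hσ
  refine ⟨B η, hB η, fun P hP => ContinuousLinearMap.ext fun y =>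
    eq_of_inner_gradC_eq hΩ hσ fun x => ?_⟩
  rw [(isPerturbOperator_iff hΩ).1 hP, (isPerturbOperator_iff hΩ).1 (hB η)]

theorem isPerturbOperator_perturbOp {Ω : Set (Euc d)} (hΩ : IsBoundedLipschitzDomain Ω)
    {σ : LInf Ω} (hσ : σ ∈ LInfPos Ω) (η : LInf Ω) : IsPerturbOperator σ η (perturbOp σ η) := by
  have h : ∃ P, IsPerturbOperator σ η P := (existsUnique_isPerturbOperator hΩ hσ η).exists
  rw [perturbOp, dif_pos h]
  exact h.choose_spec

theorem exists_perturbOp_eq {Ω : Set (Euc d)} (hΩ : IsBoundedLipschitzDomain Ω)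
    {σ : LInf Ω} (hσ : σ ∈ LInfPos Ω) :
    ∃ B : LInf Ω →L[ℝ] (H1C Ω →L[ℂ] H1C Ω), ∀ η, B η = perturbOp σ η := by
  obtain ⟨B, hB⟩ := exists_isPerturbOperator hΩ hσ
  exact ⟨B, fun η => (existsUnique_isPerturbOperator hΩ hσ η).unique (hB η)
    (isPerturbOperator_perturbOp hΩ hσ η)⟩

/-! ### The Neumann-to-Dirichlet map -/

/-- Solutions are free up to a constant; subtracting the constant part of the trace gives a solution
whose trace is exactly mean-free. -/
theorem isNDMap_tr_comp {Ω : Set (Euc d)} (hΩ : IsBoundedLipschitzDomain Ω) (hd : 2 ≤ d)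
    {σ : LInf Ω} (hσ : σ ∈ LInfPos Ω) : IsNDMap σ (tr Ω ∘L neumannOp σ) := by
  intro f
  obtain ⟨u, hu⟩ := h1Class_surjective (neumannOp σ f)
  obtain ⟨c, hc⟩ := hΩ.isMeanFreeTrace_tr hd u
  obtain ⟨v, hv⟩ := exists_smoothH1 (Ω := Ω) hΩ.isBounded (φ := fun _ => c) contDiff_const
  have hvc : v ∈ constH1 Ω := ⟨c, hv⟩
  have htv : trace Ω v = trace Ω u - h12mIncl (tr Ω (h1Class u)) := by
    refine h12_ext (Lp.ext ?_)
    have h1 : h12Fun (trace Ω v) =ᵐ[surf Ω] fun _ => c :=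
      hΩ.isTrace_trace hd _ contDiff_const v hv
    exact h1.trans (EventuallyEq.symm hc)
  have hcl : h1Class (u - v) = neumannOp σ f := by
    rw [← hu]
    exact h1Class_eq_iff.2 (by simpa using (constH1 Ω).neg_mem hvc)
  refine ⟨u - v, (isNeumannSolution_iff hΩ hd).2 fun x => ?_, ?_⟩
  · rw [hcl]
    exact inner_neumannOp hΩ hd hσ f x
  · rw [map_sub, htv, sub_sub_cancel, hu]
    rfl

theorem IsNDMap.eq_tr_comp {Ω : Set (Euc d)} (hΩ : IsBoundedLipschitzDomain Ω) (hd : 2 ≤ d)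
    {σ : LInf Ω} (hσ : σ ∈ LInfPos Ω) {L : Hneg12m Ω →L[ℂ] H12m Ω} (hL : IsNDMap σ L) :
    L = tr Ω ∘L neumannOp σ := by
  refine ContinuousLinearMap.ext fun f => ?_
  obtain ⟨u, hu, htu⟩ := hL f
  have hcl : h1Class u = neumannOp σ f := eq_of_inner_gradC_eq hΩ hσ fun x => by
    rw [(isNeumannSolution_iff hΩ hd).1 hu, inner_neumannOp hΩ hd hσ]
  rw [← sub_eq_zero]
  refine eq_zero_of_h12mIncl_mem ?_
  have h1 := hΩ.isMeanFreeTrace_tr hd u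
  rw [htu, hcl] at h1
  exact h1

theorem forwardMap_eq {Ω : Set (Euc d)} (hΩ : IsBoundedLipschitzDomain Ω) (hd : 2 ≤ d)
    {σ : LInf Ω} (hσ : σ ∈ LInfPos Ω) : forwardMap Ω σ = tr Ω ∘L neumannOp σ := by
  have h : ∃ L, IsNDMap σ L := ⟨_, isNDMap_tr_comp hΩ hd hσ⟩
  rw [forwardMap, dif_pos h]
  exact h.choose_spec.eq_tr_comp hΩ hd hσ

/-! ### The Neumann series and analyticity -/

/-- A series of powers of a bounded linear `B y` is a power series in `y`, with the ordered products
of the `B (y i)` as coefficients. Their norms grow at most like `‖B‖ ^ k`, which gives the radius;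
convergence to `f` is assumed. -/
theorem hasFPowerSeriesOnBall_of_hasSum_pow {X A Y : Type*} [NormedAddCommGroup X]
    [NormedSpace ℝ X] [NormedRing A] [NormedAlgebra ℝ A] [NormedAddCommGroup Y] [NormedSpace ℝ Y]
    (B : X →L[ℝ] A) (L : A →L[ℝ] Y) {f : X → Y} {x : X} {r : ℝ} (hr : 0 < r) (hrB : ‖B‖ * r ≤ 1)
    (h : ∀ y, ‖y‖ < r → HasSum (fun k => L (B y ^ k)) (f (x + y))) :
    HasFPowerSeriesOnBall f (fun k => L.compContinuousMultilinearMap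
      ((ContinuousMultilinearMap.mkPiAlgebraFin ℝ k A).compContinuousLinearMap fun _ => B))
      x (ENNReal.ofReal r) := by
  refine ⟨?_, by simpa using hr, fun {y} hy => ?_⟩
  · refine FormalMultilinearSeries.le_radius_of_bound _ (‖L‖ * max 1 ‖(1 : A)‖) fun k => ?_
    rw [Real.coe_toNNReal r hr.le]
    have h1 := L.norm_compContinuousMultilinearMap_le
      ((ContinuousMultilinearMap.mkPiAlgebraFin ℝ k A).compContinuousLinearMap fun _ => B)
    have h2 := (ContinuousMultilinearMap.mkPiAlgebraFin ℝ k A).norm_compContinuousLinearMap_le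
      (fun _ => B)
    have h3 : ‖ContinuousMultilinearMap.mkPiAlgebraFin ℝ k A‖ ≤ max 1 ‖(1 : A)‖ :=
      ContinuousMultilinearMap.norm_mkPiAlgebraFin_le
    rw [Finset.prod_const, Finset.card_univ, Fintype.card_fin] at h2
    have h4 : (‖B‖ * r) ^ k ≤ 1 := pow_le_one₀ (by positivity) hrB
    calc _ ≤ (‖L‖ * (max 1 ‖(1 : A)‖ * ‖B‖ ^ k)) * r ^ k := by
          refine mul_le_mul_of_nonneg_right (h1.trans ?_) (by positivity)
          refine mul_le_mul_of_nonneg_left (h2.trans ?_) (norm_nonneg _)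
          exact mul_le_mul_of_nonneg_right h3 (by positivity)
      _ = (‖L‖ * max 1 ‖(1 : A)‖) * (‖B‖ * r) ^ k := by rw [mul_pow]; ring
      _ ≤ _ := mul_le_of_le_one_right (by positivity) h4
  · have hy' : ‖y‖ < r := by
      rw [Metric.eball_ofReal, mem_ball_zero_iff] at hy
      exact hy
    refine (h y hy').congr_fun fun k => ?_
    simp [List.ofFn_const]

/-- For a solution `u` at `σ + η`, the form of `σ` applied to `u - P u` is the form of `σ` plus the
form of `η` applied to `u`, hence the boundary functional. So `u - P u` solves the problem at `σ`.
-/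
theorem neumannOp_add {Ω : Set (Euc d)} (hΩ : IsBoundedLipschitzDomain Ω) (hd : 2 ≤ d)
    {σ η : LInf Ω} (hσ : σ ∈ LInfPos Ω) (hση : σ + η ∈ LInfPos Ω) :
    (1 - perturbOp σ η) ∘L neumannOp (σ + η) = neumannOp σ := by
  refine ContinuousLinearMap.ext fun f => eq_of_inner_gradC_eq hΩ hσ fun x => ?_
  rw [inner_neumannOp hΩ hd hσ, ← inner_neumannOp hΩ hd hση]
  change inner ℂ (gradC hΩ x) (mulOp σ (gradC hΩ
    (neumannOp (σ + η) f - perturbOp σ η (neumannOp (σ + η) f)))) = _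
  rw [map_sub, map_sub, inner_sub_right,
    (isPerturbOperator_iff hΩ).1 (isPerturbOperator_perturbOp hΩ hσ η), sub_neg_eq_add,
    ← inner_add_right, map_add, add_apply]

/-- The operator `T ↦ tr T N(σ)`. -/
def sandwich {Ω : Set (Euc d)} (σ : LInf Ω) :
    (H1C Ω →L[ℂ] H1C Ω) →L[ℂ] (Hneg12m Ω →L[ℂ] H12m Ω) :=
  ContinuousLinearMap.compL ℂ (Hneg12m Ω) (H1C Ω) (H12m Ω) (tr Ω) ∘L
    (ContinuousLinearMap.compL ℂ (Hneg12m Ω) (H1C Ω) (H1C Ω)).flip (neumannOp σ)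

theorem sandwich_apply {Ω : Set (Euc d)} (σ : LInf Ω) (T : H1C Ω →L[ℂ] H1C Ω) :
    sandwich σ T = tr Ω ∘L T ∘L neumannOp σ := rfl

/-- The geometric series is a left inverse of `1 - P(σ, η)`. Only the norm of the operator matters
here, so the expansion is not confined to a ball of small `η`. -/
theorem hasSum_forwardMap_add {Ω : Set (Euc d)} (hΩ : IsBoundedLipschitzDomain Ω) (hd : 2 ≤ d)
    {σ η : LInf Ω} (hσ : σ ∈ LInfPos Ω) (hση : σ + η ∈ LInfPos Ω) (hP : ‖perturbOp σ η‖ < 1) :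
    HasSum (fun k : ℕ => sandwich σ (perturbOp σ η ^ k)) (forwardMap Ω (σ + η)) := by
  have h1 := (summable_geometric_of_norm_lt_one hP).hasSum.mapL (sandwich σ)
  have h2 : sandwich σ (∑' k : ℕ, perturbOp σ η ^ k) = forwardMap Ω (σ + η) := by
    have h3 : (∑' k : ℕ, perturbOp σ η ^ k) ∘L (1 - perturbOp σ η) = 1 :=
      geom_series_mul_neg _ hP
    rw [sandwich_apply, forwardMap_eq hΩ hd hση, ← neumannOp_add hΩ hd hσ hση,
      ← ContinuousLinearMap.comp_assoc (∑' k : ℕ, perturbOp σ η ^ k), h3]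
    rfl
  rwa [h2] at h1

theorem exists_hasFPowerSeriesOnBall_forwardMap {Ω : Set (Euc d)}
    (hΩ : IsBoundedLipschitzDomain Ω) (hd : 2 ≤ d) {σ : LInf Ω} (hσ : σ ∈ LInfPos Ω) :
    ∃ (p : FormalMultilinearSeries ℝ (LInf Ω) (Hneg12m Ω →L[ℂ] H12m Ω)) (r : ℝ≥0∞),
      HasFPowerSeriesOnBall (forwardMap Ω) p σ r ∧ ∀ (k : ℕ) (η : Fin k → LInf Ω),
        p k η = tr Ω ∘L (List.ofFn fun i => perturbOp σ (η i)).prod ∘L neumannOp σ := by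
  obtain ⟨B, hB⟩ := exists_perturbOp_eq hΩ hσ
  obtain ⟨ε, hε, hball⟩ := Metric.isOpen_iff.1 (isOpen_lInfPos Ω) σ hσ
  have hB1 : 0 < ‖B‖ + 1 := by positivity
  -- The first bound keeps `σ + η` in `LInfPos Ω`, the second makes the perturbation operator a
  -- contraction; the added one covers `B = 0`.
  set r := min ε (‖B‖ + 1)⁻¹ with hr
  have hr0 : 0 < r := lt_min hε (inv_pos.2 hB1)
  have hrB : (‖B‖ + 1) * r ≤ 1 := by
    calc (‖B‖ + 1) * r ≤ (‖B‖ + 1) * (‖B‖ + 1)⁻¹ :=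
          mul_le_mul_of_nonneg_left (min_le_right _ _) hB1.le
      _ = 1 := mul_inv_cancel₀ hB1.ne'
  refine ⟨_, _, hasFPowerSeriesOnBall_of_hasSum_pow B ((sandwich σ).restrictScalars ℝ) hr0
    (by linarith) fun η hη => ?_, fun k η => ?_⟩
  · have h1 : σ + η ∈ LInfPos Ω := hball (by
      rw [Metric.mem_ball, dist_eq_norm, add_sub_cancel_left]
      exact hη.trans_le (min_le_left _ _))
    have h2 : ‖perturbOp σ η‖ < 1 := by
      rw [← hB]
      have h3 := B.le_opNorm η
      have h4 := mul_le_mul_of_nonneg_left hη.le (norm_nonneg B)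
      linarith
    rw [hB]
    exact hasSum_forwardMap_add hΩ hd hσ h1 h2
  · rw [← sandwich_apply]
    simp only [ContinuousLinearMap.compContinuousMultilinearMap_coe, Function.comp_apply,
      ContinuousMultilinearMap.compContinuousLinearMap_apply,
      ContinuousMultilinearMap.mkPiAlgebraFin_apply, hB]
    rfl

theorem analyticOnNhd_forwardMap {Ω : Set (Euc d)} (hΩ : IsBoundedLipschitzDomain Ω)
    (hd : 2 ≤ d) : AnalyticOnNhd ℝ (forwardMap Ω) (LInfPos Ω) := by
  intro σ hσ
  obtain ⟨p, r, hp, -⟩ := exists_hasFPowerSeriesOnBall_forwardMap hΩ hd hσ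
  exact hp.analyticAt

/-- The coefficients are ordered products and need not be symmetric. The derivative of a power
series at its centre is the sum of its coefficient over all orders of the arguments. -/
theorem iteratedFDeriv_forwardMap {Ω : Set (Euc d)} (hΩ : IsBoundedLipschitzDomain Ω)
    (hd : 2 ≤ d) {σ : LInf Ω} (hσ : σ ∈ LInfPos Ω) (k : ℕ) (η : Fin k → LInf Ω) :
    iteratedFDeriv ℝ k (forwardMap Ω) σ η = ∑ α : Equiv.Perm (Fin k),
      tr Ω ∘L (List.ofFn fun i => perturbOp σ (η (α i))).prod ∘L neumannOp σ := by
  obtain ⟨p, r, hp, hpk⟩ := exists_hasFPowerSeriesOnBall_forwardMap hΩ hd hσ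
  rw [hp.iteratedFDeriv_eq_sum_of_completeSpace]
  exact Finset.sum_congr rfl fun α _ => hpk k _

/-- With equal arguments all `k!` summands coincide, so the Taylor terms are the terms of the
Neumann series. -/
theorem iteratedFDeriv_forwardMap_diag {Ω : Set (Euc d)} (hΩ : IsBoundedLipschitzDomain Ω)
    (hd : 2 ≤ d) {σ : LInf Ω} (hσ : σ ∈ LInfPos Ω) (k : ℕ) (η : LInf Ω) :
    (k.factorial : ℝ)⁻¹ • iteratedFDeriv ℝ k (forwardMap Ω) σ (fun _ => η)
      = tr Ω ∘L (perturbOp σ η ^ k) ∘L neumannOp σ := by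
  rw [iteratedFDeriv_forwardMap hΩ hd hσ, Finset.sum_const, Finset.card_univ, Fintype.card_perm,
    Fintype.card_fin, List.ofFn_const, List.prod_replicate, ← Nat.cast_smul_eq_nsmul ℝ, smul_smul,
    inv_mul_cancel₀ (Nat.cast_ne_zero.2 k.factorial_ne_zero), one_smul]

end EIT

end

end

theorem mainTheorem4 {d : ℕ} (hd : 2 ≤ d) (Ω : Set (Euc d)) (hΩ : IsBoundedLipschitzDomain Ω) :
    -- the trace maps, the solution operators and the forward map are well defined
    ((∃! T : H1 Ω →L[ℂ] H12 Ω, IsTrace Ω T) ∧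
      (∃! T : H1C Ω →L[ℂ] H12m Ω, IsMeanFreeTrace Ω T) ∧
      (∀ σ ∈ LInfPos Ω, ∃! N : Hneg12m Ω →L[ℂ] H1C Ω, IsNeumannOperator σ N) ∧
      (∀ σ ∈ LInfPos Ω, ∀ η : LInf Ω, ∃! P : H1C Ω →L[ℂ] H1C Ω, IsPerturbOperator σ η P) ∧
      (∀ σ ∈ LInfPos Ω, ∃! L : Hneg12m Ω →L[ℂ] H12m Ω, IsNDMap σ L)) ∧
    -- infinite continuous Fréchet differentiability on an open set
    IsOpen (LInfPos Ω) ∧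
    ContDiffOn ℝ ((⊤ : ℕ∞) : WithTop ℕ∞) (forwardMap Ω) (LInfPos Ω) ∧
    -- the formula for the derivatives
    (∀ σ ∈ LInfPos Ω, ∀ (k : ℕ) (η : Fin k → LInf Ω),
      iteratedFDeriv ℝ k (forwardMap Ω) σ η =
        ∑ α : Equiv.Perm (Fin k),
          tr Ω ∘L (List.ofFn fun i => perturbOp σ (η (α i))).prod ∘L neumannOp σ) ∧
    -- analyticity, with the Taylor series being a Neumann series
    AnalyticOnNhd ℝ (forwardMap Ω) (LInfPos Ω) ∧
    (∀ σ ∈ LInfPos Ω, ∀ η : LInf Ω, σ + η ∈ LInfPos Ω → ‖perturbOp σ η‖ < 1 →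
      HasSum (fun k : ℕ => (k.factorial : ℝ)⁻¹ •
        iteratedFDeriv ℝ k (forwardMap Ω) σ (fun _ => η)) (forwardMap Ω (σ + η)) ∧
      HasSum (fun k : ℕ => tr Ω ∘L (perturbOp σ η ^ k) ∘L neumannOp σ)
        (forwardMap Ω (σ + η))) := by
  refine ⟨⟨hΩ.existsUnique_isTrace hd, hΩ.existsUnique_isMeanFreeTrace hd,
    fun σ hσ => existsUnique_isNeumannOperator hΩ hd hσ,
    fun σ hσ η => existsUnique_isPerturbOperator hΩ hσ η,
    fun σ hσ => ⟨_, isNDMap_tr_comp hΩ hd hσ, fun L hL => hL.eq_tr_comp hΩ hd hσ⟩⟩,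
    isOpen_lInfPos Ω, fun σ hσ => (analyticOnNhd_forwardMap hΩ hd σ hσ).contDiffAt.contDiffWithinAt,
    fun σ hσ k η => iteratedFDeriv_forwardMap hΩ hd hσ k η, analyticOnNhd_forwardMap hΩ hd,
    fun σ hσ η hση hP => ?_⟩
  have h := hasSum_forwardMap_add hΩ hd hσ hση hP
  refine ⟨?_, h⟩
  simp_rw [iteratedFDeriv_forwardMap_diag hΩ hd hσ]
  exact h
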